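/- A tournament on a finite set $V$ of alternatives has, for every two distinct alternatives $a,b$, exactly one of the edges $a\succ b$ ("$a$ dominates $b$") and $b\succ a$. For $n=2^r$ alternatives, a *bracket* is a bijective assignment of the alternatives to the $n$ leaves of the balanced binary tree of height $r$; the winner of a leaf is the alternative placed there, and the winner of the subtree at an inner node is whichever of the winners of its two child subtrees dominates the other. An alternative is a *single-elimination winner* if it is the winner of the whole tree under some bracket. An alternative $y$ is a *superking* of a tournament on $m$ alternatives if for every $x'\succ y$ there are at least $\log_2 m$ alternatives $x''$ with $y\succ x''$ and $x''\succ x'$. In the *generalized random model* with parameters $p_{i,j}$ ($i\ne j$, $p_{i,j}+p_{j,i}=1$), alternative $x_i$ dominates $x_j$ with probability $p_{i,j}$, independently over all unordered pairs of alternatives. **Theorem.** There are a deterministic algorithm and a polynomial $q$ such that: 1. for every $n=2^r$, every tournament $T$ on $n$ alternatives and every alternative $x$, the algorithm on input $(T,x)$ halts within $q(n)$ steps (on a random access machine with logarithmic costs); 2. for every $\varepsilon>0$ there is $r_0$ such that for all $r\ge r_0$ and $n=2^r$, if $T$ is generated from the generalized random model on $n$ alternatives with $$p_{i,j}\in\left[\frac{100\log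 n}{n},\,1-\frac{100\log n}{n}\right]\quad\text{for all } i\neq j$$ ($\log$ is the natural logarithm), then with probability at least $1-\varepsilon$ all alternatives of $T$ are single-elimination winners, and for every alternative $x$ the algorithm outputs on input $(T,x)$ a bracket under which $x$ wins. Moreover, in 2. the bracket output for $x$ has the following form: $x$ is placed at the first leaf, and for each $1\le i\le r$ the block of $2^{i-1}$ alternatives at the leaves $2^{i-1},\dots,2^i-1$ (leaves numbered from $0$), whose winner $x$ meets in round $i$, is won by an alternative that is a superking of the tournament restricted to this block. -/

import Mathlib

open MeasureTheory

/-! ### Tournaments, brackets, single-elimination winners, superkings -/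

/-- A tournament on the set `V` of alternatives: `T.dom a b = true` means that `a` dominates `b`.
Between any two distinct alternatives there is exactly one edge, and there are no loops. -/
structure Tournament (V : Type) where
  dom : V → V → Bool
  irrefl : ∀ a, dom a a = false
  antisymm : ∀ a b, a ≠ b → dom b a = !dom a b

namespace Tournament

variable {V : Type}

/-- The winner of the match between `a` and `b`. -/
def matchWinner (T : Tournament V) (a b : V) : V := if T.dom a b then a else b

/-- The winner of the balanced binary tree of height `k` whose leaves `0, …, 2 ^ k - 1`, from left
to right, carry the alternatives `f 0, …, f (2 ^ k - 1)`. -/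
def winner (T : Tournament V) : (k : ℕ) → (Fin (2 ^ k) → V) → V
  | 0, f => f 0
  | k + 1, f =>
      T.matchWinner
        (T.winner k fun i => f ⟨i, by have := i.2; rw [pow_succ]; omega⟩)
        (T.winner k fun i => f ⟨2 ^ k + i, by have := i.2; rw [pow_succ]; omega⟩)

/-- `y` belongs to `S` and is a superking of the tournament `T` restricted to `S`: for every
alternative `x'` of `S` that dominates `y`, at least `log₂ |S|` alternatives `x''` of `S` are
dominated by `y` and dominate `x'`. -/
def IsSuperkingIn (T : Tournament V) (S : Finset V) (y : V) : Prop :=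
  y ∈ S ∧ ∀ x' ∈ S, T.dom x' y = true →
    Real.logb 2 (S.card : ℝ) ≤
      ((S.filter fun x'' => T.dom y x'' = true ∧ T.dom x'' x' = true).card : ℝ)

end Tournament

/-- A bracket for `2 ^ r` alternatives: a bijective assignment of the alternatives to the leaves
`0, …, 2 ^ r - 1` of the balanced binary tree of height `r`. -/
abbrev SEBracket (V : Type) (r : ℕ) : Type := Fin (2 ^ r) ≃ V

namespace SEBracket

variable {V : Type} {r : ℕ}

/-- The leftmost leaf. -/
def first (σ : SEBracket V r) : V := σ ⟨0, by positivity⟩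

/-- The block of the leaves `2 ^ i, …, 2 ^ (i + 1) - 1` (for `i < r`), which are the leaves of a
subtree of height `i`: the alternative at leaf `0`, as long as it wins, meets the winner of this
block in round `i + 1`. -/
def block (σ : SEBracket V r) (i : Fin r) : Fin (2 ^ (i : ℕ)) → V := fun j =>
  σ ⟨2 ^ (i : ℕ) + j, by
    have h₁ := j.2
    have h₂ : 2 ^ ((i : ℕ) + 1) ≤ 2 ^ r := Nat.pow_le_pow_right (by norm_num) i.2
    rw [pow_succ] at h₂
    omega⟩

/-- The set of the alternatives in the `i`-th block. -/
def blockSet (σ : SEBracket V r) (i : Fin r) : Finset V :=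
  Finset.univ.map ⟨σ.block i, fun a b h => by
    have h' := congrArg Fin.val (σ.injective h)
    simp only [] at h'
    exact Fin.ext (by omega)⟩

end SEBracket

namespace Tournament

variable {V : Type} {r : ℕ}

/-- `x` wins the single-elimination tournament with bracket `σ`. -/
def WinsUnder (T : Tournament V) (σ : SEBracket V r) (x : V) : Prop := T.winner r σ = x

/-- `x` is a single-elimination winner (among `2 ^ r` alternatives). -/
def IsSingleEliminationWinner (T : Tournament (Fin (2 ^ r))) (x : Fin (2 ^ r)) : Prop :=
  ∃ σ : SEBracket (Fin (2 ^ r)) r, T.WinsUnder σ x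

/-- The bracket `σ` puts `x` at its first leaf, and divides the other alternatives into blocks of
sizes `1, 2, 4, …, 2 ^ (r - 1)` such that each block is won by an alternative that is a superking
of the tournament restricted to the block. -/
def HasSuperkingBlocks (T : Tournament V) (σ : SEBracket V r) (x : V) : Prop :=
  σ.first = x ∧ ∀ i : Fin r, T.IsSuperkingIn (σ.blockSet i) (T.winner i (σ.block i))

end Tournament

/-! ### The generalized random model -/

/-- The unordered pairs of distinct alternatives, as pairs `(i, j)` with `i < j`. -/
abbrev EdgePair (n : ℕ) : Type := {e : Fin n × Fin n // e.1 < e.2}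

/-- The tournament in which, for `i < j`, alternative `i` dominates `j` iff `o (i, j) = true`. -/
def Tournament.ofOrientation {n : ℕ} (o : EdgePair n → Bool) : Tournament (Fin n) where
  dom i j :=
    if h : i < j then o ⟨(i, j), h⟩ else if h : j < i then !o ⟨(j, i), h⟩ else false
  irrefl i := by simp
  antisymm i j hij := by
    rcases lt_or_gt_of_ne hij with h | h
    · simp [h, not_lt_of_gt h]
    · simp [h, not_lt_of_gt h]

/-- The law on `Bool` that gives `true` the mass `t` and `false` the mass `1 - t`. -/
noncomputable def coinLaw (t : ℝ) : Measure Bool :=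
  ENNReal.ofReal t • Measure.dirac true + ENNReal.ofReal (1 - t) • Measure.dirac false

instance coinLaw_isFinite (t : ℝ) : IsFiniteMeasure (coinLaw t) :=
  ⟨by simp [coinLaw, ENNReal.add_lt_top]⟩

instance Tournament.instMeasurableSpace (V : Type) : MeasurableSpace (Tournament V) := ⊤

/-- The law of a tournament generated from the generalized random model with parameters `p`:
independently for all pairs `i < j`, alternative `i` dominates `j` with probability `p i j`, and
otherwise `j` dominates `i`. -/
noncomputable def generalizedRandomModel {n : ℕ} (p : Fin n → Fin n → ℝ) :
    Measure (Tournament (Fin n)) :=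
  (Measure.pi fun e : EdgePair n => coinLaw (p e.1.1 e.1.2)).map Tournament.ofOrientation

/-! ### A random access machine with logarithmic costs

Programs of a small imperative language over natural numbers, with scalar variables and arrays (both
named by natural numbers). The cost is logarithmic: each evaluated subexpression costs one plus the
bit length of its value. -/

/-- Arithmetic expressions: constants, variables, array entries, sums, truncated differences and
products. -/
inductive RamExp : Type
  | const (c : ℕ)
  | var (v : ℕ)
  | entry (a : ℕ) (i : RamExp)
  | add (e₁ e₂ : RamExp)
  | sub (e₁ e₂ : RamExp)
  | mul (e₁ e₂ : RamExp)

/-- Programs. -/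
inductive RamProg : Type
  | skip
  | assign (v : ℕ) (e : RamExp)
  | store (a : ℕ) (i e : RamExp)
  | seq (c₁ c₂ : RamProg)
  | ite (e : RamExp) (c₁ c₂ : RamProg)
  | loop (e : RamExp) (c : RamProg)

/-- A memory state: the values of the variables and the contents of the arrays. -/
structure RamState where
  var : ℕ → ℕ
  arr : ℕ → ℕ → ℕ

namespace RamExp

/-- The value of an expression. -/
def eval (s : RamState) : RamExp → ℕ
  | const c => c
  | var v => s.var v
  | entry a i => s.arr a (i.eval s)
  | add e₁ e₂ => e₁.eval s + e₂.eval s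
  | sub e₁ e₂ => e₁.eval s - e₂.eval s
  | mul e₁ e₂ => e₁.eval s * e₂.eval s

/-- The cost of evaluating an expression: every subexpression is charged one plus the bit length of
its value. -/
def cost (s : RamState) : RamExp → ℕ
  | const c => 1 + c.size
  | var v => 1 + (s.var v).size
  | entry a i => i.cost s + 1 + (s.arr a (i.eval s)).size
  | add e₁ e₂ => e₁.cost s + e₂.cost s + 1 + (e₁.eval s + e₂.eval s).size
  | sub e₁ e₂ => e₁.cost s + e₂.cost s + 1 + (e₁.eval s - e₂.eval s).size
  | mul e₁ e₂ => e₁.cost s + e₂.cost s + 1 + (e₁.eval s * e₂.eval s).size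

end RamExp

namespace RamState

/-- Assign the value `x` to the variable `v`. -/
def setVar (s : RamState) (v x : ℕ) : RamState :=
  { s with var := Function.update s.var v x }

/-- Write the value `x` into entry `i` of the array `a`. -/
def setArr (s : RamState) (a i x : ℕ) : RamState :=
  { s with arr := Function.update s.arr a (Function.update (s.arr a) i x) }

end RamState

/-- `Runs c s t s'`: the program `c`, started in state `s`, halts in state `s'` after `t` steps.
A condition is true if its value is not zero; `loop e c` repeats `c` while `e` is true. -/
inductive Runs : RamProg → RamState → ℕ → RamState → Prop
  | skip (s : RamState) : Runs .skip s 1 s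
  | assign (v : ℕ) (e : RamExp) (s : RamState) :
      Runs (.assign v e) s (1 + e.cost s) (s.setVar v (e.eval s))
  | store (a : ℕ) (i e : RamExp) (s : RamState) :
      Runs (.store a i e) s (1 + i.cost s + e.cost s) (s.setArr a (i.eval s) (e.eval s))
  | seq {c₁ c₂ : RamProg} {s s₁ s₂ : RamState} {t₁ t₂ : ℕ} :
      Runs c₁ s t₁ s₁ → Runs c₂ s₁ t₂ s₂ → Runs (.seq c₁ c₂) s (t₁ + t₂) s₂
  | ite_true {e : RamExp} {c₁ c₂ : RamProg} {s s₁ : RamState} {t : ℕ} :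
      e.eval s ≠ 0 → Runs c₁ s t s₁ → Runs (.ite e c₁ c₂) s (1 + e.cost s + t) s₁
  | ite_false {e : RamExp} {c₁ c₂ : RamProg} {s s₁ : RamState} {t : ℕ} :
      e.eval s = 0 → Runs c₂ s t s₁ → Runs (.ite e c₁ c₂) s (1 + e.cost s + t) s₁
  | loop_true {e : RamExp} {c : RamProg} {s s₁ s₂ : RamState} {t₁ t₂ : ℕ} :
      e.eval s ≠ 0 → Runs c s t₁ s₁ → Runs (.loop e c) s₁ t₂ s₂ →
        Runs (.loop e c) s (1 + e.cost s + t₁ + t₂) s₂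
  | loop_false {e : RamExp} {c : RamProg} {s : RamState} :
      e.eval s = 0 → Runs (.loop e c) s (1 + e.cost s) s

/-- The input: variable `0` holds the number `n` of alternatives, variable `1` holds the
alternative `x`, array `0` holds the dominance matrix of `T` row by row (entry `i * n + j` is `1` if
`i` dominates `j`, and `0` otherwise); everything else is `0`. -/
def inputState {n : ℕ} (T : Tournament (Fin n)) (x : Fin n) : RamState where
  var v := if v = 0 then n else if v = 1 then x else 0
  arr a k :=
    if a = 0 then
      if h : 0 < n ∧ k < n * n then
        (T.dom ⟨k / n, Nat.div_lt_of_lt_mul h.2⟩ ⟨k % n, Nat.mod_lt k h.1⟩).toNat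
      else 0
    else 0

/-- The output: entry `i` of array `1` is the alternative at leaf `i` of the bracket `σ`. -/
def OutputsBracket {r : ℕ} (s : RamState) (σ : SEBracket (Fin (2 ^ r)) r) : Prop :=
  ∀ i : Fin (2 ^ r), s.arr 1 i = (σ i : ℕ)

/-! Write `n = 2 ^ r = 128 * m`. If `x` dominates `r` distinct kings, and the alternatives other
than `x` can be divided into blocks of sizes `1, 2, ..., 2 ^ (r - 1)` such that the `i`-th king lies
in the `i`-th block and can win it, then `x` wins.

A superking `y` of a set of `2 ^ i` alternatives can win it. For `b` dominating `y`, call `a` a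
helper against `b` if `y` dominates `a` and `a` dominates `b`. In each round let `y` beat somebody,
then match helpers against alternatives dominating `y` as long as possible, then make all remaining
matches that can be made. In a tournament a maximal matching leaves at most one player, so by parity
nobody is left. A survivor `b` that dominates `y` was unmatched after the second phase; by
maximality all its helpers were matched by then, and a helper can have lost only to `y`. So the
number of helpers drops by at most one per round, just like the base-two logarithm of the number of
players, and `y` remains a superking (`RoundInvariant.next`). A superking among at least two players
always finds somebody to beat (`RoundInvariant.king_wins`). The lists of losers unfold into the
bracket (`IsRoundTable.exists_bracket`).

As kings serve alternatives dominated by `x` that dominate at least `15 n / 32 = 60 m` others. Each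
of the first `r - 2` blocks consists of its king and alternatives dominated by him, so nobody there
dominates him. The blocks of sizes `n / 4` and `n / 2` are too large for this. They receive
reserves, disjoint from each other, of `13 m` alternatives dominated by the king, and are then
filled arbitrarily. It is enough that every alternative other than the kings concerned is dominated
by `2 r` members of the reserve. The condition `IsTypical` collects what is needed of the
tournament, and `run_main` is the deterministic conclusion.

In every tournament at least `8 m` alternatives other than `x` have outdegree at least `60 m` even
without counting `x` (`le_card_strong`); this set is independent of the edges at `x`. Likewise a
reserve depends only on the edges at one or two kings and not on those between another `z` and the
remaining alternatives. After conditioning, both requirements count successes of independent coins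
of bias at least `100 log n / n`. An exponential Markov inequality (`measureReal_card_filter_lt_le`)
and a union bound leave a failure probability of at most `3 n ^ (-1/4)`.

The algorithm is written with counting loops up to `n` and with stored values truncated at `n`, so
that its running time is polynomial by induction on the syntax (`exists_polynomial_runs`); its
correctness is proved with loop invariants (`forN_induction`). -/

/-! ### Programs with counting loops and bounded values -/

/-- Programs whose loops are counting loops up to the value `n` of variable `0`, and whose stored
values are truncated at `n`. -/
inductive ForProg : Type
  | skip
  | assign (v : ℕ) (e : RamExp)
  | store (a : ℕ) (i e : RamExp)
  | seq (c₁ c₂ : ForProg)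
  | ite (e : RamExp) (c₁ c₂ : ForProg)
  | forN (v : ℕ) (c : ForProg)

namespace ForProg

/-- The state reached by a program. -/
def run : ForProg → RamState → RamState
  | skip, s => s
  | assign v e, s => s.setVar v (min (e.eval s) (s.var 0))
  | store a i e, s => s.setArr a (i.eval s) (min (e.eval s) (s.var 0))
  | seq c₁ c₂, s => c₂.run (c₁.run s)
  | ite e c₁ c₂, s => if e.eval s ≠ 0 then c₁.run s else c₂.run s
  | forN v c, s =>
      (fun s => (c.run s).setVar v ((c.run s).var v + 1))^[s.var 0] (s.setVar v 0)

/-- Whether a program contains an assignment to the variable `v`. -/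
def writesVar (v : ℕ) : ForProg → Bool
  | skip => false
  | assign w _ => w == v
  | store _ _ _ => false
  | seq c₁ c₂ => c₁.writesVar v || c₂.writesVar v
  | ite _ c₁ c₂ => c₁.writesVar v || c₂.writesVar v
  | forN w c => w == v || c.writesVar v

/-- Whether a program writes to the array `a`. -/
def writesArr (a : ℕ) : ForProg → Bool
  | skip => false
  | assign _ _ => false
  | store b _ _ => b == a
  | seq c₁ c₂ => c₁.writesArr a || c₂.writesArr a
  | ite _ c₁ c₂ => c₁.writesArr a || c₂.writesArr a
  | forN _ c => c.writesArr a

/-- Variable `0` is never written, and no loop changes its counter. -/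
def wellFormed : ForProg → Bool
  | skip => true
  | assign w _ => w != 0
  | store _ _ _ => true
  | seq c₁ c₂ => c₁.wellFormed && c₂.wellFormed
  | ite _ c₁ c₂ => c₁.wellFormed && c₂.wellFormed
  | forN w c => w != 0 && !c.writesVar w && c.wellFormed

/-- The expression `min e (var 0)`. -/
def truncExp (e : RamExp) : RamExp := .sub e (.sub e (.var 0))

/-- Translation into programs of the random access machine. -/
def compile : ForProg → RamProg
  | skip => .skip
  | assign v e => .assign v (truncExp e)
  | store a i e => .store a i (truncExp e)
  | seq c₁ c₂ => .seq c₁.compile c₂.compile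
  | ite e c₁ c₂ => .ite e c₁.compile c₂.compile
  | forN v c =>
      .seq (.assign v (.const 0))
        (.loop (.sub (.var 0) (.var v))
          (.seq c.compile (.assign v (.add (.var v) (.const 1)))))

end ForProg

namespace RamState

@[simp] lemma setVar_var_self (s : RamState) (v x : ℕ) : (s.setVar v x).var v = x := by
  simp [setVar]

lemma setVar_var (s : RamState) (v x w : ℕ) :
    (s.setVar v x).var w = if w = v then x else s.var w := by
  simp [setVar, Function.update_apply]

@[simp] lemma setVar_var_of_ne (s : RamState) {v w : ℕ} (x : ℕ) (h : w ≠ v) :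
    (s.setVar v x).var w = s.var w := by
  simp [setVar, h]

@[simp] lemma setVar_arr (s : RamState) (v x : ℕ) : (s.setVar v x).arr = s.arr := rfl

@[simp] lemma setArr_var (s : RamState) (a i x : ℕ) : (s.setArr a i x).var = s.var := rfl

lemma setArr_arr_self (s : RamState) (a i x j : ℕ) :
    (s.setArr a i x).arr a j = if j = i then x else s.arr a j := by
  simp [setArr, Function.update_apply]

@[simp] lemma setArr_arr_of_ne (s : RamState) {a b : ℕ} (i x : ℕ) (h : b ≠ a) :
    (s.setArr a i x).arr b = s.arr b := by
  simp [setArr, h]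

/-- All values in the memory are at most `n`, the positive value of variable `0`. -/
structure Bounded (s : RamState) (n : ℕ) : Prop where
  pos : 1 ≤ n
  var_zero : s.var 0 = n
  var_le : ∀ v, s.var v ≤ n
  arr_le : ∀ a i, s.arr a i ≤ n

lemma Bounded.setVar {s : RamState} {n : ℕ} (hs : s.Bounded n) {v x : ℕ} (hv : v ≠ 0)
    (hx : x ≤ n) : (s.setVar v x).Bounded n where
  pos := hs.pos
  var_zero := by rw [setVar_var_of_ne _ _ hv.symm, hs.var_zero]
  var_le w := by
    rw [setVar_var]; split_ifs
    · exact hx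
    · exact hs.var_le w
  arr_le := hs.arr_le

lemma Bounded.setArr {s : RamState} {n : ℕ} (hs : s.Bounded n) {a i x : ℕ}
    (hx : x ≤ n) : (s.setArr a i x).Bounded n where
  pos := hs.pos
  var_zero := hs.var_zero
  var_le := hs.var_le
  arr_le b j := by
    by_cases h : b = a
    · subst h
      rw [setArr_arr_self]; split_ifs
      · exact hx
      · exact hs.arr_le _ _
    · rw [setArr_arr_of_ne _ _ _ h]; exact hs.arr_le _ _

end RamState

lemma Nat.size_le_self' (n : ℕ) : n.size ≤ n := Nat.size_le.2 Nat.lt_two_pow_self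

/-- The value and the cost of an expression are polynomially bounded on bounded states. -/
lemma RamExp.exists_polynomial_bound (e : RamExp) :
    ∃ P Q : Polynomial ℕ, ∀ (s : RamState) (n : ℕ), s.Bounded n →
      e.eval s ≤ P.eval n ∧ e.cost s ≤ Q.eval n := by
  induction e with
  | const c =>
    refine ⟨.C c, .C (1 + c.size), fun s n _ => ?_⟩
    simp [eval, cost]
  | var v =>
    refine ⟨.X, 1 + .X, fun s n hs => ?_⟩
    have h := hs.var_le v
    have h' := Nat.size_le_self' (s.var v)
    simp only [eval, cost, Polynomial.eval_X, Polynomial.eval_add, Polynomial.eval_one]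
    omega
  | entry a i ih =>
    obtain ⟨P, Q, h⟩ := ih
    refine ⟨.X, Q + 1 + .X, fun s n hs => ?_⟩
    have h₁ := hs.arr_le a (i.eval s)
    have h₂ := Nat.size_le_self' (s.arr a (i.eval s))
    have h₃ := (h s n hs).2
    simp only [eval, cost, Polynomial.eval_X, Polynomial.eval_add, Polynomial.eval_one]
    omega
  | add e₁ e₂ ih₁ ih₂ =>
    obtain ⟨P₁, Q₁, h₁⟩ := ih₁
    obtain ⟨P₂, Q₂, h₂⟩ := ih₂
    refine ⟨P₁ + P₂, Q₁ + Q₂ + 1 + (P₁ + P₂), fun s n hs => ?_⟩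
    have g₁ := h₁ s n hs
    have g₂ := h₂ s n hs
    have h' := Nat.size_le_self' (e₁.eval s + e₂.eval s)
    simp only [eval, cost, Polynomial.eval_add, Polynomial.eval_one]
    omega
  | sub e₁ e₂ ih₁ ih₂ =>
    obtain ⟨P₁, Q₁, h₁⟩ := ih₁
    obtain ⟨P₂, Q₂, h₂⟩ := ih₂
    refine ⟨P₁, Q₁ + Q₂ + 1 + P₁, fun s n hs => ?_⟩
    have g₁ := h₁ s n hs
    have g₂ := h₂ s n hs
    have h' := Nat.size_le_self' (e₁.eval s - e₂.eval s)
    simp only [eval, cost, Polynomial.eval_add, Polynomial.eval_one]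
    omega
  | mul e₁ e₂ ih₁ ih₂ =>
    obtain ⟨P₁, Q₁, h₁⟩ := ih₁
    obtain ⟨P₂, Q₂, h₂⟩ := ih₂
    refine ⟨P₁ * P₂, Q₁ + Q₂ + 1 + (P₁ * P₂), fun s n hs => ?_⟩
    have g₁ := h₁ s n hs
    have g₂ := h₂ s n hs
    have h' := Nat.size_le_self' (e₁.eval s * e₂.eval s)
    have h'' := Nat.mul_le_mul g₁.1 g₂.1
    simp only [eval, cost, Polynomial.eval_add, Polynomial.eval_one, Polynomial.eval_mul]
    omega

namespace ForProg

lemma truncExp_eval (e : RamExp) (s : RamState) :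
    (truncExp e).eval s = min (e.eval s) (s.var 0) := by
  simp only [truncExp, RamExp.eval]; omega

/-- Frame rule. Since `writesVar` is computed from the syntax, the hypothesis holds by `rfl` for
most concrete programs below; the next lemma does the same for arrays. -/
lemma run_var_of_not_writesVar {v : ℕ} {c : ForProg} (hc : c.writesVar v = false)
    (s : RamState) : (c.run s).var v = s.var v := by
  induction c generalizing s with
  | skip => rfl
  | assign w e =>
    simp only [writesVar, beq_eq_false_iff_ne] at hc
    simp [run, hc.symm]
  | store a i e => rfl
  | seq c₁ c₂ ih₁ ih₂ =>
    simp only [writesVar, Bool.or_eq_false_iff] at hc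
    simp only [run]; rw [ih₂ hc.2, ih₁ hc.1]
  | ite e c₁ c₂ ih₁ ih₂ =>
    simp only [writesVar, Bool.or_eq_false_iff] at hc
    simp only [run]; split_ifs
    · exact ih₁ hc.1 s
    · exact ih₂ hc.2 s
  | forN w c ih =>
    simp only [writesVar, Bool.or_eq_false_iff, beq_eq_false_iff_ne] at hc
    simp only [run]
    have key : ∀ (k : ℕ) (s : RamState),
        ((fun s => (c.run s).setVar w ((c.run s).var w + 1))^[k] s).var v = s.var v := by
      intro k
      induction k with
      | zero => intro s; rfl
      | succ k ihk =>
        intro s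
        rw [Function.iterate_succ_apply, ihk, RamState.setVar_var_of_ne _ _ hc.1.symm, ih hc.2]
    rw [key, RamState.setVar_var_of_ne _ _ hc.1.symm]

lemma run_arr_of_not_writesArr {a : ℕ} {c : ForProg} (hc : c.writesArr a = false)
    (s : RamState) : (c.run s).arr a = s.arr a := by
  induction c generalizing s with
  | skip => rfl
  | assign w e => rfl
  | store b i e =>
    simp only [writesArr, beq_eq_false_iff_ne] at hc
    simp [run, hc.symm]
  | seq c₁ c₂ ih₁ ih₂ =>
    simp only [writesArr, Bool.or_eq_false_iff] at hc
    simp only [run]; rw [ih₂ hc.2, ih₁ hc.1]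
  | ite e c₁ c₂ ih₁ ih₂ =>
    simp only [writesArr, Bool.or_eq_false_iff] at hc
    simp only [run]; split_ifs
    · exact ih₁ hc.1 s
    · exact ih₂ hc.2 s
  | forN w c ih =>
    simp only [writesArr] at hc
    simp only [run]
    have key : ∀ (k : ℕ) (s : RamState),
        ((fun s => (c.run s).setVar w ((c.run s).var w + 1))^[k] s).arr a = s.arr a := by
      intro k
      induction k with
      | zero => intro s; rfl
      | succ k ihk =>
        intro s
        rw [Function.iterate_succ_apply, ihk, RamState.setVar_arr, ih hc]
    rw [key, RamState.setVar_arr]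

lemma writesVar_zero {c : ForProg} (hc : c.wellFormed = true) : c.writesVar 0 = false := by
  induction c with
  | skip => rfl
  | assign w e => simpa [wellFormed, writesVar] using hc
  | store a i e => rfl
  | seq c₁ c₂ ih₁ ih₂ =>
    simp only [wellFormed, Bool.and_eq_true] at hc
    simp [writesVar, ih₁ hc.1, ih₂ hc.2]
  | ite e c₁ c₂ ih₁ ih₂ =>
    simp only [wellFormed, Bool.and_eq_true] at hc
    simp [writesVar, ih₁ hc.1, ih₂ hc.2]
  | forN w c ih =>
    simp only [wellFormed, Bool.and_eq_true, bne_iff_ne] at hc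
    simp [writesVar, ih hc.2, hc.1.1]

lemma run_skip (s : RamState) : skip.run s = s := rfl

lemma run_assign (v : ℕ) (e : RamExp) (s : RamState) :
    (assign v e).run s = s.setVar v (min (e.eval s) (s.var 0)) := rfl

lemma run_store (a : ℕ) (i e : RamExp) (s : RamState) :
    (store a i e).run s = s.setArr a (i.eval s) (min (e.eval s) (s.var 0)) := rfl

lemma run_seq (c₁ c₂ : ForProg) (s : RamState) : (seq c₁ c₂).run s = c₂.run (c₁.run s) := rfl

/-- Proof rule for counting loops. -/
lemma forN_induction {v : ℕ} {c : ForProg} (hc : (forN v c).wellFormed = true)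
    (I : ℕ → RamState → Prop) {s : RamState} {n : ℕ} (hn : s.var 0 = n) (h₀ : I 0 (s.setVar v 0))
    (hs : ∀ i < n, ∀ s', s'.var 0 = n → s'.var v = i → I i s' →
      I (i + 1) ((c.run s').setVar v (i + 1))) :
    I n ((forN v c).run s) := by
  subst hn
  simp only [wellFormed, Bool.and_eq_true, bne_iff_ne, Bool.not_eq_true'] at hc
  obtain ⟨⟨hv, hw⟩, hc⟩ := hc
  have key : ∀ k ≤ s.var 0, ∀ s',
      s' = (fun s => (c.run s).setVar v ((c.run s).var v + 1))^[k] (s.setVar v 0) →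
      s'.var 0 = s.var 0 ∧ s'.var v = k ∧ I k s' := by
    intro k
    induction k with
    | zero =>
      rintro - s' rfl
      exact ⟨by simp [hv.symm], by simp, h₀⟩
    | succ k ih =>
      rintro hk s' rfl
      obtain ⟨g₁, g₂, g₃⟩ := ih (by omega) _ rfl
      rw [Function.iterate_succ_apply']
      set s' := (fun s => (c.run s).setVar v ((c.run s).var v + 1))^[k] (s.setVar v 0)
      have e₁ : (c.run s').var v = k := by rw [run_var_of_not_writesVar hw, g₂]
      refine ⟨?_, ?_, ?_⟩
      · simp only [RamState.setVar_var_of_ne _ _ hv.symm]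
        rw [run_var_of_not_writesVar (writesVar_zero hc), g₁]
      · simp [e₁]
      · simp only [e₁]
        exact hs k (by omega) s' g₁ g₂ g₃
  exact (key _ le_rfl _ rfl).2.2

/-- Well-formed programs halt in polynomial time. -/
theorem exists_polynomial_runs {c : ForProg} (hc : c.wellFormed = true) :
    ∃ P : Polynomial ℕ, ∀ (s : RamState) (n : ℕ), s.Bounded n →
      (c.run s).Bounded n ∧ ∃ t, Runs c.compile s t (c.run s) ∧ t ≤ P.eval n := by
  induction c with
  | skip => exact ⟨1, fun s n hs => ⟨hs, 1, .skip s, by simp⟩⟩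
  | assign v e =>
    obtain ⟨P, Q, h⟩ := (truncExp e).exists_polynomial_bound
    refine ⟨1 + Q, fun s n hs => ⟨?_, 1 + (truncExp e).cost s, ?_, ?_⟩⟩
    · exact hs.setVar (by simpa [wellFormed] using hc) ((min_le_right _ _).trans (hs.var_le 0))
    · simpa only [run, compile, truncExp_eval] using Runs.assign v (truncExp e) s
    · simpa using (h s n hs).2
  | store a i e =>
    obtain ⟨P, Q, h⟩ := (truncExp e).exists_polynomial_bound
    obtain ⟨P', Q', h'⟩ := i.exists_polynomial_bound
    refine ⟨1 + Q' + Q, fun s n hs => ⟨?_, 1 + i.cost s + (truncExp e).cost s, ?_, ?_⟩⟩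
    · exact hs.setArr ((min_le_right _ _).trans (hs.var_le 0))
    · simpa only [run, compile, truncExp_eval] using Runs.store a i (truncExp e) s
    · have h₁ := (h s n hs).2
      have h₂ := (h' s n hs).2
      simp only [Polynomial.eval_add, Polynomial.eval_one]
      omega
  | seq c₁ c₂ ih₁ ih₂ =>
    simp only [wellFormed, Bool.and_eq_true] at hc
    obtain ⟨P₁, h₁⟩ := ih₁ hc.1
    obtain ⟨P₂, h₂⟩ := ih₂ hc.2
    refine ⟨P₁ + P₂, fun s n hs => ?_⟩
    obtain ⟨b₁, t₁, r₁, l₁⟩ := h₁ s n hs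
    obtain ⟨b₂, t₂, r₂, l₂⟩ := h₂ _ n b₁
    refine ⟨b₂, _, .seq r₁ r₂, ?_⟩
    simp only [Polynomial.eval_add]; omega
  | ite e c₁ c₂ ih₁ ih₂ =>
    simp only [wellFormed, Bool.and_eq_true] at hc
    obtain ⟨P₁, h₁⟩ := ih₁ hc.1
    obtain ⟨P₂, h₂⟩ := ih₂ hc.2
    obtain ⟨P, Q, h⟩ := e.exists_polynomial_bound
    refine ⟨1 + Q + (P₁ + P₂), fun s n hs => ?_⟩
    have hq := (h s n hs).2
    by_cases he : e.eval s = 0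
    · obtain ⟨b₂, t₂, r₂, l₂⟩ := h₂ s n hs
      have hr : (ite e c₁ c₂).run s = c₂.run s := by simp [run, he]
      rw [hr]
      refine ⟨b₂, _, .ite_false he r₂, ?_⟩
      simp only [Polynomial.eval_add, Polynomial.eval_one]; omega
    · obtain ⟨b₁, t₁, r₁, l₁⟩ := h₁ s n hs
      have hr : (ite e c₁ c₂).run s = c₁.run s := by simp [run, he]
      rw [hr]
      refine ⟨b₁, _, .ite_true he r₁, ?_⟩
      simp only [Polynomial.eval_add, Polynomial.eval_one]; omega
  | forN v c ih =>
    simp only [wellFormed, Bool.and_eq_true, bne_iff_ne, Bool.not_eq_true'] at hc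
    obtain ⟨⟨hv, hw⟩, hc⟩ := hc
    obtain ⟨P, h⟩ := ih hc
    obtain ⟨_, Q, hQ⟩ := (RamExp.sub (.var 0) (.var v)).exists_polynomial_bound
    obtain ⟨_, R, hR⟩ := (RamExp.add (.var v) (.const 1)).exists_polynomial_bound
    obtain ⟨_, U, hU⟩ := (RamExp.const 0).exists_polynomial_bound
    refine ⟨1 + U + (.X + 1) * (1 + Q + (P + (1 + R))), fun s n hs => ?_⟩
    set step : RamState → RamState := fun s => (c.run s).setVar v ((c.run s).var v + 1)
    -- Here `k` is the number of iterations that remain. The factor `k + 1` also pays for the last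
    -- test, which ends the loop. The increment of the counter is not truncated, but it cannot
    -- exceed `n`.
    have key : ∀ k s', s'.Bounded n → n = s'.var v + k →
        (step^[k] s').Bounded n ∧ ∃ t, Runs (.loop (.sub (.var 0) (.var v))
          (.seq c.compile (.assign v (.add (.var v) (.const 1))))) s' t (step^[k] s') ∧
          t ≤ (k + 1) * (1 + Q + (P + (1 + R))).eval n := by
      intro k
      induction k with
      | zero =>
        intro s' hs' hk
        refine ⟨hs', _, .loop_false ?_, ?_⟩
        · simp only [RamExp.eval, hs'.var_zero]; omega
        · have := (hQ s' n hs').2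
          simp only [Polynomial.eval_add, Polynomial.eval_one]; omega
      | succ k ihk =>
        intro s' hs' hk
        obtain ⟨b, t, r, l⟩ := h s' n hs'
        have e₁ : (c.run s').var v = s'.var v := run_var_of_not_writesVar hw s'
        have hb : (step s').Bounded n := b.setVar hv (by omega)
        obtain ⟨b', t', r', l'⟩ := ihk (step s') hb (by simp [step, e₁]; omega)
        rw [Function.iterate_succ_apply]
        refine ⟨b', _, .loop_true ?_ (.seq r (.assign v _ _)) r', ?_⟩
        · simp only [RamExp.eval, hs'.var_zero]; omega
        · have h₁ := (hQ s' n hs').2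
          have h₂ := (hR _ n b).2
          simp only [Polynomial.eval_add, Polynomial.eval_one] at l' ⊢
          rw [Nat.succ_mul (k + 1)]
          omega
    have hb : (s.setVar v 0).Bounded n := hs.setVar hv (by omega)
    obtain ⟨b, t, r, l⟩ := key n _ hb (by simp)
    have hr : (forN v c).run s = step^[n] (s.setVar v 0) := by simp [run, hs.var_zero, step]
    rw [hr]
    refine ⟨b, _, .seq (.assign v _ s) r, ?_⟩
    have := (hU s n hs).2
    simp only [Polynomial.eval_add, Polynomial.eval_one, Polynomial.eval_mul,
      Polynomial.eval_X] at l ⊢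
    omega

end ForProg

/-! ### Conditions as arithmetic expressions -/

namespace RamExp

/-- An expression that is true if `a < b`. -/
def less (a b : RamExp) : RamExp := .sub b a

/-- An expression that is true if `a = b`. -/
def equal (a b : RamExp) : RamExp := .sub (.const 1) (.add (.sub a b) (.sub b a))

/-- An expression that is true if `a` and `b` are. -/
def conj (a b : RamExp) : RamExp := .mul a b

/-- An expression is true if its value is not zero. -/
def Holds (s : RamState) (e : RamExp) : Prop := e.eval s ≠ 0

@[simp] lemma holds_less {s : RamState} {a b : RamExp} :
    Holds s (less a b) ↔ a.eval s < b.eval s := by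
  simp only [Holds, less, eval]; omega

@[simp] lemma holds_equal {s : RamState} {a b : RamExp} :
    Holds s (equal a b) ↔ a.eval s = b.eval s := by
  simp only [Holds, equal, eval]; omega

@[simp] lemma holds_conj {s : RamState} {a b : RamExp} :
    Holds s (conj a b) ↔ Holds s a ∧ Holds s b := by
  simp [Holds, conj, eval]

end RamExp

lemma ForProg.run_ite (e : RamExp) (c₁ c₂ : ForProg) (s : RamState)
    [Decidable (RamExp.Holds s e)] :
    (ForProg.ite e c₁ c₂).run s = if RamExp.Holds s e then c₁.run s else c₂.run s := by
  simp only [ForProg.run, RamExp.Holds]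
  congr

lemma inputState_bounded {r : ℕ} (T : Tournament (Fin (2 ^ r))) (x : Fin (2 ^ r)) :
    (inputState T x).Bounded (2 ^ r) where
  pos := Nat.one_le_two_pow
  var_zero := by simp [inputState]
  var_le v := by
    simp only [inputState]
    split_ifs
    · exact le_rfl
    · exact x.2.le
    · exact Nat.zero_le _
  arr_le a i := by
    have : 1 ≤ 2 ^ r := Nat.one_le_two_pow
    simp only [inputState]
    split_ifs
    · exact (Bool.toNat_le _).trans this
    · exact Nat.zero_le _
    · exact Nat.zero_le _

lemma inputState_matrix {n : ℕ} (T : Tournament (Fin n)) (x u v : Fin n) :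
    (inputState T x).arr 0 (u * n + v) = (T.dom u v).toNat := by
  have hn : 0 < n := u.pos
  have h : (u : ℕ) * n + v < n * n := by
    calc (u : ℕ) * n + v < u * n + n := by omega
      _ = (u + 1) * n := by ring
      _ ≤ n * n := Nat.mul_le_mul_right _ u.2
  simp only [inputState, if_true, hn, h, true_and, dif_pos]
  congr 2
  · ext
    simp only
    rw [Nat.add_comm, Nat.add_mul_div_right _ _ hn, Nat.div_eq_of_lt v.2, zero_add]
  · ext
    simp only
    rw [Nat.add_comm, Nat.add_mul_mod_self_right, Nat.mod_eq_of_lt v.2]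

/-! ### One round of pairings -/

namespace Tournament

variable {V : Type}

lemma dom_asymm (T : Tournament V) {a b : V} (h : T.dom a b = true) : T.dom b a = false := by
  have hab : a ≠ b := by rintro rfl; simp [T.irrefl] at h
  rw [T.antisymm a b hab, h]; rfl

lemma dom_ne (T : Tournament V) {a b : V} (h : T.dom a b = true) : a ≠ b := by
  rintro rfl; simp [T.irrefl] at h

lemma dom_or_dom (T : Tournament V) {a b : V} (h : a ≠ b) :
    T.dom a b = true ∨ T.dom b a = true := by
  rw [T.antisymm a b h]; cases T.dom a b <;> simp

/-- A partial result of round `t`: a player with level `t` has not played yet, a player with level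
`t + 1` has won against `lose v`, and losers get the level `0`. The levels at the start of the
round are `lev₀`; matches are between players with the same label. -/
structure IsPairing (T : Tournament V) (lab : V → ℕ) (t : ℕ) (lev₀ lev : V → ℕ)
    (lose : V → V) : Prop where
  level : ∀ v, lev v = lev₀ v ∨ lev₀ v = t ∧ (lev v = t + 1 ∨ lev v = 0)
  winner : ∀ v, lev v = t + 1 → lev₀ v = t ∧ lev₀ (lose v) = t ∧ lev (lose v) = 0 ∧
    lab (lose v) = lab v ∧ T.dom v (lose v) = true
  inj : ∀ v w, lev v = t + 1 → lev w = t + 1 → lose v = lose w → v = w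
  loser : ∀ v, lev₀ v = t → lev v = 0 → ∃ w, lev w = t + 1 ∧ lose w = v

/-- The invariant `I` is preserved by matches in round `t` won by `u` against `v` that satisfy the
condition `cond`. -/
def PreservedByMatches [DecidableEq V] (T : Tournament V) (lab : V → ℕ) (t : ℕ)
    (cond : V → V → Prop) (I : (V → ℕ) → (V → V) → Prop) : Prop :=
  ∀ lev lose u v, I lev lose → lev u = t → lev v = t → lab u = lab v → T.dom u v = true →
    cond u v → I (Function.update (Function.update lev u (t + 1)) v 0) (Function.update lose u v)

/-- There are no more possible matches satisfying the condition `cond`. -/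
def IsMaximalPairing (T : Tournament V) (lab : V → ℕ) (t : ℕ) (cond : V → V → Prop)
    (lev : V → ℕ) : Prop :=
  ∀ u v, lev u = t → lev v = t → lab u = lab v → T.dom u v = true → ¬ cond u v

/-- The matches in the first phase of a round: those of the kings. -/
def condKing (kg : V → V) (u _v : V) : Prop := u = kg u

/-- The matches in the second phase of a round: those won by a player dominated by the king of his
class against a player dominating the king. -/
def condHelp (T : Tournament V) (kg : V → V) (u v : V) : Prop :=
  T.dom (kg u) u = true ∧ T.dom v (kg u) = true

/-- In every class `i + 1 ≥ t`, the players with level `t` form a set of `2 ^ (i + 1 - t)`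
alternatives in which the king is a superking. -/
structure RoundInvariant [Fintype V] (T : Tournament V) (r : ℕ) (lab : V → ℕ) (king : ℕ → V)
    (t : ℕ) (lev : V → ℕ) : Prop where
  le : ∀ v, lev v ≤ t
  lab_le : ∀ v, lev v = t → t ≤ lab v ∧ lab v ≤ r
  card : ∀ i < r, t ≤ i + 1 →
    (Finset.univ.filter fun v => lev v = t ∧ lab v = i + 1).card = 2 ^ (i + 1 - t)
  king_lev : ∀ i < r, t ≤ i + 1 → lev (king i) = t
  superking : ∀ i < r, t ≤ i + 1 → ∀ b, lev b = t → lab b = i + 1 → T.dom b (king i) = true →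
    i + 1 - t ≤ (Finset.univ.filter fun a => lev a = t ∧ lab a = i + 1 ∧
      T.dom (king i) a = true ∧ T.dom a b = true).card

/-- Both players still have level `t`, so neither has won or lost in this round and no earlier
result is overwritten. As `1 ≤ t`, the level `0` of losers is not confused with `t`. -/
lemma IsPairing.preserved [DecidableEq V] (T : Tournament V) (lab : V → ℕ) {t : ℕ} (ht : 1 ≤ t)
    (lev₀ : V → ℕ)
    (cond : V → V → Prop) :
    T.PreservedByMatches lab t cond (T.IsPairing lab t lev₀) := by
  intro lev lose u v h hu hv hl hd _
  have huv : u ≠ v := T.dom_ne hd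
  obtain ⟨h₁, h₂, h₃, h₄⟩ := h
  have hu₀ : lev₀ u = t := by rcases h₁ u with h | h <;> omega
  have hv₀ : lev₀ v = t := by rcases h₁ v with h | h <;> omega
  refine ⟨fun w => ?_, fun w hw => ?_, fun w w' hw hw' e => ?_, fun w hw hw' => ?_⟩
  · have := h₁ w
    simp only [Function.update_apply]
    split_ifs with g₁ g₂
    · subst g₁; omega
    · subst g₂; omega
    · exact this
  · simp only [Function.update_apply] at hw
    split_ifs at hw with g₁ g₂
    · subst g₂
      simp [hu₀, hv₀, hl, hd]
    · obtain ⟨k₁, k₂, k₃, k₄, k₅⟩ := h₂ w hw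
      have k₆ : lose w ≠ u := fun h => by rw [h] at k₃; omega
      simp [k₁, k₂, k₃, k₄, k₅, k₆, g₂, Function.update_apply]
  · simp only [Function.update_apply] at hw hw' e
    have key : ∀ w, lev w = t + 1 → lose w ≠ v := fun w hw h => by
      have := (h₂ w hw).2.2.1
      rw [h] at this; omega
    by_cases g : w = u <;> by_cases g' : w' = u
    · exact g.trans g'.symm
    · rw [if_pos g, if_neg g'] at e
      split_ifs at hw'
      exact absurd e.symm (key _ hw')
    · rw [if_neg g, if_pos g'] at e
      split_ifs at hw
      exact absurd e (key _ hw)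
    · rw [if_neg g, if_neg g'] at e
      split_ifs at hw hw'
      exact h₃ w w' hw hw' e
  · simp only [Function.update_apply] at hw'
    split_ifs at hw' with g₁ g₂
    · exact ⟨u, by simp [huv], by simp [g₁]⟩
    · obtain ⟨w', k₁, k₂⟩ := h₄ w hw hw'
      have k₃ : w' ≠ u := fun h => by rw [h] at k₁; omega
      have k₄ : w' ≠ v := fun h => by rw [h] at k₁; omega
      exact ⟨w', by simp [k₃, k₄, k₁], by simp [k₃, k₂]⟩

section Round

variable {T : Tournament V} {r : ℕ} {lab : V → ℕ} {king : ℕ → V} {t : ℕ}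
  {lev₀ : V → ℕ}

/-- After the first phase. -/
lemma RoundInvariant.king_wins [Fintype V] (hlk : ∀ i < r, lab (king i) = i + 1)
    (h₀ : T.RoundInvariant r lab king t lev₀)
    {lev : V → ℕ} {lose : V → V}
    (hp : T.IsPairing lab t lev₀ lev lose)
    (hk : ∀ v, lev v = t + 1 → v = king (lab v - 1))
    (hm : T.IsMaximalPairing lab t (condKing fun v => king (lab v - 1)) lev) {i : ℕ} (hi : i < r)
    (hti : t ≤ i) : lev (king i) = t + 1 := by
  have hkl := hlk i hi
  have hk₀ := h₀.king_lev i hi (by omega)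
  by_contra hne
  -- All winners so far are kings of their classes. So if this king has not won, nobody in his class
  -- has won, hence nobody has lost, and the whole class is still available.
  have hall : ∀ v, lab v = i + 1 → lev v ≠ t + 1 := by
    intro v hv hv'
    have := hk v hv'
    rw [hv, Nat.add_sub_cancel] at this
    exact hne (this ▸ hv')
  have hun : ∀ v, lev₀ v = t → lab v = i + 1 → lev v = t := by
    intro v hv hv'
    rcases hp.level v with h | ⟨_, h | h⟩
    · omega
    · exact absurd h (hall v hv')
    · obtain ⟨w, hw, rfl⟩ := hp.loser v hv h
      exact absurd hw (hall w ((hp.winner w hw).2.2.2.1 ▸ hv'))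
  -- The class has a second player. Either the king dominates him, or the superking property
  -- supplies at least one player dominated by the king.
  obtain ⟨a, ha₁, ha₂, ha₃⟩ : ∃ a, lev₀ a = t ∧ lab a = i + 1 ∧ T.dom (king i) a = true := by
    have hc := h₀.card i hi (by omega)
    have h1 : 1 < (Finset.univ.filter fun v => lev₀ v = t ∧ lab v = i + 1).card := by
      rw [hc]; exact Nat.one_lt_two_pow (by omega)
    obtain ⟨b, hb, hbk⟩ := Finset.exists_mem_ne h1 (king i)
    simp only [Finset.mem_filter, Finset.mem_univ, true_and] at hb
    rcases T.dom_or_dom hbk with h | h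
    · have hs := h₀.superking i hi (by omega) b hb.1 hb.2 h
      obtain ⟨a, ha⟩ := Finset.card_pos.1 ((show 0 < i + 1 - t by omega).trans_le hs)
      simp only [Finset.mem_filter, Finset.mem_univ, true_and] at ha
      exact ⟨a, ha.1, ha.2.1, ha.2.2.1⟩
    · exact ⟨b, hb.1, hb.2, h⟩
  refine hm (king i) a (hun _ hk₀ hkl) (hun a ha₁ ha₂) (by rw [hkl, ha₂]) ha₃ ?_
  simp [condKing, hkl]

/-- After the second phase. -/
lemma IsPairing.helpers_win {lev : V → ℕ} {lose : V → V}
    (hp : T.IsPairing lab t lev₀ lev lose)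
    (hk : ∀ v, lev v = t + 1 → v = king (lab v - 1) ∨
      condHelp T (fun v => king (lab v - 1)) v (lose v))
    (hm : T.IsMaximalPairing lab t (condHelp T fun v => king (lab v - 1)) lev)
    {a b : V} (hb : lev b = t ∨ lev b = t + 1) (hbk : T.dom b (king (lab b - 1)) = true)
    (ha : lev₀ a = t) (hab : lab a = lab b) (hka : T.dom (king (lab b - 1)) a = true)
    (hd : T.dom a b = true) : a = lose (king (lab b - 1)) ∨ lev a = t + 1 := by
  rcases hb with hb | hb
  -- Maximality excludes that helper `a` and `b` are both unmatched. If `a` has lost, then to the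
  -- king, since losers of the other matches dominate the king whereas the king dominates `a`.
  · have key : lev a ≠ t := fun hat => hm a b hat hb hab hd (by simp [condHelp, hab, hka, hbk])
    rcases hp.level a with h | ⟨_, h | h⟩
    · omega
    · exact Or.inr h
    · left
      obtain ⟨w, hw, rfl⟩ := hp.loser a ha h
      have hl := (hp.winner w hw).2.2.2.1
      rcases hk w hw with hw' | ⟨_, hw'⟩
      · rw [← hab, hl, ← hw']
      · simp only [← hl, hab] at hw'
        rw [T.dom_asymm hw'] at hka
        exact absurd hka (by simp)
  -- So far only kings and players dominated by their king have won, so `b` is no winner.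
  · exfalso
    rcases hk b hb with h | ⟨h, _⟩
    · rw [← h] at hbk; simp [T.irrefl] at hbk
    · rw [T.dom_asymm hbk] at h; exact absurd h (by simp)

/-- At the end of a round. -/
lemma RoundInvariant.next [Fintype V] [DecidableEq V] (h₀ : T.RoundInvariant r lab king t lev₀) {lev : V → ℕ} {lose : V → V}
    (ht : 1 ≤ t) (hp : T.IsPairing lab t lev₀ lev lose)
    (hm : T.IsMaximalPairing lab t (fun _ _ => True) lev)
    (hk : ∀ i < r, t ≤ i → lev (king i) = t + 1) (l : V → V)
    (hl : ∀ a b, lev b = t + 1 → T.dom b (king (lab b - 1)) = true →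
      lev₀ a = t → lab a = lab b → T.dom (king (lab b - 1)) a = true → T.dom a b = true →
      a = l (king (lab b - 1)) ∨ lev a = t + 1) :
    T.RoundInvariant r lab king (t + 1) lev := by
  -- Any two players left over in a class could still be matched, so at most one is left; this is
  -- `ε`. For `t ≤ i` the left-hand side is even, which forces `ε = 0`.
  have hcard : ∀ i < r, t ≤ i + 1 → ∃ ε ≤ 1, 2 ^ (i + 1 - t) =
      ε + 2 * (Finset.univ.filter fun v => lev v = t + 1 ∧ lab v = i + 1).card := by
    intro i hi hti
    set U := Finset.univ.filter fun v => lev v = t ∧ lab v = i + 1 with hU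
    set W := Finset.univ.filter fun v => lev v = t + 1 ∧ lab v = i + 1 with hW
    refine ⟨U.card, ?_, ?_⟩
    · rw [Finset.card_le_one]
      intro a ha b hb
      simp only [hU, Finset.mem_filter, Finset.mem_univ, true_and] at ha hb
      by_contra hab
      rcases T.dom_or_dom hab with h | h
      · exact hm a b ha.1 hb.1 (by omega) h trivial
      · exact hm b a hb.1 ha.1 (by omega) h trivial
    · have hA : (Finset.univ.filter fun v => lev₀ v = t ∧ lab v = i + 1) =
          U ∪ (W ∪ W.image lose) := by
        ext v
        simp only [hU, hW, Finset.mem_filter, Finset.mem_univ, true_and, Finset.mem_union,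
          Finset.mem_image]
        constructor
        · rintro ⟨hv, hv'⟩
          rcases hp.level v with h | ⟨_, h | h⟩
          · exact Or.inl ⟨h.trans hv, hv'⟩
          · exact Or.inr (Or.inl ⟨h, hv'⟩)
          · obtain ⟨w, hw, rfl⟩ := hp.loser v hv h
            exact Or.inr (Or.inr ⟨w, ⟨hw, (hp.winner w hw).2.2.2.1 ▸ hv'⟩, rfl⟩)
        · rintro (⟨hv, hv'⟩ | ⟨hv, hv'⟩ | ⟨w, ⟨hw, hw'⟩, rfl⟩)
          · refine ⟨?_, hv'⟩
            rcases hp.level v with h | h <;> omega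
          · exact ⟨(hp.winner v hv).1, hv'⟩
          · have := hp.winner w hw
            exact ⟨this.2.1, this.2.2.2.1.trans hw'⟩
      have hinj : (W.image lose).card = W.card := by
        apply Finset.card_image_of_injOn
        intro a ha b hb hab
        simp only [hW, Finset.coe_filter, Finset.mem_univ, true_and, Set.mem_ofPred_eq] at ha hb
        exact hp.inj a b ha.1 hb.1 hab
      rw [← h₀.card i hi hti, hA, Finset.card_union_of_disjoint, Finset.card_union_of_disjoint,
        hinj]
      · ring
      · rw [Finset.disjoint_left]
        intro a ha hb
        simp only [hW, Finset.mem_filter, Finset.mem_univ, true_and, Finset.mem_image] at ha hb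
        obtain ⟨w, hw, rfl⟩ := hb
        have := (hp.winner w hw.1).2.2.1
        omega
      · rw [Finset.disjoint_left]
        intro a ha hb
        simp only [hU, hW, Finset.mem_filter, Finset.mem_univ, true_and, Finset.mem_union,
          Finset.mem_image] at ha hb
        rcases hb with hb | ⟨w, hw, rfl⟩
        · omega
        · have := (hp.winner w hw.1).2.2.1
          omega
  refine ⟨fun v => ?_, fun v hv => ?_, fun i hi hti => ?_, fun i hi hti => hk i hi (by omega),
    fun i hi hti b hb hb' hbk => ?_⟩
  · have := h₀.le v
    rcases hp.level v with h | h <;> omega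
  · obtain ⟨hv₀, h2, h3, h4, h5⟩ := hp.winner v hv
    obtain ⟨g₁, g₂⟩ := h₀.lab_le v hv₀
    refine ⟨?_, g₂⟩
    -- A class with label `t` has only one player in round `t`; a winner and his loser would be two.
    by_contra hlt
    have hc := h₀.card (t - 1) (by omega) (by omega)
    rw [show t - 1 + 1 - t = 0 by omega, pow_zero] at hc
    have := Finset.card_le_one.1 hc.le v (by simp; omega) (lose v) (by simp; omega)
    exact T.dom_ne h5 this
  · obtain ⟨ε, hε, h⟩ := hcard i hi (by omega)
    rw [show i + 1 - t = (i + 1 - (t + 1)) + 1 by omega, pow_succ] at h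
    omega
  · have hs := h₀.superking i hi (by omega) b (hp.winner b hb).1 hb' hbk
    -- At most one helper against `b` is lost in the round, which matches the decrease by one of the
    -- required number.
    have hsub : (Finset.univ.filter fun a => lev₀ a = t ∧ lab a = i + 1 ∧
        T.dom (king i) a = true ∧ T.dom a b = true) ⊆
        insert (l (king i)) (Finset.univ.filter fun a => lev a = t + 1 ∧ lab a = i + 1 ∧
          T.dom (king i) a = true ∧ T.dom a b = true) := by
      intro a ha
      simp only [Finset.mem_filter, Finset.mem_univ, true_and, Finset.mem_insert] at ha ⊢
      have := hl a b hb (by rw [hb']; exact hbk) ha.1 (by omega) (by rw [hb']; exact ha.2.2.1)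
        ha.2.2.2
      rw [hb'] at this
      exact this.imp id fun h => ⟨h, ha.2⟩
    have := (Finset.card_le_card hsub).trans (Finset.card_insert_le _ _)
    omega

end Round

/-! ### Brackets from the results of the rounds -/

/-- The player at position `j` before the last `s` rounds, when `x` is the winner and `v` wins
against `lose t v` in round `t`. -/
def layout (r : ℕ) (lose : ℕ → V → V) (x : V) : ℕ → ℕ → V
  | 0, _ => x
  | s + 1, j =>
      if j % 2 = 0 then layout r lose x s (j / 2)
      else lose (r - s) (layout r lose x s (j / 2))

/-- The results of all rounds: `P t` is the set of the players in round `t + 1`, and the player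
`v ∈ P (t + 1)` has won against `lose (t + 1) v`. -/
structure IsRoundTable (T : Tournament V) (r : ℕ) (lab : V → ℕ) (king : ℕ → V) (x : V)
    (P : ℕ → V → Prop) (lose : ℕ → V → V) : Prop where
  mem_x : P r x
  lose_x : ∀ t < r, lose (t + 1) x = king t
  mono : ∀ t < r, ∀ v, P (t + 1) v → P t v
  mem_lose : ∀ t < r, ∀ v, P (t + 1) v → P t (lose (t + 1) v) ∧ ¬ P (t + 1) (lose (t + 1) v)
  inj : ∀ t < r, ∀ v w, P (t + 1) v → P (t + 1) w → lose (t + 1) v = lose (t + 1) w → v = w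
  dom : ∀ t < r, ∀ v, P (t + 1) v → T.dom v (lose (t + 1) v) = true
  lab_lose : ∀ t < r, ∀ v, P (t + 1) v → v ≠ x → lab (lose (t + 1) v) = lab v

section Layout

variable {T : Tournament V} {r : ℕ} {lab : V → ℕ} {king : ℕ → V} {x : V}
  {P : ℕ → V → Prop} {lose : ℕ → V → V}

lemma layout_zero_right (s : ℕ) : layout r lose x s 0 = x := by
  induction s with
  | zero => rfl
  | succ s ih => simp [layout, ih]

lemma IsRoundTable.mem_layout (h : T.IsRoundTable r lab king x P lose) :
    ∀ s ≤ r, ∀ j, P (r - s) (layout r lose x s j) := by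
  intro s
  induction s with
  | zero => intro _ j; exact h.mem_x
  | succ s ih =>
    intro hs j
    have hp := ih (by omega) (j / 2)
    have e : r - s = (r - (s + 1)) + 1 := by omega
    rw [e] at hp
    simp only [layout]
    split_ifs
    · exact h.mono _ (by omega) _ hp
    · rw [e]; exact (h.mem_lose _ (by omega) _ hp).1

/-- Even positions hold players that survive round `r - s` and odd positions those eliminated in it,
so equal entries are at positions of the same parity; then injectivity of `lose` and induction
apply. -/
lemma IsRoundTable.layout_inj (h : T.IsRoundTable r lab king x P lose) :
    ∀ s ≤ r, ∀ i < 2 ^ s, ∀ j < 2 ^ s, layout r lose x s i = layout r lose x s j → i = j := by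
  intro s
  induction s with
  | zero => intro _ i hi j hj _; simp at hi hj; omega
  | succ s ih =>
    intro hs i hi j hj hij
    have hpi := h.mem_layout s (by omega) (i / 2)
    have hpj := h.mem_layout s (by omega) (j / 2)
    have e : r - s = (r - (s + 1)) + 1 := by omega
    have hlt : r - (s + 1) < r := by omega
    rw [pow_succ] at hi hj
    have key := ih (by omega) (i / 2) (by omega) (j / 2) (by omega)
    simp only [layout] at hij
    rw [e] at hpi hpj hij
    split_ifs at hij with h₁ h₂ h₂
    · have := key hij; omega
    · rw [hij] at hpi
      exact absurd hpi (h.mem_lose _ hlt _ hpj).2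
    · rw [← hij] at hpj
      exact absurd hpj (h.mem_lose _ hlt _ hpi).2
    · have := key (h.inj _ hlt _ _ hpi hpj hij); omega

/-- Passing from a winner to his loser can change the label only if the winner is `x`, and `x`
occurs only at position `0`, which is no descendant of `b ≥ 1`. -/
lemma IsRoundTable.lab_layout (h : T.IsRoundTable r lab king x P lose) {s b : ℕ} (hb : 1 ≤ b)
    (hbs : b < 2 ^ s) : ∀ d, s + d ≤ r → ∀ j < 2 ^ d,
      lab (layout r lose x (s + d) (2 ^ d * b + j)) = lab (layout r lose x s b) := by
  intro d
  induction d with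
  | zero => intro _ j hj; simp at hj; simp [hj]
  | succ d ih =>
    intro hd j hj
    have hpow : 1 ≤ 2 ^ d := Nat.one_le_two_pow
    rw [pow_succ] at hj
    have e₁ : (2 ^ (d + 1) * b + j) / 2 = 2 ^ d * b + j / 2 := by
      rw [pow_succ, show 2 ^ d * 2 * b + j = j + 2 * (2 ^ d * b) by ring,
        Nat.add_mul_div_left _ _ (by norm_num), add_comm]
    have key := ih (by omega) (j / 2) (by omega)
    have hlt : 2 ^ d * b + j / 2 < 2 ^ (s + d) := by
      calc 2 ^ d * b + j / 2 < 2 ^ d * b + 2 ^ d := by omega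
        _ = 2 ^ d * (b + 1) := by ring
        _ ≤ 2 ^ d * 2 ^ s := Nat.mul_le_mul_left _ hbs
        _ = 2 ^ (s + d) := by ring
    have hpos : 2 ^ d * b + j / 2 ≠ 0 := by positivity
    rw [← add_assoc]
    simp only [layout, e₁]
    split_ifs
    · exact key
    · have hp := h.mem_layout (s + d) (by omega) (2 ^ d * b + j / 2)
      have e : r - (s + d) = (r - (s + d + 1)) + 1 := by omega
      rw [e] at hp
      rw [e, h.lab_lose _ (by omega) _ hp, key]
      intro hx
      exact hpos (h.layout_inj _ (by omega) _ hlt _ (by positivity)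
        (hx.trans (layout_zero_right _).symm))

/-- The subtree of a player splits into his own subtree one level down and that of the player he
beats in this round. -/
lemma IsRoundTable.winner_layout (h : T.IsRoundTable r lab king x P lose) :
    ∀ d s b, s + d ≤ r →
      T.winner d (fun j => layout r lose x (s + d) (2 ^ d * b + j)) = layout r lose x s b := by
  intro d
  induction d with
  | zero => intro s b _; simp [winner]
  | succ d ih =>
    intro s b hs
    have e₁ := ih (s + 1) (2 * b) (by omega)
    have e₂ := ih (s + 1) (2 * b + 1) (by omega)
    have hp := h.mem_layout s (by omega) b
    have e : r - s = (r - (s + 1)) + 1 := by omega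
    rw [e] at hp
    have l₁ : layout r lose x (s + 1) (2 * b) = layout r lose x s b := by simp [layout]
    have l₂ : layout r lose x (s + 1) (2 * b + 1) =
        lose (r - (s + 1) + 1) (layout r lose x s b) := by
      simp only [layout, e]
      rw [if_neg (by omega), show (2 * b + 1) / 2 = b by omega]
    have a₁ : ∀ j, 2 ^ d * (2 * b) + j = 2 ^ (d + 1) * b + j := fun j => by ring
    have a₂ : ∀ j, 2 ^ d * (2 * b + 1) + j = 2 ^ (d + 1) * b + (2 ^ d + j) := fun j => by ring
    have a₃ : s + 1 + d = s + (d + 1) := by ring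
    simp only [a₁, a₃] at e₁
    simp only [a₂, a₃] at e₂
    simp only [winner, e₁, e₂, l₁, l₂, matchWinner]
    rw [if_pos (h.dom _ (by omega) _ hp)]

end Layout

/-- The results of the rounds give a bracket. -/
theorem IsRoundTable.exists_bracket {r : ℕ} {T : Tournament (Fin (2 ^ r))}
    {lab : Fin (2 ^ r) → ℕ} {king : ℕ → Fin (2 ^ r)} {x : Fin (2 ^ r)}
    {P : ℕ → Fin (2 ^ r) → Prop} {lose : ℕ → Fin (2 ^ r) → Fin (2 ^ r)}
    (h : T.IsRoundTable r lab king x P lose) (hlk : ∀ i < r, lab (king i) = i + 1)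
    (hcard : ∀ i < r, (Finset.univ.filter fun v => lab v = i + 1).card = 2 ^ i)
    (hsk : ∀ i < r, ∀ b, lab b = i + 1 → T.dom b (king i) = true →
      i ≤ (Finset.univ.filter fun a => lab a = i + 1 ∧
        T.dom (king i) a = true ∧ T.dom a b = true).card) :
    ∃ σ : SEBracket (Fin (2 ^ r)) r, (∀ j, σ j = layout r lose x r j) ∧ T.WinsUnder σ x ∧
      T.HasSuperkingBlocks σ x := by
  have hinj : Function.Injective fun j : Fin (2 ^ r) => layout r lose x r j := fun i j hij =>
    Fin.ext (h.layout_inj r le_rfl i i.2 j j.2 hij)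
  refine ⟨Equiv.ofBijective _ (Finite.injective_iff_bijective.1 hinj), fun j => rfl, ?_, ?_⟩
  · have := h.winner_layout r 0 0 (by omega)
    simp only [Nat.mul_zero, Nat.zero_add] at this
    exact this
  · set σ : SEBracket (Fin (2 ^ r)) r :=
      Equiv.ofBijective _ (Finite.injective_iff_bijective.1 hinj) with hσ
    have hσ' : ∀ j, σ j = layout r lose x r j := fun j => rfl
    refine ⟨layout_zero_right r, fun i => ?_⟩
    have hi := i.2
    have hblock : ∀ j, σ.block i j = layout r lose x (r - i + i) (2 ^ (i : ℕ) * 1 + j) := by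
      intro j
      simp only [SEBracket.block, hσ']
      rw [Nat.sub_add_cancel hi.le, mul_one]
    have hking : layout r lose x (r - i) 1 = king i := by
      rw [show r - (i : ℕ) = (r - i - 1) + 1 by omega]
      simp only [layout]
      rw [if_neg (by norm_num), layout_zero_right, show r - (r - (i : ℕ) - 1) = i + 1 by omega,
        h.lose_x i hi]
    have hwin : T.winner i (σ.block i) = king i := by
      rw [← hking, ← h.winner_layout i (r - i) 1 (by omega)]
      exact congrArg _ (funext hblock)
    -- Labels are constant below position `1` at level `r - i`, which gives one inclusion; equality
    -- holds because both sets have `2 ^ i` elements.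
    have hset : σ.blockSet i = Finset.univ.filter fun v => lab v = (i : ℕ) + 1 := by
      apply Finset.eq_of_subset_of_card_le
      · intro v hv
        simp only [SEBracket.blockSet, Finset.mem_map, Finset.mem_univ, true_and] at hv
        obtain ⟨j, rfl⟩ := hv
        simp only [Finset.mem_filter, Finset.mem_univ, true_and]
        change lab (σ.block i j) = _
        rw [hblock, h.lab_layout le_rfl (Nat.one_lt_two_pow (by omega)) i (by omega) j j.2, hking,
          hlk i hi]
      · rw [hcard i hi]
        simp [SEBracket.blockSet]
    rw [hwin, hset]
    refine ⟨by simp [hlk i hi], fun b hb hbk => ?_⟩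
    simp only [Finset.mem_filter, Finset.mem_univ, true_and] at hb
    rw [hcard i hi, Finset.filter_filter]
    push_cast
    rw [Real.logb_pow, Real.logb_self_eq_one (by norm_num), mul_one]
    exact_mod_cast hsk i hi b hb hbk

end Tournament

/-! ### The program

Variables: `2` is the number of rounds, `3` a power of two, `4`, `5`, `6` are capacities, `7` and `8`
are counters, `10` is the index of a block, `11` is a round, and `20`, `21`, `22` are loop
counters. Arrays: `1` is the output, `2` contains the kings, `3` the labels, `4` the levels, `5` the
losers of the matches, and `6` is a copy of the output. -/

namespace KnockoutProg

open RamExp ForProg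

/-- `a` dominates `b`. -/
def domExp (a b : RamExp) : RamExp := .entry 0 (.add (.mul a (.var 0)) b)

/-- Increment a variable. -/
def incr (v : ℕ) : ForProg := .assign v (.add (.var v) (.const 1))

/-- Compute in variable `2` the number `r` of rounds. -/
def roundNumber : ForProg :=
  .seq (.assign 2 (.const 0)) <| .seq (.assign 3 (.const 1)) <|
    .forN 20 (.ite (less (.var 3) (.var 0))
      (.seq (incr 2) (.assign 3 (.add (.var 3) (.var 3)))) .skip)

/-- Compute in variable `v` the number `p * n / q` (rounded up). -/
def capacity (v p q : ℕ) : ForProg :=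
  .seq (.assign v (.const 0)) <|
    .forN 20 (.ite (less (.mul (.const q) (.var 20)) (.mul (.const p) (.var 0)))
      (.assign v (.add (.var 20) (.const 1))) .skip)

/-- Count in variable `8` the values of variable `21` that satisfy the condition `e`. -/
def count (e : RamExp) : ForProg :=
  .seq (.assign 8 (.const 0)) (.forN 21 (.ite e (incr 8) .skip))

/-- Choose as kings the first `r` alternatives that are dominated by `x` and dominate at least
`15 n / 32` alternatives. -/
def chooseKings : ForProg :=
  .seq (.assign 7 (.const 0)) <|
    .forN 20 <| .seq (count (domExp (.var 20) (.var 21))) <|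
      .ite (conj (domExp (.var 1) (.var 20))
          (conj (less (.mul (.const 15) (.var 0)) (.add (.mul (.const 32) (.var 8)) (.const 1)))
            (less (.var 7) (.var 2))))
        (.seq (.store 2 (.var 7) (.var 20)) (incr 7)) .skip

/-- The label of the block whose index is variable `10`. -/
def labelExp : RamExp := .add (.var 10) (.const 1)

/-- Put alternatives that are not in a block yet (if `d`, only those dominated by the king) into the
block whose index is variable `10`, until its size is variable `cap`. -/
def fillBlock (d : Bool) (cap : ℕ) : ForProg :=
  .seq (count (equal (.entry 3 (.var 21)) labelExp)) <|
    .forN 21 <| .ite (conj (equal (.entry 3 (.var 21)) (.const 0))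
        (conj (less (.var 8) (.var cap))
          (bif d then domExp (.entry 2 (.var 10)) (.var 21) else .const 1)))
      (.seq (.store 3 (.var 21) labelExp) (incr 8)) .skip

/-- Reserve alternatives for the two large blocks. -/
def reserve : ForProg :=
  .seq (.assign 10 (.sub (.var 2) (.const 1))) <| .seq (fillBlock true 4) <|
    .seq (.assign 10 (.sub (.var 2) (.const 2))) (fillBlock true 4)

/-- Label the kings and `x`. -/
def labelKings : ForProg :=
  .seq (.forN 20 <| .ite (less (.var 20) (.var 2))
    (.store 3 (.entry 2 (.var 20)) (.add (.var 20) (.const 1))) .skip) <|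
    .store 3 (.var 1) (.var 0)

/-- Fill the small blocks. -/
def fillSmall : ForProg :=
  .seq (.assign 3 (.const 1)) <|
    .forN 20 <| .ite (less (.add (.var 20) (.const 2)) (.var 2))
      (.seq (.assign 10 (.var 20)) <| .seq (fillBlock true 3)
        (.assign 3 (.add (.var 3) (.var 3)))) .skip

/-- Fill the two large blocks. -/
def fillLarge : ForProg :=
  .seq (.assign 10 (.sub (.var 2) (.const 2))) <| .seq (fillBlock false 5) <|
    .seq (.assign 10 (.sub (.var 2) (.const 1))) (fillBlock false 6)

/-- Make all possible matches `21` against `22` in round `11` that satisfy the condition `e`. -/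
def phase (e : RamExp) : ForProg :=
  .forN 21 <| .forN 22 <| .ite (conj (equal (.entry 4 (.var 21)) (.var 11))
      (conj (equal (.entry 4 (.var 22)) (.var 11))
        (conj (equal (.entry 3 (.var 21)) (.entry 3 (.var 22)))
          (conj (domExp (.var 21) (.var 22)) e))))
    (.seq (.store 5 (.add (.mul (.var 11) (.var 0)) (.var 21)) (.var 22)) <|
      .seq (.store 4 (.var 21) (.add (.var 11) (.const 1))) (.store 4 (.var 22) (.const 0))) .skip

/-- The king of the block of the alternative `21`. -/
def kingExp : RamExp := .entry 2 (.sub (.entry 3 (.var 21)) (.const 1))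

/-- Play round `11`. -/
def round : ForProg :=
  .seq (phase (equal (.var 21) kingExp)) <|
    .seq (phase (conj (domExp kingExp (.var 21)) (domExp (.var 22) kingExp))) <|
      phase (.const 1)

/-- Play all rounds. -/
def rounds : ForProg :=
  .seq (.forN 20 (.store 4 (.var 20) (.const 1))) <| .seq (.store 4 (.var 1) (.const 0)) <|
    .forN 20 <| .ite (less (.var 20) (.var 2))
      (.seq (.assign 11 (.add (.var 20) (.const 1))) <| .seq round <|
        .store 5 (.add (.mul (.var 11) (.var 0)) (.var 1)) (.entry 2 (.var 20))) .skip

/-- Compute the bracket from the losers of the matches. -/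
def expand : ForProg :=
  .seq (.store 1 (.const 0) (.var 1)) <|
    .forN 20 <| .ite (less (.var 20) (.var 2))
      (.seq (.assign 11 (.sub (.var 2) (.var 20))) <|
        .seq (.forN 21 (.store 6 (.var 21) (.entry 1 (.var 21)))) <|
          .forN 21 <| .seq (.store 1 (.add (.var 21) (.var 21)) (.entry 6 (.var 21))) <|
            .store 1 (.add (.add (.var 21) (.var 21)) (.const 1))
              (.entry 5 (.add (.mul (.var 11) (.var 0)) (.entry 6 (.var 21))))) .skip

/-- The whole program. -/
def main : ForProg :=
  .seq roundNumber <| .seq (capacity 4 13 128) <| .seq (capacity 5 1 4) <|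
    .seq (capacity 6 1 2) <| .seq chooseKings <| .seq reserve <| .seq labelKings <|
      .seq fillSmall <| .seq fillLarge <| .seq rounds expand

lemma main_wellFormed : main.wellFormed = true := rfl

/-! ### Correctness of the counters and capacities -/

/-- The state contains the input. -/
structure Input {n : ℕ} (T : Tournament (Fin n)) (x : Fin n) (s : RamState) : Prop where
  size : s.var 0 = n
  player : s.var 1 = x
  matrix : ∀ u v : Fin n, s.arr 0 (u * n + v) = (T.dom u v).toNat

section

variable {n : ℕ} {T : Tournament (Fin n)} {x : Fin n} {s : RamState}

lemma Input.run (h : Input T x s) (c : ForProg) (hc : c.wellFormed = true)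
    (h₁ : c.writesVar 1 = false) (h₀ : c.writesArr 0 = false) : Input T x (c.run s) where
  size := by rw [run_var_of_not_writesVar (writesVar_zero hc), h.size]
  player := by rw [run_var_of_not_writesVar h₁, h.player]
  matrix := by rw [run_arr_of_not_writesArr h₀]; exact h.matrix

lemma Input.setVar (h : Input T x s) {v : ℕ} (a : ℕ) (hv : 1 < v) :
    Input T x (s.setVar v a) where
  size := by rw [RamState.setVar_var_of_ne _ _ (by omega), h.size]
  player := by rw [RamState.setVar_var_of_ne _ _ (by omega), h.player]
  matrix := h.matrix

lemma Input.holds_domExp (h : Input T x s) {a b : RamExp} {u v : Fin n} (ha : a.eval s = u)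
    (hb : b.eval s = v) : Holds s (domExp a b) ↔ T.dom u v = true := by
  simp only [domExp, Holds, eval, ha, hb, h.size, h.matrix]
  cases T.dom u v <;> simp

end

lemma run_roundNumber {r : ℕ} {s : RamState} (hs : s.var 0 = 2 ^ r) :
    (roundNumber.run s).var 2 = r := by
  have hr : r < 2 ^ r := Nat.lt_two_pow_self
  rw [roundNumber, run_seq, run_seq]
  have key := forN_induction (v := 20) (c := .ite (less (.var 3) (.var 0))
      (.seq (incr 2) (.assign 3 (.add (.var 3) (.var 3)))) .skip) rfl
    -- The doubling stops after `r` iterations, and `r < 2 ^ r`, so that the loop is long enough.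
    (fun i s => s.var 2 = min i r ∧ s.var 3 = 2 ^ min i r) (n := 2 ^ r)
    (s := (ForProg.assign 3 (.const 1)).run ((ForProg.assign 2 (.const 0)).run s))
    (by simp [run_assign, hs]) ?_ ?_
  · rw [key.1]; omega
  · have : 1 ≤ 2 ^ r := Nat.one_le_two_pow
    simp [run_assign, eval, hs]; omega
  · rintro i _ s' h₀ _ ⟨h₁, h₂⟩
    classical
    rw [run_ite]
    by_cases hi : i < r
    · have e₁ : min i r = i := by omega
      have e₂ : min (i + 1) r = i + 1 := by omega
      have e₃ : i + 1 ≤ 2 ^ r := hi.trans_le Nat.lt_two_pow_self.le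
      have e₄ : 2 ^ (i + 1) ≤ 2 ^ r := Nat.pow_le_pow_right (by norm_num) hi
      rw [e₁] at h₁ h₂
      rw [if_pos (by simpa [eval, h₂, h₀] using Nat.pow_lt_pow_right (by norm_num) hi)]
      simp only [incr, run_assign, run_seq, RamState.setVar_var, eval, h₁, h₂, h₀, e₂]
      rw [pow_succ] at e₄ ⊢
      simp
      omega
    · have e₁ : min i r = r := by omega
      have e₂ : min (i + 1) r = r := by omega
      rw [e₁] at h₁ h₂
      rw [if_neg (by simp [eval, h₂, h₀])]
      simp [run_skip, h₁, h₂, e₂]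

/-- In place of a division, the largest `i` with `q * i < p * n` is sought by trial; for `n = q * m`
the condition is `i < p * m`. -/
lemma run_capacity {v p q m : ℕ} {s : RamState} (hv : v ≠ 0) (hv' : v ≠ 20) (hpq : p ≤ q)
    (hq : 0 < q) (hs : s.var 0 = q * m) : ((capacity v p q).run s).var v = p * m := by
  have hpm : p * m ≤ q * m := Nat.mul_le_mul_right _ hpq
  rw [capacity, run_seq]
  have key := forN_induction (v := 20)
    (c := .ite (less (.mul (.const q) (.var 20)) (.mul (.const p) (.var 0)))
      (.assign v (.add (.var 20) (.const 1))) .skip) (by simp [wellFormed, writesVar, hv, hv'])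
    (fun i s => s.var v = min i (p * m)) (n := q * m)
    (s := (ForProg.assign v (.const 0)).run s) (by simp [run_assign, hs, hv.symm]) ?_ ?_
  · rw [key]; omega
  · simp [run_assign, eval, hv']
  · intro i hi s' h₀ h₁ h
    classical
    rw [run_ite]
    have hiff : Holds s' (less (.mul (.const q) (.var 20)) (.mul (.const p) (.var 0))) ↔
        i < p * m := by
      simp only [holds_less, eval, h₁, h₀]
      rw [show p * (q * m) = q * (p * m) by ring]
      exact Nat.mul_lt_mul_left hq
    split_ifs with hc
    · rw [hiff] at hc
      simp only [run_assign, RamState.setVar_var, eval, h₁, h₀, hv', if_false, if_true]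
      omega
    · rw [hiff] at hc
      simp only [run_skip, RamState.setVar_var, hv', if_false, h]
      omega

lemma card_filter_lt_succ {n : ℕ} (A : Finset (Fin n)) (u : Fin n) :
    (A.filter fun w : Fin n => (w : ℕ) < u + 1).card =
      (A.filter fun w : Fin n => (w : ℕ) < u).card + if u ∈ A then 1 else 0 := by
  have : (A.filter fun w : Fin n => (w : ℕ) < u + 1) =
      (A.filter fun w : Fin n => (w : ℕ) < u) ∪ (if u ∈ A then {u} else ∅) := by
    ext w
    split_ifs with h <;> simp only [Finset.mem_filter, Finset.mem_union, Finset.mem_singleton,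
      Finset.notMem_empty, or_false]
    · constructor
      · rintro ⟨h₁, h₂⟩
        by_cases hw : w = u
        · exact Or.inr hw
        · have : (w : ℕ) ≠ u := fun h => hw (Fin.ext h)
          exact Or.inl ⟨h₁, by omega⟩
      · rintro (⟨h₁, h₂⟩ | rfl)
        · exact ⟨h₁, by omega⟩
        · exact ⟨h, by omega⟩
    · constructor
      · rintro ⟨h₁, h₂⟩
        have : (w : ℕ) ≠ u := fun h' => h (Fin.ext h' ▸ h₁)
        exact ⟨h₁, by omega⟩
      · rintro ⟨h₁, h₂⟩
        exact ⟨h₁, by omega⟩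
  rw [this, Finset.card_union_of_disjoint]
  · split_ifs <;> simp
  · rw [Finset.disjoint_left]
    intro w hw
    split_ifs <;> simp only [Finset.mem_filter, Finset.mem_singleton, Finset.notMem_empty,
      not_false_eq_true] at hw ⊢
    rintro rfl; omega

lemma count_writesVar (e : RamExp) (v : ℕ) (h₁ : v ≠ 8) (h₂ : v ≠ 21) :
    (count e).writesVar v = false := by
  simp [count, incr, writesVar, h₁.symm, h₂.symm]

/-- The loop itself changes variables `8` and `21`, so the meaning of `e` has to be known in all
states that differ from `s` only there. -/
lemma run_count {n : ℕ} {s : RamState} (hs : s.var 0 = n) {e : RamExp} {A : Finset (Fin n)}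
    (hA : ∀ s' : RamState, s'.arr = s.arr → (∀ v, v ≠ 8 → v ≠ 21 → s'.var v = s.var v) →
      ∀ u : Fin n, s'.var 21 = u → (Holds s' e ↔ u ∈ A)) :
    ((count e).run s).var 8 = A.card := by
  classical
  rw [count, run_seq]
  have key := forN_induction (v := 21) (c := .ite e (incr 8) .skip) rfl
    (fun i s' => s'.arr = s.arr ∧ (∀ v, v ≠ 8 → v ≠ 21 → s'.var v = s.var v) ∧
      s'.var 8 = (A.filter fun w : Fin n => (w : ℕ) < i).card)
    (s := (ForProg.assign 8 (.const 0)).run s) (n := n) (by simp [run_assign, hs]) ?_ ?_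
  · rw [key.2.2]
    congr 1
    simp [Finset.filter_true_of_mem]
  · refine ⟨rfl, fun v h h' => by simp [run_assign, h, h'], ?_⟩
    simp [run_assign, eval]
  · rintro i hi s' h₀ h₁ ⟨h₂, h₃, h₄⟩
    have hiff := hA s' h₂ h₃ ⟨i, hi⟩ h₁
    have hc := card_filter_lt_succ A ⟨i, hi⟩
    have hle : (A.filter fun w : Fin n => (w : ℕ) < i + 1).card ≤ n := by
      simpa using Finset.card_le_univ (A.filter fun w : Fin n => (w : ℕ) < i + 1)
    simp only at hc
    rw [run_ite, hc]
    split_ifs with g g' g'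
    · refine ⟨h₂, fun v h h' => ?_, ?_⟩
      · simp [incr, run_assign, h, h', h₃ v h h']
      · rw [if_pos g'] at hc
        simp [incr, run_assign, eval, h₄, h₀]
        omega
    · exact absurd (hiff.1 g) g'
    · exact absurd (hiff.2 g') g
    · refine ⟨h₂, fun v h h' => ?_, ?_⟩
      · simp [run_skip, h', h₃ v h h']
      · simp [run_skip, h₄]

end KnockoutProg

/-! ### Choosing the kings and filling a block -/

/-- The number of alternatives dominated by `u`. -/
def Tournament.outdegree {n : ℕ} (T : Tournament (Fin n)) (u : Fin n) : ℕ :=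
  (Finset.univ.filter fun v => T.dom u v = true).card

/-- The alternatives dominated by `x` that dominate at least `15 n / 32` alternatives. -/
def Tournament.candidates {n : ℕ} (T : Tournament (Fin n)) (x : Fin n) : Finset (Fin n) :=
  Finset.univ.filter fun u => T.dom x u = true ∧ 15 * n ≤ 32 * T.outdegree u

/-- The first `k` elements of `A`. -/
def firstElements {n : ℕ} (k : ℕ) (A : Finset (Fin n)) : Finset (Fin n) :=
  A.filter fun v => (A.filter fun w : Fin n => (w : ℕ) < v).card < k

lemma firstElements_subset {n : ℕ} (k : ℕ) (A : Finset (Fin n)) : firstElements k A ⊆ A :=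
  Finset.filter_subset _ _

/-- Induction over initial segments: the count stops growing once it reaches `k`, just as in the
greedy loops. -/
lemma card_firstElements {n : ℕ} (k : ℕ) (A : Finset (Fin n)) :
    (firstElements k A).card = min k A.card := by
  have key : ∀ i ≤ n, ((firstElements k A).filter fun w : Fin n => (w : ℕ) < i).card =
      min k (A.filter fun w : Fin n => (w : ℕ) < i).card := by
    intro i
    induction i with
    | zero => simp
    | succ i ih =>
      intro hi
      have h₁ := KnockoutProg.card_filter_lt_succ A ⟨i, by omega⟩
      have h₂ := KnockoutProg.card_filter_lt_succ (firstElements k A) ⟨i, by omega⟩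
      simp only at h₁ h₂
      rw [h₁, h₂, ih (by omega)]
      simp only [firstElements, Finset.mem_filter]
      split_ifs <;> grind
  have := key n le_rfl
  simpa [Finset.filter_true_of_mem] using this

namespace KnockoutProg

open RamExp ForProg

section

variable {n : ℕ} {T : Tournament (Fin n)} {x : Fin n} {s : RamState}

lemma run_chooseKings (h : Input T x s) {r : ℕ} (hr : s.var 2 = r)
    (hc : r ≤ (T.candidates x).card) :
    ∃ king : ℕ → Fin n, (∀ i < r, (chooseKings.run s).arr 2 i = king i ∧
      king i ∈ T.candidates x) ∧ ∀ i < r, ∀ j < r, king i = king j → i = j := by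
  classical
  set G := T.candidates x with hG
  have hrn : r ≤ n := hc.trans (by simpa using Finset.card_le_univ G)
  rw [chooseKings, run_seq]
  have key := forN_induction (v := 20)
    (c := .seq (count (domExp (.var 20) (.var 21))) <|
      .ite (conj (domExp (.var 1) (.var 20))
          (conj (less (.mul (.const 15) (.var 0)) (.add (.mul (.const 32) (.var 8)) (.const 1)))
            (less (.var 7) (.var 2))))
        (.seq (.store 2 (.var 7) (.var 20)) (incr 7)) .skip) rfl
    (fun i s => Input T x s ∧ s.var 2 = r ∧
      s.var 7 = min r (G.filter fun w : Fin n => (w : ℕ) < i).card ∧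
      (∀ j < s.var 7, ∃ u ∈ G, (u : ℕ) < i ∧ s.arr 2 j = u) ∧
      ∀ j < s.var 7, ∀ k < s.var 7, s.arr 2 j = s.arr 2 k → j = k)
    (n := n) (s := (ForProg.assign 7 (.const 0)).run s) (by simp [run_assign, h.size]) ?_ ?_
  · obtain ⟨-, -, k₁, k₂, k₃⟩ := key
    have e : min r (G.filter fun w : Fin n => (w : ℕ) < n).card = r := by
      simpa [Finset.filter_true_of_mem] using hc
    rw [e] at k₁
    rw [k₁] at k₂ k₃
    have hx : ∀ i, ∃ u, i < r → u ∈ G ∧ _ = (u : ℕ) := fun i => by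
      by_cases hi : i < r
      · obtain ⟨u, hu, -, hu'⟩ := k₂ i hi
        exact ⟨u, fun _ => ⟨hu, hu'⟩⟩
      · exact ⟨x, fun hi' => absurd hi' hi⟩
    choose king hk using hx
    refine ⟨king, fun i hi => ⟨(hk i hi).2, (hk i hi).1⟩, fun i hi j hj hij => k₃ i hi j hj ?_⟩
    rw [(hk i hi).2, (hk j hj).2, hij]
  · refine ⟨(h.run _ rfl rfl rfl).setVar _ (by norm_num), ?_, ?_, ?_, ?_⟩
    · simp [run_assign, hr]
    · simp [run_assign, eval]
    · simp [run_assign, eval]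
    · simp [run_assign, eval]
  · rintro i hi s' - hv ⟨g₁, g₂, g₃, g₄, g₅⟩
    rw [run_seq]
    have hdeg : ((count (domExp (.var 20) (.var 21))).run s').var 8 = T.outdegree ⟨i, hi⟩ := by
      refine run_count g₁.size fun s'' e₁ e₂ u hu => ?_
      have hin : Input T x s'' := ⟨by rw [e₂ 0 (by norm_num) (by norm_num), g₁.size],
        by rw [e₂ 1 (by norm_num) (by norm_num), g₁.player], by rw [e₁]; exact g₁.matrix⟩
      have h20 : s''.var 20 = i := by rw [e₂ 20 (by norm_num) (by norm_num), hv]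
      rw [hin.holds_domExp (u := ⟨i, hi⟩) (v := u) (by simp [eval, h20]) (by simp [eval, hu])]
      simp
    have f₁ := g₁.run (count (domExp (.var 20) (.var 21))) rfl rfl rfl
    have fv : ∀ v, v ≠ 8 → v ≠ 21 → ((count (domExp (.var 20) (.var 21))).run s').var v =
        s'.var v := fun v h₁ h₂ => run_var_of_not_writesVar (count_writesVar _ v h₁ h₂) s'
    have fa : ((count (domExp (.var 20) (.var 21))).run s').arr 2 = s'.arr 2 :=
      run_arr_of_not_writesArr rfl s'
    set s₁ := (count (domExp (.var 20) (.var 21))).run s'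
    have f20 : s₁.var 20 = i := by rw [fv 20 (by norm_num) (by norm_num), hv]
    have f2 : s₁.var 2 = r := by rw [fv 2 (by norm_num) (by norm_num), g₂]
    have f7 : s₁.var 7 = s'.var 7 := fv 7 (by norm_num) (by norm_num)
    -- Only strict comparisons are available; `15 n < 32 d + 1` expresses `15 n ≤ 32 d`.
    have hiff : Holds s₁ (conj (domExp (.var 1) (.var 20))
          (conj (less (.mul (.const 15) (.var 0)) (.add (.mul (.const 32) (.var 8)) (.const 1)))
            (less (.var 7) (.var 2)))) ↔ (⟨i, hi⟩ : Fin n) ∈ G ∧ s'.var 7 < r := by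
      rw [holds_conj, holds_conj, f₁.holds_domExp (u := x) (v := ⟨i, hi⟩)
        (by simp [eval, f₁.player]) (by simp [eval, f20]), holds_less, holds_less]
      simp only [eval, f2, f7, hdeg, f₁.size, Nat.lt_succ_iff, hG, Tournament.candidates,
        Finset.mem_filter, Finset.mem_univ, true_and, and_assoc]
    have hcard := card_filter_lt_succ G ⟨i, hi⟩
    simp only at hcard
    rw [run_ite, hcard]
    split_ifs with c₁ c₂ c₂
    · rw [hiff] at c₁
      have e₁ : (s'.var 7 : ℕ) = (G.filter fun w : Fin n => (w : ℕ) < i).card := by omega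
      refine ⟨?_, ?_, ?_, ?_, ?_⟩
      · exact (f₁.run _ rfl rfl rfl).setVar _ (by norm_num)
      · simp [run_seq, run_store, incr, run_assign, f2]
      · simp [run_seq, run_store, incr, run_assign, eval, f7, f₁.size]
        omega
      · intro j hj
        simp only [run_seq, run_store, incr, run_assign, eval, RamState.setVar_arr,
          RamState.setArr_var, f7, f20, f₁.size, RamState.setArr_arr_self, fa] at hj ⊢
        simp at hj
        split_ifs with hj'
        · exact ⟨⟨i, hi⟩, c₁.1, by simp, by simp; omega⟩
        · obtain ⟨u, hu, hu', hu''⟩ := g₄ j (by omega)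
          exact ⟨u, hu, by omega, hu''⟩
      · intro j hj k hk
        simp only [run_seq, run_store, incr, run_assign, eval, RamState.setVar_arr,
          RamState.setArr_var, f7, f20, f₁.size, RamState.setArr_arr_self, fa] at hj hk ⊢
        simp at hj hk
        -- The stored kings come from earlier iterations and are below `i`, so the new one is
        -- different.
        have old : ∀ j < s'.var 7, s'.arr 2 j ≠ min i n := by
          intro j hj
          obtain ⟨u, -, hu', hu''⟩ := g₄ j hj
          omega
        split_ifs with h₁ h₂ h₂
        · omega
        · exact fun h => absurd h.symm (old k (by omega))
        · exact fun h => absurd h (old j (by omega))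
        · exact g₅ j (by omega) k (by omega)
    · exact absurd (hiff.1 c₁).1 c₂
    · have : ¬ s'.var 7 < r := fun h => c₁ (hiff.2 ⟨c₂, h⟩)
      simp only [run_skip]
      refine ⟨f₁.setVar _ (by norm_num), by simp [f2], ?_, ?_, ?_⟩
      · simp [f7]; omega
      · simp only [RamState.setVar_arr, fa]
        simp only [RamState.setVar_var_of_ne _ _ (show 7 ≠ 20 by norm_num), f7]
        exact fun j hj => (g₄ j hj).imp fun u hu => ⟨hu.1, by omega, hu.2.2⟩
      · simp only [RamState.setVar_arr, fa]
        simpa only [RamState.setVar_var_of_ne _ _ (show 7 ≠ 20 by norm_num), f7] using g₅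
    · simp only [run_skip]
      refine ⟨f₁.setVar _ (by norm_num), by simp [f2], ?_, ?_, ?_⟩
      · simp [f7]; omega
      · simp only [RamState.setVar_arr, fa]
        simp only [RamState.setVar_var_of_ne _ _ (show 7 ≠ 20 by norm_num), f7]
        exact fun j hj => (g₄ j hj).imp fun u hu => ⟨hu.1, by omega, hu.2.2⟩
      · simp only [RamState.setVar_arr, fa]
        simpa only [RamState.setVar_var_of_ne _ _ (show 7 ≠ 20 by norm_num), f7] using g₅

/-- The labels after putting the first elements of `A` into the class `L` until its size is
`cap`. -/
def fillLabels (L cap : ℕ) (A : Finset (Fin n)) (lab : Fin n → ℕ) (v : Fin n) : ℕ :=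
  if v ∈ firstElements (cap - (Finset.univ.filter fun u => lab u = L).card) A then L else lab v

/-- The counter starts with the present size of the class, so that the king and the reserve count
towards the capacity. Alternatives are met in increasing order, whence `firstElements`. -/
lemma run_fillBlock (h : Input T x s) (d : Bool) {cap : ℕ} (hcap : cap ≠ 8) (hcap' : cap ≠ 21)
    {lab : Fin n → ℕ} (hlab : ∀ v : Fin n, s.arr 3 v = lab v) {A : Finset (Fin n)}
    {k : Fin n} (hk : s.arr 2 (s.var 10) = k)
    (hA : ∀ v, v ∈ A ↔ lab v = 0 ∧ (d = true → T.dom k v = true)) (hL : s.var 10 + 1 ≤ n)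
    (hle : (Finset.univ.filter fun u => lab u = s.var 10 + 1).card ≤ s.var cap) (v : Fin n) :
    ((fillBlock d cap).run s).arr 3 v = fillLabels (s.var 10 + 1) (s.var cap) A lab v := by
  classical
  set L := s.var 10 + 1 with hLdef
  set c₀ := (Finset.univ.filter fun u => lab u = L).card with hc₀
  set F := firstElements (s.var cap - c₀) A with hF
  rw [fillBlock, run_seq]
  have hcount : ((count (equal (.entry 3 (.var 21)) labelExp)).run s).var 8 = c₀ := by
    refine run_count h.size fun s' e₁ e₂ u hu => ?_
    rw [holds_equal]
    simp only [labelExp, eval, e₁, hu, e₂ 10 (by norm_num) (by norm_num), hlab]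
    simp [hLdef]
  have f₁ := h.run (count (equal (.entry 3 (.var 21)) labelExp)) rfl rfl rfl
  have fv : ∀ v, v ≠ 8 → v ≠ 21 → ((count (equal (.entry 3 (.var 21)) labelExp)).run s).var v =
      s.var v := fun v h₁ h₂ => run_var_of_not_writesVar (count_writesVar _ v h₁ h₂) s
  have fa : ∀ a, ((count (equal (.entry 3 (.var 21)) labelExp)).run s).arr a = s.arr a :=
    fun a => run_arr_of_not_writesArr rfl s
  set s₁ := (count (equal (.entry 3 (.var 21)) labelExp)).run s
  have key := forN_induction (v := 21)
    (c := .ite (conj (equal (.entry 3 (.var 21)) (.const 0))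
        (conj (less (.var 8) (.var cap))
          (bif d then domExp (.entry 2 (.var 10)) (.var 21) else .const 1)))
      (.seq (.store 3 (.var 21) labelExp) (incr 8)) .skip) rfl
    (fun i s' => Input T x s' ∧ s'.var cap = s.var cap ∧ s'.var 10 = s.var 10 ∧
      s'.arr 2 = s.arr 2 ∧
      s'.var 8 = min (s.var cap) (c₀ + (A.filter fun w : Fin n => (w : ℕ) < i).card) ∧
      ∀ v : Fin n, s'.arr 3 v = if v ∈ F ∧ (v : ℕ) < i then L else lab v)
    (n := n) (s := s₁) f₁.size ?_ ?_
  · have := key.2.2.2.2.2 v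
    simp only [v.2, and_true] at this
    exact this
  · refine ⟨f₁.setVar _ (by norm_num), ?_, ?_, ?_, ?_, ?_⟩
    · simp [hcap', fv _ hcap hcap']
    · simp [fv 10 (by norm_num) (by norm_num)]
    · simp [fa]
    · simp [hcount, hle]
    · simp [fa, hlab]
  · rintro i hi s' - hv ⟨g₁, g₂, g₃, g₄, g₅, g₆⟩
    set u : Fin n := ⟨i, hi⟩ with hu
    have hlu : s'.arr 3 i = lab u := by simpa [hu] using g₆ u
    have hiff : Holds s' (conj (equal (.entry 3 (.var 21)) (.const 0))
        (conj (less (.var 8) (.var cap))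
          (bif d then domExp (.entry 2 (.var 10)) (.var 21) else .const 1))) ↔ u ∈ F := by
      have hd : Holds s' (bif d then domExp (.entry 2 (.var 10)) (.var 21) else .const 1) ↔
          (d = true → T.dom k u = true) := by
        cases d
        · simp [Holds, eval]
        · simp only [cond_true, forall_const]
          exact g₁.holds_domExp (by simp [eval, g₃, g₄, hk]) (by simp [eval, hv, hu])
      rw [holds_conj, holds_conj, holds_equal, holds_less, hd, hF, firstElements,
        Finset.mem_filter, hA]
      simp only [eval, hv, hlu, g₂, g₅, hu]
      constructor
      · rintro ⟨a, b, c⟩; exact ⟨⟨a, c⟩, by omega⟩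
      · rintro ⟨⟨a, c⟩, b⟩; exact ⟨a, by omega, c⟩
    have hcard := card_filter_lt_succ A u
    -- The class and `A` are disjoint because the elements of `A` are unlabelled, so the counter
    -- stays below `n` and its truncation has no effect.
    have hcn : c₀ + (A.filter fun w : Fin n => (w : ℕ) < i + 1).card ≤ n := by
      rw [← Finset.card_union_of_disjoint]
      · simpa using Finset.card_le_univ (_ : Finset (Fin n))
      · rw [Finset.disjoint_left]
        intro w hw hw'
        simp only [Finset.mem_filter, Finset.mem_univ, true_and, hA] at hw hw'
        omega
    have hsplit : ∀ v : Fin n, v ≠ u → ((v : ℕ) < i + 1 ↔ (v : ℕ) < i) := fun v hv => by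
      have : (v : ℕ) ≠ i := fun h => hv (Fin.ext h)
      omega
    rw [run_ite]
    split_ifs with c₁
    · rw [hiff] at c₁
      have c₂ := c₁
      rw [hF, firstElements, Finset.mem_filter] at c₂
      rw [if_pos c₂.1] at hcard
      simp only [hu] at c₂ hcard
      refine ⟨(g₁.run _ rfl rfl rfl).setVar _ (by norm_num), ?_, ?_, ?_, ?_, ?_⟩
      · simp [run_seq, run_store, incr, run_assign, g₂, hcap, hcap']
      · simp [run_seq, run_store, incr, run_assign, g₃]
      · simp [run_seq, run_store, incr, run_assign, g₄]
      · rw [hcard]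
        simp [run_seq, run_store, incr, run_assign, eval, g₅, g₁.size]
        omega
      · intro v
        simp only [run_seq, run_store, incr, run_assign, eval, RamState.setVar_arr, labelExp, hv,
          RamState.setArr_arr_self, g₁.size, g₃]
        split_ifs with h₁ h₂ h₂
        · omega
        · exact absurd ⟨(Fin.ext h₁ : v = u) ▸ c₁, by omega⟩ h₂
        · rw [g₆, if_pos ⟨h₂.1, by omega⟩]
        · rw [g₆, if_neg (fun h => h₂ ⟨h.1, by omega⟩)]
    · rw [hiff] at c₁
      refine ⟨g₁.setVar _ (by norm_num), ?_, ?_, ?_, ?_, ?_⟩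
      · simp [run_skip, g₂, hcap']
      · simp [run_skip, g₃]
      · simp [run_skip, g₄]
      · simp only [run_skip, RamState.setVar_var_of_ne _ _ (show 8 ≠ 21 by norm_num), g₅]
        simp only [hu] at hcard
        rw [hcard]
        by_cases c₂ : u ∈ A
        · rw [if_pos c₂]
          have : ¬ (A.filter fun w : Fin n => (w : ℕ) < i).card < s.var cap - c₀ := fun h =>
            c₁ (by rw [hF, firstElements, Finset.mem_filter]; exact ⟨c₂, h⟩)
          omega
        · rw [if_neg c₂]; rfl
      · intro v
        simp only [run_skip, RamState.setVar_arr, g₆]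
        by_cases hvu : v = u
        · rw [hvu, if_neg (fun h => c₁ h.1), if_neg (fun h => c₁ h.1)]
        · simp only [hsplit v hvu]

lemma fillBlock_writesVar (d : Bool) (cap v : ℕ) (h₁ : v ≠ 8) (h₂ : v ≠ 21) :
    (fillBlock d cap).writesVar v = false := by
  simp [fillBlock, count, incr, writesVar, h₁.symm, h₂.symm]

end

end KnockoutProg

/-- The alternatives dominated by `y`. -/
def Tournament.dominated {n : ℕ} (T : Tournament (Fin n)) (y : Fin n) : Finset (Fin n) :=
  Finset.univ.filter fun v => T.dom y v = true

/-- The alternatives reserved for the last block if its king is `y`. -/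
def Tournament.firstReserve {n : ℕ} (T : Tournament (Fin n)) (c : ℕ) (y : Fin n) :
    Finset (Fin n) :=
  firstElements c (T.dominated y)

/-- The alternatives reserved for the last but one block if its king is `y` and the king of the last
block is `y'`. -/
def Tournament.secondReserve {n : ℕ} (T : Tournament (Fin n)) (c : ℕ) (y' y : Fin n) :
    Finset (Fin n) :=
  firstElements c (T.dominated y \ T.firstReserve c y')

/-- The properties of a tournament that imply that the program finds a bracket for `x`. -/
structure Tournament.IsTypical {n : ℕ} (T : Tournament (Fin n)) (r c : ℕ) (x : Fin n) : Prop where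
  candidates : r ≤ (T.candidates x).card
  first : ∀ y z, z ≠ y → 15 * n ≤ 32 * T.outdegree y →
    2 * r ≤ ((T.firstReserve c y).filter fun v => T.dom v z = true).card
  second : ∀ y' y z, z ≠ y' → z ≠ y → 15 * n ≤ 32 * T.outdegree y' →
    15 * n ≤ 32 * T.outdegree y →
    2 * r ≤ ((T.secondReserve c y' y).filter fun v => T.dom v z = true).card

/-! ### Sizes and composition of the blocks -/

namespace KnockoutProg

open RamExp ForProg

section FillLabels

variable {n : ℕ} {L cap : ℕ} {A : Finset (Fin n)} {lab : Fin n → ℕ}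

lemma fillLabels_cases (v : Fin n) : fillLabels L cap A lab v = lab v ∨
    v ∈ A ∧ fillLabels L cap A lab v = L := by
  rw [fillLabels]
  split_ifs with h
  · exact Or.inr ⟨firstElements_subset _ _ h, rfl⟩
  · exact Or.inl rfl

lemma fillLabels_of_ne_zero (hA : ∀ v ∈ A, lab v = 0) {v : Fin n} (hv : lab v ≠ 0) :
    fillLabels L cap A lab v = lab v := by
  rcases fillLabels_cases (L := L) (cap := cap) (A := A) (lab := lab) v with h | h
  · exact h
  · exact absurd (hA v h.1) hv

lemma card_fillLabels_self (hA : ∀ v ∈ A, lab v = 0) (hL : L ≠ 0) :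
    (Finset.univ.filter fun v => fillLabels L cap A lab v = L).card =
      (Finset.univ.filter fun v => lab v = L).card +
        min (cap - (Finset.univ.filter fun v => lab v = L).card) A.card := by
  rw [← card_firstElements, ← Finset.card_union_of_disjoint]
  · congr 1
    ext v
    simp only [Finset.mem_filter, Finset.mem_univ, true_and, Finset.mem_union]
    rw [fillLabels]
    split_ifs with h <;> simp [h]
  · rw [Finset.disjoint_left]
    intro v hv hv'
    have := hA v (firstElements_subset _ _ hv')
    simp only [Finset.mem_filter, Finset.mem_univ, true_and] at hv
    omega

lemma card_fillLabels_zero (hA : ∀ v ∈ A, lab v = 0) (hL : L ≠ 0) :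
    (Finset.univ.filter fun v => fillLabels L cap A lab v = 0).card +
        min (cap - (Finset.univ.filter fun v => lab v = L).card) A.card =
      (Finset.univ.filter fun v => lab v = 0).card := by
  rw [← card_firstElements, ← Finset.card_union_of_disjoint]
  · congr 1
    ext v
    simp only [Finset.mem_filter, Finset.mem_univ, true_and, Finset.mem_union]
    rw [fillLabels]
    split_ifs with h
    · simp [h, hA v (firstElements_subset _ _ h)]
    · simp [h]
  · rw [Finset.disjoint_left]
    intro v hv hv'
    simp only [Finset.mem_filter, Finset.mem_univ, true_and] at hv
    rw [fillLabels, if_pos hv'] at hv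
    exact hL hv

lemma filter_fillLabels_of_ne (hA : ∀ v ∈ A, lab v = 0) {M : ℕ} (hM : M ≠ 0) (hML : M ≠ L) :
    (Finset.univ.filter fun v => fillLabels L cap A lab v = M) =
      Finset.univ.filter fun v => lab v = M := by
  ext v
  simp only [Finset.mem_filter, Finset.mem_univ, true_and]
  rcases fillLabels_cases (L := L) (cap := cap) (A := A) (lab := lab) v with h | h
  · rw [h]
  · rw [h.2, hA v h.1]
    exact ⟨fun h => absurd h.symm hML, fun h => absurd h.symm hM⟩

end FillLabels

section Labels

variable {n : ℕ} {T : Tournament (Fin n)} {x : Fin n} {r m : ℕ} {king : ℕ → Fin n}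

/-- Distinct kings, chosen among the candidates. -/
structure AreKings (T : Tournament (Fin n)) (x : Fin n) (r : ℕ) (king : ℕ → Fin n) : Prop where
  mem : ∀ i < r, king i ∈ T.candidates x
  inj : ∀ i < r, ∀ j < r, king i = king j → i = j

lemma AreKings.dom (h : AreKings T x r king) {i : ℕ} (hi : i < r) :
    T.dom x (king i) = true := by
  have := h.mem i hi
  simp only [Tournament.candidates, Finset.mem_filter] at this
  exact this.2.1

lemma AreKings.outdegree (h : AreKings T x r king) {i : ℕ} (hi : i < r) :
    15 * n ≤ 32 * T.outdegree (king i) := by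
  have := h.mem i hi
  simp only [Tournament.candidates, Finset.mem_filter] at this
  exact this.2.2

/-- The labels after the first steps: those of the kings, of `x`, and of the alternatives reserved
for the two large blocks. -/
structure StartLabels (T : Tournament (Fin n)) (x : Fin n) (r m : ℕ) (king : ℕ → Fin n)
    (lab : Fin n → ℕ) : Prop where
  king_lab : ∀ i < r, lab (king i) = i + 1
  player : lab x = n
  first : ∀ v ∈ T.firstReserve (13 * m) (king (r - 1)), v ≠ x → (∀ i < r, v ≠ king i) →
    lab v = r
  second : ∀ v ∈ T.secondReserve (13 * m) (king (r - 1)) (king (r - 2)), v ≠ x →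
    (∀ i < r, v ≠ king i) → lab v = r - 1
  cases : ∀ v, v = x ∨ (∃ i < r, v = king i) ∨ lab v = 0 ∨
    lab v = r ∧ v ∈ T.firstReserve (13 * m) (king (r - 1)) ∨
    lab v = r - 1 ∧ v ∈ T.secondReserve (13 * m) (king (r - 1)) (king (r - 2))

/-- The labels when the first `i` small blocks are complete. -/
structure SmallLabels (T : Tournament (Fin n)) (x : Fin n) (r m : ℕ) (king : ℕ → Fin n)
    (lab₀ : Fin n → ℕ) (i : ℕ) (lab : Fin n → ℕ) : Prop where
  ext : ∀ v, lab₀ v ≠ 0 → lab v = lab₀ v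
  le : ∀ v, v ≠ x → lab v ≤ r
  dom : ∀ j < r - 2, ∀ v, lab v = j + 1 → v = king j ∨ T.dom (king j) v = true
  card : ∀ j < i, (Finset.univ.filter fun v => lab v = j + 1).card = 2 ^ j
  card_one : ∀ j < r - 2, i ≤ j → (Finset.univ.filter fun v => lab v = j + 1).card = 1
  large : (Finset.univ.filter fun v => lab v = r - 1).card ≤ 13 * m + 1
  large' : (Finset.univ.filter fun v => lab v = r).card ≤ 13 * m + 1
  zero : (Finset.univ.filter fun v => lab v = 0).card +
    (Finset.univ.filter fun v => lab v = r - 1).card +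
    (Finset.univ.filter fun v => lab v = r).card + r + 2 ^ i = n + i + 2

/-- The labels when all blocks are complete. -/
structure FinalLabels (T : Tournament (Fin n)) (x : Fin n) (r : ℕ) (king : ℕ → Fin n)
    (lab : Fin n → ℕ) : Prop where
  king_lab : ∀ i < r, lab (king i) = i + 1
  player : lab x = n
  pos : ∀ v, 1 ≤ lab v
  le : ∀ v, v ≠ x → lab v ≤ r
  card : ∀ i < r, (Finset.univ.filter fun v => lab v = i + 1).card = 2 ^ i
  superking : ∀ i < r, ∀ b, lab b = i + 1 → T.dom b (king i) = true →
      i ≤ (Finset.univ.filter fun a => lab a = i + 1 ∧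
        T.dom (king i) a = true ∧ T.dom a b = true).card

lemma StartLabels.small (hk : AreKings T x r king) (hr : 2 ≤ r) (hrn : r < n)
    {lab : Fin n → ℕ} (h : StartLabels T x r m king lab) :
    SmallLabels T x r m king lab 0 lab := by
  have hx : ∀ i < r, king i ≠ x := fun i hi e => T.dom_ne (hk.dom hi) e.symm
  have hone : ∀ j < r - 2, (Finset.univ.filter fun v => lab v = j + 1) = {king j} := by
    intro j hj
    ext v
    simp only [Finset.mem_filter, Finset.mem_univ, true_and, Finset.mem_singleton]
    constructor
    · intro hv
      rcases h.cases v with rfl | ⟨i, hi, rfl⟩ | h' | h' | h'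
      · have := h.player; omega
      · rw [h.king_lab i hi] at hv
        rw [show i = j by omega]
      · omega
      · omega
      · omega
    · rintro rfl; exact h.king_lab j (by omega)
  have hle : ∀ v, v ≠ x → lab v ≤ r := by
    intro v hv
    rcases h.cases v with rfl | ⟨i, hi, rfl⟩ | h' | h' | h'
    · exact absurd rfl hv
    · rw [h.king_lab i hi]; omega
    · omega
    · omega
    · omega
  have hlarge : ∀ j, ∀ S : Finset (Fin n), S.card ≤ 13 * m →
      (∀ v, lab v = j → v ∈ insert (king (j - 1)) S) →
      (Finset.univ.filter fun v => lab v = j).card ≤ 13 * m + 1 := by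
    intro j S hS hj
    refine (Finset.card_le_card (t := insert (king (j - 1)) S) fun v hv => ?_).trans
      ((Finset.card_insert_le _ _).trans (by omega))
    simp only [Finset.mem_filter, Finset.mem_univ, true_and] at hv
    exact hj v hv
  refine ⟨fun v _ => rfl, hle, fun j hj v hv => Or.inl ?_, fun j hj => by omega,
    fun j hj _ => ?_, ?_, ?_, ?_⟩
  · have : v ∈ Finset.univ.filter fun v => lab v = j + 1 := by simp [hv]
    rw [hone j hj] at this
    simpa using this
  · rw [hone j hj, Finset.card_singleton]
  · refine hlarge (r - 1) (T.secondReserve (13 * m) (king (r - 1)) (king (r - 2)))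
      (by rw [Tournament.secondReserve, card_firstElements]; exact min_le_left _ _) ?_
    intro v hv
    rw [Finset.mem_insert]
    rcases h.cases v with rfl | ⟨i, hi, rfl⟩ | h' | h' | h'
    · have := h.player; omega
    · rw [h.king_lab i hi] at hv
      left; congr 1; omega
    · omega
    · omega
    · exact Or.inr h'.2
  · refine hlarge r (T.firstReserve (13 * m) (king (r - 1)))
      (by rw [Tournament.firstReserve, card_firstElements]; exact min_le_left _ _) ?_
    intro v hv
    rw [Finset.mem_insert]
    rcases h.cases v with rfl | ⟨i, hi, rfl⟩ | h' | h' | h'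
    · have := h.player; omega
    · rw [h.king_lab i hi] at hv
      left; congr 1; omega
    · omega
    · exact Or.inr h'.2
    · omega
  -- All alternatives are counted by label: `x` has the label `n`, each of the `r - 2` small classes
  -- contains only its king, and the labels `0`, `r - 1`, `r` remain.
  · have hsum := Finset.card_eq_sum_card_fiberwise (s := (Finset.univ : Finset (Fin n)))
      (t := insert n (Finset.range (r + 1))) (f := lab) (by
        intro v _
        simp only [Finset.coe_insert, Finset.coe_range, Set.mem_insert_iff, Set.mem_Iio]
        by_cases hv : v = x
        · left; rw [hv, h.player]
        · right; have := hle v hv; omega)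
    have hn : (Finset.univ.filter fun v => lab v = n) = {x} := by
      ext v
      simp only [Finset.mem_filter, Finset.mem_univ, true_and, Finset.mem_singleton]
      constructor
      · intro hv
        by_contra hvx
        have := hle v hvx; omega
      · rintro rfl; exact h.player
    obtain ⟨q, rfl⟩ : ∃ q, r = q + 2 := ⟨r - 2, by omega⟩
    rw [Finset.sum_insert (by simp; omega), Finset.sum_range_succ, Finset.sum_range_succ,
      Finset.sum_range_succ', hn] at hsum
    rw [Finset.sum_congr rfl (g := fun _ => 1)] at hsum
    · simp only [Finset.card_univ, Fintype.card_fin, Finset.card_singleton, Finset.sum_const,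
        Finset.card_range, smul_eq_mul, mul_one] at hsum
      rw [show q + 2 - 1 = q + 1 by omega]
      omega
    · intro j hj
      rw [hone j (by simpa using hj), Finset.card_singleton]

/-- The block can be filled because its king dominates at least `60 m` alternatives, of which at
most `26 m + r + 2 ^ i` are labelled already. Since `2 ^ (i + 1) ≤ 32 m` and `r ≤ 2 m`, enough are
left. The slack `60 - 26 - 32 = 2` does not allow reserves of `14 m`. -/
lemma SmallLabels.next (hk : AreKings T x r king) (hn : n = 2 ^ r) (hm : n = 128 * m)
    (hrm : r + 10 ≤ 2 * m) {lab₀ lab : Fin n → ℕ} {i : ℕ} (hi : i < r - 2)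
    (h : SmallLabels T x r m king lab₀ i lab) {A : Finset (Fin n)}
    (hA : ∀ v, v ∈ A ↔ lab v = 0 ∧ T.dom (king i) v = true) :
    SmallLabels T x r m king lab₀ (i + 1) (fillLabels (i + 1) (2 ^ i) A lab) := by
  have hA₀ : ∀ v ∈ A, lab v = 0 := fun v hv => ((hA v).1 hv).1
  have hone := h.card_one i hi le_rfl
  have hpow : 1 ≤ 2 ^ i := Nat.one_le_two_pow
  have hAcard : 2 ^ i - 1 ≤ A.card := by
    have h₁ : T.outdegree (king i) ≤ A.card +
        (Finset.univ.filter fun v => ¬ lab v = 0).card := by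
      refine (Finset.card_le_card ?_).trans (Finset.card_union_le _ _)
      intro v hv
      simp only [Finset.mem_filter, Finset.mem_univ, true_and] at hv
      simp only [Finset.mem_union, hA, Finset.mem_filter, Finset.mem_univ, true_and]
      tauto
    have h₂ := Finset.card_filter_add_card_filter_not (s := (Finset.univ : Finset (Fin n)))
      (fun v => lab v = 0)
    rw [Finset.card_univ, Fintype.card_fin] at h₂
    have h₃ := hk.outdegree (show i < r by omega)
    have h₄ : 2 ^ (i + 1) * 4 ≤ 2 ^ r := by
      rw [show (4 : ℕ) = 2 ^ 2 by norm_num, ← pow_add]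
      exact Nat.pow_le_pow_right (by norm_num) (by omega)
    have := h.large
    have := h.large'
    have := h.zero
    rw [pow_succ] at h₄
    omega
  refine ⟨fun v hv => ?_, fun v hv => ?_, fun j hj v hv => ?_, fun j hj => ?_,
    fun j hj hij => ?_, ?_, ?_, ?_⟩
  · have := h.ext v hv
    rw [fillLabels_of_ne_zero hA₀ (by omega), this]
  · rcases fillLabels_cases (L := i + 1) (cap := 2 ^ i) (A := A) (lab := lab) v with h' | h'
    · rw [h']; exact h.le v hv
    · rw [h'.2]; omega
  · rcases fillLabels_cases (L := i + 1) (cap := 2 ^ i) (A := A) (lab := lab) v with h' | h'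
    · exact h.dom j hj v (h' ▸ hv)
    · rw [h'.2] at hv
      obtain rfl : i = j := by omega
      exact Or.inr ((hA v).1 h'.1).2
  · by_cases hji : j = i
    · subst hji
      rw [card_fillLabels_self hA₀ (by omega), hone]
      omega
    · rw [filter_fillLabels_of_ne hA₀ (by omega) (by omega)]
      exact h.card j (by omega)
  · rw [filter_fillLabels_of_ne hA₀ (by omega) (by omega)]
    exact h.card_one j hj (by omega)
  · rw [filter_fillLabels_of_ne hA₀ (by omega) (by omega)]
    exact h.large
  · rw [filter_fillLabels_of_ne hA₀ (by omega) (by omega)]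
    exact h.large'
  · have h₁ := card_fillLabels_zero (cap := 2 ^ i) hA₀ (L := i + 1) (by omega)
    have h₂ := h.zero
    rw [filter_fillLabels_of_ne hA₀ (M := r - 1) (by omega) (by omega),
      filter_fillLabels_of_ne hA₀ (M := r) (by omega) (by omega)]
    rw [hone] at h₁
    rw [pow_succ]
    omega

/-- At this stage exactly `96 m` alternatives are unlabelled or in the two large classes. Hence
filling one of these up to `32 m` leaves precisely what the other one needs to reach `64 m`. The
kings of small blocks dominate their whole block, and in the large ones the helpers come from the
reserve. -/
lemma SmallLabels.final (hT : T.IsTypical r (13 * m) x) (hk : AreKings T x r king)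
    (hn : n = 2 ^ r) (hm : n = 128 * m) (hr : 2 ≤ r) (hrm : r + 10 ≤ 2 * m)
    {lab₀ lab : Fin n → ℕ} (h₀ : StartLabels T x r m king lab₀)
    (h : SmallLabels T x r m king lab₀ (r - 2) lab) {A B : Finset (Fin n)}
    (hA : ∀ v, v ∈ A ↔ lab v = 0)
    (hB : ∀ v, v ∈ B ↔ fillLabels (r - 1) (32 * m) A lab v = 0) :
    FinalLabels T x r king (fillLabels r (64 * m) B (fillLabels (r - 1) (32 * m) A lab)) := by
  set lab₁ := fillLabels (r - 1) (32 * m) A lab with hlab₁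
  have hA₀ : ∀ v ∈ A, lab v = 0 := fun v hv => (hA v).1 hv
  have hB₀ : ∀ v ∈ B, lab₁ v = 0 := fun v hv => (hB v).1 hv
  have hAc : A.card = (Finset.univ.filter fun v => lab v = 0).card := by
    congr 1; ext v; simp [hA]
  have hBc : B.card = (Finset.univ.filter fun v => lab₁ v = 0).card := by
    congr 1; ext v; simp [hB]
  have hpow : 2 ^ (r - 2) = 32 * m := by
    have : 2 ^ r = 2 ^ (r - 2) * 4 := by
      rw [show (4 : ℕ) = 2 ^ 2 by norm_num, ← pow_add]; congr 1; omega
    omega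
  have hzero := h.zero
  have hl := h.large
  have hl' := h.large'
  have a₁ := card_fillLabels_self (cap := 32 * m) hA₀ (L := r - 1) (by omega)
  have a₂ := card_fillLabels_zero (cap := 32 * m) hA₀ (L := r - 1) (by omega)
  have a₃ := filter_fillLabels_of_ne (cap := 32 * m) (L := r - 1) hA₀ (M := r) (by omega)
    (by omega)
  have b₁ := card_fillLabels_self (cap := 64 * m) hB₀ (L := r) (by omega)
  have b₂ := card_fillLabels_zero (cap := 64 * m) hB₀ (L := r) (by omega)
  have b₃ := filter_fillLabels_of_ne (cap := 64 * m) (L := r) hB₀ (M := r - 1) (by omega)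
    (by omega)
  rw [← hlab₁] at a₁ a₂ a₃
  rw [a₃] at b₁ b₂
  have ext : ∀ v, lab v ≠ 0 → fillLabels r (64 * m) B lab₁ v = lab v := by
    intro v hv
    have e : lab₁ v = lab v := fillLabels_of_ne_zero hA₀ hv
    rw [fillLabels_of_ne_zero hB₀ (by omega), e]
  have ext₀ : ∀ v, lab₀ v ≠ 0 → fillLabels r (64 * m) B lab₁ v = lab₀ v := by
    intro v hv
    have := h.ext v hv
    rw [ext v (by omega), this]
  have hcard : ∀ i < r,
      (Finset.univ.filter fun v => fillLabels r (64 * m) B lab₁ v = i + 1).card = 2 ^ i := by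
    intro i hi
    by_cases h₁ : i = r - 1
    · subst h₁
      rw [show r - 1 + 1 = r by omega, show r - 1 = (r - 2) + 1 by omega, pow_succ]
      omega
    · by_cases h₂ : i = r - 2
      · subst h₂
        rw [show r - 2 + 1 = r - 1 by omega, b₃]
        omega
      · rw [filter_fillLabels_of_ne hB₀ (by omega) (by omega), hlab₁,
          filter_fillLabels_of_ne hA₀ (by omega) (by omega)]
        exact h.card i (by omega)
  have hking : ∀ i < r, fillLabels r (64 * m) B lab₁ (king i) = i + 1 := fun i hi => by
    have := h₀.king_lab i hi
    rw [ext₀ _ (by omega), this]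
  -- Of the `2 * r` reserved alternatives that dominate `b`, at most `r + 1` may have another label,
  -- namely `x` and the kings; the other `r - 1 ≥ i` are helpers.
  have hlarge : ∀ i < r, ∀ b, ∀ S : Finset (Fin n),
      2 * r ≤ (S.filter fun v => T.dom v b = true).card →
      (∀ v ∈ S, v ≠ x → (∀ j < r, v ≠ king j) → lab₀ v = i + 1) →
      (∀ v ∈ S, T.dom (king i) v = true) →
      i ≤ (Finset.univ.filter fun a => fillLabels r (64 * m) B lab₁ a = i + 1 ∧
        T.dom (king i) a = true ∧ T.dom a b = true).card := by
    intro i hi b S hS hS' hdom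
    have hsub : (S.filter fun v => T.dom v b = true) ⊆
        (Finset.univ.filter fun a => fillLabels r (64 * m) B lab₁ a = i + 1 ∧
          T.dom (king i) a = true ∧ T.dom a b = true) ∪
        insert x ((Finset.range r).image king) := by
      intro v hv
      simp only [Finset.mem_filter] at hv
      simp only [Finset.mem_union, Finset.mem_filter, Finset.mem_univ, true_and,
        Finset.mem_insert, Finset.mem_image, Finset.mem_range]
      by_cases hvx : v = x
      · exact Or.inr (Or.inl hvx)
      · by_cases hvk : ∃ j < r, king j = v
        · exact Or.inr (Or.inr hvk)
        · left
          have := hS' v hv.1 hvx fun j hj e => hvk ⟨j, hj, e.symm⟩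
          exact ⟨by rw [ext₀ v (by omega), this], hdom v hv.1, hv.2⟩
    have h₁ := (Finset.card_le_card hsub).trans (Finset.card_union_le _ _)
    have h₂ := Finset.card_insert_le x ((Finset.range r).image king)
    have h₃ := Finset.card_image_le (s := Finset.range r) (f := king)
    rw [Finset.card_range] at h₃
    omega
  refine ⟨hking, ?_, fun v => ?_, fun v hv => ?_, hcard, fun i hi b hb hbk => ?_⟩
  · have := h₀.player
    have := x.2
    rw [ext₀ x (by omega), h₀.player]
  · have : (Finset.univ.filter fun v => fillLabels r (64 * m) B lab₁ v = 0).card = 0 := by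
      omega
    rw [Finset.card_eq_zero, Finset.filter_eq_empty_iff] at this
    have := this (Finset.mem_univ v)
    omega
  · rcases fillLabels_cases (L := r) (cap := 64 * m) (A := B) (lab := lab₁) v with h' | h'
    · rw [h']
      rcases fillLabels_cases (L := r - 1) (cap := 32 * m) (A := A) (lab := lab) v with h' | h'
      · rw [hlab₁, h']; exact h.le v hv
      · rw [hlab₁, h'.2]; omega
    · rw [h'.2]
  · have hbk' : b ≠ king i := T.dom_ne hbk
    by_cases h₁ : i = r - 1
    · subst h₁
      refine hlarge _ hi b (T.firstReserve (13 * m) (king (r - 1)))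
        (hT.first _ b hbk' (hk.outdegree hi)) (fun v hv hvx hvk => ?_) fun v hv => ?_
      · rw [h₀.first v hv hvx hvk]; omega
      · have := firstElements_subset _ _ hv
        simpa [Tournament.dominated] using this
    · by_cases h₂ : i = r - 2
      · subst h₂
        refine hlarge _ hi b (T.secondReserve (13 * m) (king (r - 1)) (king (r - 2)))
          (hT.second _ _ b ?_ hbk' (hk.outdegree (by omega)) (hk.outdegree hi))
          (fun v hv hvx hvk => ?_) fun v hv => ?_
        -- The bound for the second reserve also excludes the king of the last block; he cannot be
        -- `b` because his label is `r`.
        · rintro rfl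
          rw [hking _ (by omega)] at hb
          omega
        · rw [h₀.second v hv hvx hvk]; omega
        · have := Finset.mem_sdiff.1 (firstElements_subset _ _ hv)
          simpa [Tournament.dominated] using this.1
      · exfalso
        have hb' : lab b = i + 1 := by
          have : b ∈ Finset.univ.filter fun v => fillLabels r (64 * m) B lab₁ v = i + 1 := by
            simp [hb]
          rw [filter_fillLabels_of_ne hB₀ (by omega) (by omega), hlab₁,
            filter_fillLabels_of_ne hA₀ (by omega) (by omega)] at this
          simpa using this
        rcases h.dom i (by omega) b hb' with h' | h'
        · exact hbk' h'
        · rw [T.dom_asymm hbk] at h'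
          exact absurd h' (by simp)

end Labels

end KnockoutProg

/-! ### The program computes the blocks -/

namespace KnockoutProg

open RamExp ForProg

section

variable {n : ℕ} {T : Tournament (Fin n)} {x : Fin n} {r m : ℕ} {king : ℕ → Fin n}
  {s : RamState}

/-- The state contains the input, the number of rounds and the kings. -/
structure Ready (T : Tournament (Fin n)) (x : Fin n) (r : ℕ) (king : ℕ → Fin n)
    (s : RamState) : Prop where
  input : Input T x s
  rounds : s.var 2 = r
  kings : ∀ i < r, s.arr 2 i = king i

lemma Ready.run (h : Ready T x r king s) (c : ForProg) (hc : c.wellFormed = true)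
    (h₁ : c.writesVar 1 = false) (h₀ : c.writesArr 0 = false) (h₂ : c.writesVar 2 = false)
    (h₃ : c.writesArr 2 = false) : Ready T x r king (c.run s) where
  input := h.input.run c hc h₁ h₀
  rounds := by rw [run_var_of_not_writesVar h₂, h.rounds]
  kings := by rw [run_arr_of_not_writesArr h₃]; exact h.kings

lemma Ready.setVar (h : Ready T x r king s) {v : ℕ} (a : ℕ) (hv : 2 < v) :
    Ready T x r king (s.setVar v a) where
  input := h.input.setVar a (by omega)
  rounds := by rw [RamState.setVar_var_of_ne _ _ (by omega), h.rounds]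
  kings := h.kings

/-- The labels stored in a state. -/
def labels (n : ℕ) (s : RamState) (v : Fin n) : ℕ := s.arr 3 v

lemma Ready.run_fillBlock (h : Ready T x r king s) (d : Bool) {cap i L : ℕ} (hcap : cap ≠ 8)
    (hcap' : cap ≠ 21) (hi : s.var 10 = i) (hir : i < r) (hL : i + 1 = L) (hrn : r ≤ n)
    (hle : (Finset.univ.filter fun u => labels n s u = L).card ≤ s.var cap) :
    labels n ((fillBlock d cap).run s) = fillLabels L (s.var cap)
      (Finset.univ.filter fun v => labels n s v = 0 ∧ (d = true → T.dom (king i) v = true))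
      (labels n s) := by
  subst hL hi
  exact funext fun v => KnockoutProg.run_fillBlock h.input d hcap hcap' (fun _ => rfl)
    (h.kings _ hir) (fun v => Finset.mem_filter.trans
      ⟨fun h => h.2, fun h => ⟨Finset.mem_univ _, h⟩⟩) (by omega) hle v

lemma Ready.fillBlock (h : Ready T x r king s) (d : Bool) (cap : ℕ) :
    Ready T x r king ((fillBlock d cap).run s) :=
  h.run _ rfl rfl rfl rfl rfl

lemma run_labelKings (h : Ready T x r king s) (hk : AreKings T x r king) (hrn : r ≤ n) :
    Ready T x r king (labelKings.run s) ∧ labels n (labelKings.run s) x = n ∧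
      (∀ i < r, labels n (labelKings.run s) (king i) = i + 1) ∧
      ∀ v, v ≠ x → (∀ i < r, v ≠ king i) → labels n (labelKings.run s) v = labels n s v := by
  classical
  rw [labelKings, run_seq]
  have key := forN_induction (v := 20) (c := .ite (less (.var 20) (.var 2))
    (.store 3 (.entry 2 (.var 20)) (.add (.var 20) (.const 1))) .skip) rfl
    (fun i s' => Ready T x r king s' ∧
      (∀ j < r, j < i → s'.arr 3 (king j) = j + 1) ∧
      ∀ v : Fin n, (∀ j < r, v ≠ king j) → s'.arr 3 v = s.arr 3 v)
    (n := n) (s := s) h.input.size ?_ ?_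
  · obtain ⟨h₁, h₂, h₃⟩ := key
    refine ⟨h₁.run _ rfl rfl rfl rfl rfl, ?_, fun i hi => ?_, fun v hv hv' => ?_⟩
    · simp [labels, run_store, eval, RamState.setArr_arr_self, h₁.input.player, h₁.input.size]
    · have : (king i : ℕ) ≠ x := fun e => T.dom_ne (hk.dom hi) (Fin.ext e).symm
      simp [labels, run_store, eval, RamState.setArr_arr_self, h₁.input.player, this,
        h₂ i hi (by omega)]
    · have : (v : ℕ) ≠ x := fun e => hv (Fin.ext e)
      simp [labels, run_store, eval, RamState.setArr_arr_self, h₁.input.player, this, h₃ v hv']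
  · exact ⟨h.setVar _ (by norm_num), fun j _ hj => absurd hj (by omega), fun v _ => rfl⟩
  · rintro i hi s' - hv ⟨h₁, h₂, h₃⟩
    rw [run_ite]
    have hiff : Holds s' (less (.var 20) (.var 2)) ↔ i < r := by simp [eval, hv, h₁.rounds]
    split_ifs with hc
    · rw [hiff] at hc
      refine ⟨(h₁.run _ rfl rfl rfl rfl rfl).setVar _ (by norm_num), fun j hj hji => ?_,
        fun v hv' => ?_⟩
      · simp only [run_store, eval, RamState.setVar_arr, RamState.setArr_arr_self, hv,
          h₁.kings i hc, h₁.input.size]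
        split_ifs with e
        · have := hk.inj j hj i hc (Fin.ext e)
          omega
        · refine h₂ j hj ?_
          have : j ≠ i := by rintro rfl; exact e rfl
          omega
      · simp only [run_store, eval, RamState.setVar_arr, RamState.setArr_arr_self, hv,
          h₁.kings i hc]
        rw [if_neg (fun e => hv' i hc (Fin.ext e)), h₃ v hv']
    · rw [hiff] at hc
      exact ⟨h₁.setVar _ (by norm_num), fun j hj hji => h₂ j hj (by omega), h₃⟩

/-- The reserves are made before the kings and `x` are labelled, and those labels then overwrite
reservations. Thus each reserve is determined by the edges at the kings of the large blocks alone,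
as the independence in the tail bounds requires. -/
lemma run_reserve_labelKings (h : Ready T x r king s) (hk : AreKings T x r king) (hrn : r ≤ n)
    (hr : 2 ≤ r) (hcap : s.var 4 = 13 * m) (h₀ : ∀ v, labels n s v = 0) :
    Ready T x r king (labelKings.run (reserve.run s)) ∧
      StartLabels T x r m king (labels n (labelKings.run (reserve.run s))) := by
  have h₀' : labels n s = fun _ => 0 := funext h₀
  have hres : Ready T x r king (reserve.run s) ∧ ∀ v, labels n (reserve.run s) v =
      if v ∈ T.secondReserve (13 * m) (king (r - 1)) (king (r - 2)) then r - 1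
      else if v ∈ T.firstReserve (13 * m) (king (r - 1)) then r else 0 := by
    rw [reserve, run_seq, run_seq, run_seq]
    set s₁ := (ForProg.assign 10 (.sub (.var 2) (.const 1))).run s with hs₁
    have r₁ : Ready T x r king s₁ := h.run _ rfl rfl rfl rfl rfl
    have v₁ : s₁.var 10 = r - 1 := by
      simp [hs₁, run_assign, eval, h.rounds, h.input.size]; omega
    have l₁ : labels n s₁ = fun _ => 0 := h₀'
    have c₁ : s₁.var 4 = 13 * m := hcap
    set s₂ := (fillBlock true 4).run s₁ with hs₂
    have r₂ : Ready T x r king s₂ := r₁.fillBlock true 4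
    have c₂ : s₂.var 4 = 13 * m := by
      rw [hs₂, run_var_of_not_writesVar (fillBlock_writesVar _ _ _ (by norm_num) (by norm_num)),
        c₁]
    have l₂ : labels n s₂ = fun v =>
        if v ∈ T.firstReserve (13 * m) (king (r - 1)) then r else 0 := by
      rw [hs₂, r₁.run_fillBlock true (by norm_num) (by norm_num) v₁ (by omega)
        (show r - 1 + 1 = r by omega) hrn (by
          have : (0 : ℕ) ≠ r := by omega
          simp [l₁, this])]
      funext v
      have : (0 : ℕ) ≠ r := by omega
      have hset : (Finset.univ.filter fun v => labels n s₁ v = 0 ∧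
          (true = true → T.dom (king (r - 1)) v = true)) = T.dominated (king (r - 1)) := by
        ext v
        simp [Tournament.dominated, l₁]
      rw [hset, l₁, c₁]
      simp only [fillLabels, this, Finset.filter_false, Finset.card_empty, Nat.sub_zero]
      rfl
    set s₃ := (ForProg.assign 10 (.sub (.var 2) (.const 2))).run s₂ with hs₃
    have r₃ : Ready T x r king s₃ := r₂.run _ rfl rfl rfl rfl rfl
    have v₃ : s₃.var 10 = r - 2 := by
      simp [hs₃, run_assign, eval, r₂.rounds, r₂.input.size]; omega
    have l₃ : labels n s₃ = fun v =>
        if v ∈ T.firstReserve (13 * m) (king (r - 1)) then r else 0 := l₂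
    have c₃ : s₃.var 4 = 13 * m := c₂
    have hno : ∀ v, labels n s₃ v ≠ r - 1 := by
      intro v
      rw [l₃]
      simp only
      split_ifs <;> omega
    refine ⟨r₃.fillBlock true 4, fun v => ?_⟩
    rw [r₃.run_fillBlock true (by norm_num) (by norm_num) v₃ (by omega)
        (show r - 2 + 1 = r - 1 by omega) hrn (by simp [hno])]
    simp only [fillLabels, hno, Finset.filter_false, Finset.card_empty, Nat.sub_zero, c₃]
    have hset : (Finset.univ.filter fun v => labels n s₃ v = 0 ∧
        (True → T.dom (king (r - 2)) v = true)) =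
        T.dominated (king (r - 2)) \ T.firstReserve (13 * m) (king (r - 1)) := by
      ext v
      have : r ≠ 0 := by omega
      simp [Tournament.dominated, l₃, this, and_comm]
    rw [hset, l₃]
    rfl
  obtain ⟨g₁, g₂⟩ := hres
  obtain ⟨k₁, k₂, k₃, k₄⟩ := run_labelKings g₁ hk hrn
  refine ⟨k₁, k₃, k₂, fun v hv hvx hvk => ?_, fun v hv hvx hvk => ?_, fun v => ?_⟩
  · have hv' : v ∉ T.secondReserve (13 * m) (king (r - 1)) (king (r - 2)) := fun hv' =>
      (Finset.mem_sdiff.1 (firstElements_subset _ _ hv')).2 hv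
    rw [k₄ v hvx hvk, g₂, if_neg hv', if_pos hv]
  · rw [k₄ v hvx hvk, g₂, if_pos hv]
  · by_cases hvx : v = x
    · exact Or.inl hvx
    by_cases hvk : ∃ i < r, v = king i
    · exact Or.inr (Or.inl hvk)
    push Not at hvk
    rw [k₄ v hvx hvk, g₂]
    split_ifs with h₁ h₂
    · exact Or.inr (Or.inr (Or.inr (Or.inr ⟨rfl, h₁⟩)))
    · exact Or.inr (Or.inr (Or.inr (Or.inl ⟨rfl, h₂⟩)))
    · exact Or.inr (Or.inr (Or.inl rfl))

lemma run_fillSmall (h : Ready T x r king s) (hk : AreKings T x r king) (hn : n = 2 ^ r)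
    (hm : n = 128 * m) (hrm : r + 10 ≤ 2 * m) (hr : 2 ≤ r)
    (h₀ : StartLabels T x r m king (labels n s)) :
    Ready T x r king (fillSmall.run s) ∧
      SmallLabels T x r m king (labels n s) (r - 2) (labels n (fillSmall.run s)) := by
  classical
  have hrn : r < n := hn ▸ Nat.lt_two_pow_self
  rw [fillSmall, run_seq]
  have key := forN_induction (v := 20) (c := .ite (less (.add (.var 20) (.const 2)) (.var 2))
      (.seq (.assign 10 (.var 20)) <| .seq (fillBlock true 3)
        (.assign 3 (.add (.var 3) (.var 3)))) .skip) rfl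
    (fun i s' => Ready T x r king s' ∧ s'.var 3 = 2 ^ min i (r - 2) ∧
      SmallLabels T x r m king (labels n s) (min i (r - 2)) (labels n s'))
    (n := n) (s := (ForProg.assign 3 (.const 1)).run s) h.input.size ?_ ?_
  · have e : min n (r - 2) = r - 2 := by omega
    rw [e] at key
    exact ⟨key.1, key.2.2⟩
  · refine ⟨(h.run _ rfl rfl rfl rfl rfl).setVar _ (by norm_num), ?_, ?_⟩
    · simp [run_assign, eval, h.input.size]; omega
    · rw [Nat.zero_min]
      exact h₀.small hk hr hrn
  · rintro i hi s' - hv ⟨h₁, h₂, h₃⟩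
    rw [run_ite]
    have hiff : Holds s' (less (.add (.var 20) (.const 2)) (.var 2)) ↔ i < r - 2 := by
      simp [eval, hv, h₁.rounds]; omega
    split_ifs with hc
    · rw [hiff] at hc
      rw [show min i (r - 2) = i by omega] at h₂ h₃
      rw [show min (i + 1) (r - 2) = i + 1 by omega, run_seq, run_seq]
      set s₁ := (ForProg.assign 10 (.var 20)).run s' with hs₁
      have r₁ : Ready T x r king s₁ := h₁.run _ rfl rfl rfl rfl rfl
      have v₁ : s₁.var 10 = i := by
        simp [hs₁, run_assign, eval, hv, h₁.input.size]; omega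
      have c₁ : s₁.var 3 = 2 ^ i := h₂
      have l₁ : labels n s₁ = labels n s' := rfl
      have r₂ := r₁.fillBlock true 3
      have hfill := r₁.run_fillBlock true (by norm_num) (by norm_num) v₁ (by omega) rfl
        (by omega) (cap := 3) (by
          rw [l₁, c₁, h₃.card_one i hc le_rfl]; exact Nat.one_le_two_pow)
      have c₂ : ((fillBlock true 3).run s₁).var 3 = 2 ^ i := by
        rw [run_var_of_not_writesVar (fillBlock_writesVar _ _ _ (by norm_num) (by norm_num)), c₁]
      refine ⟨(r₂.run _ rfl rfl rfl rfl rfl).setVar _ (by norm_num), ?_, ?_⟩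
      · have : 2 ^ (i + 1) ≤ 2 ^ r := Nat.pow_le_pow_right (by norm_num) (by omega)
        simp only [run_assign, eval, c₂, r₂.input.size,
          RamState.setVar_var_of_ne _ _ (show 3 ≠ 20 by norm_num), RamState.setVar_var_self]
        rw [pow_succ] at this ⊢
        omega
      · change SmallLabels T x r m king _ (i + 1) (labels n ((fillBlock true 3).run s₁))
        rw [hfill, c₁, l₁]
        exact h₃.next hk hn hm hrm hc (fun v => by simp)
    · rw [hiff] at hc
      rw [show min i (r - 2) = r - 2 by omega] at h₂ h₃
      rw [show min (i + 1) (r - 2) = r - 2 by omega, run_skip]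
      exact ⟨h₁.setVar _ (by norm_num), h₂, h₃⟩

/-- The program determines the labels. -/
lemma run_labels (h : Ready T x r king s) (hk : AreKings T x r king)
    (hT : T.IsTypical r (13 * m) x) (hn : n = 2 ^ r) (hm : n = 128 * m) (hrm : r + 10 ≤ 2 * m)
    (hr : 2 ≤ r) (h4 : s.var 4 = 13 * m) (h5 : s.var 5 = 32 * m) (h6 : s.var 6 = 64 * m)
    (h₀ : ∀ v, labels n s v = 0) :
    Ready T x r king (fillLarge.run (fillSmall.run (labelKings.run (reserve.run s)))) ∧
      FinalLabels T x r king
        (labels n (fillLarge.run (fillSmall.run (labelKings.run (reserve.run s))))) := by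
  have hrn : r < n := hn ▸ Nat.lt_two_pow_self
  obtain ⟨g₁, hs⟩ := run_reserve_labelKings h hk hrn.le hr h4 h₀
  have e5 : (labelKings.run (reserve.run s)).var 5 = 32 * m :=
    (run_var_of_not_writesVar (c := labelKings) rfl _).trans
      ((run_var_of_not_writesVar (c := reserve) rfl _).trans h5)
  have e6 : (labelKings.run (reserve.run s)).var 6 = 64 * m :=
    (run_var_of_not_writesVar (c := labelKings) rfl _).trans
      ((run_var_of_not_writesVar (c := reserve) rfl _).trans h6)
  generalize labelKings.run (reserve.run s) = s₀ at *
  obtain ⟨g₂, hs'⟩ := run_fillSmall g₁ hk hn hm hrm hr hs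
  replace e5 : (fillSmall.run s₀).var 5 = 32 * m :=
    (run_var_of_not_writesVar (c := fillSmall) rfl _).trans e5
  replace e6 : (fillSmall.run s₀).var 6 = 64 * m :=
    (run_var_of_not_writesVar (c := fillSmall) rfl _).trans e6
  generalize fillSmall.run s₀ = s₁ at *
  rw [fillLarge, run_seq, run_seq, run_seq]
  obtain ⟨s₂, hs₂⟩ : ∃ s₂, s₂ = (ForProg.assign 10 (.sub (.var 2) (.const 2))).run s₁ := ⟨_, rfl⟩
  rw [← hs₂]
  have r₂ : Ready T x r king s₂ := hs₂ ▸ g₂.run _ rfl rfl rfl rfl rfl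
  have v₂ : s₂.var 10 = r - 2 := by
    simp [hs₂, run_assign, eval, g₂.rounds, g₂.input.size]; omega
  have l₂ : labels n s₂ = labels n s₁ := by rw [hs₂]; rfl
  have c₂ : s₂.var 5 = 32 * m := by rw [hs₂]; exact e5
  have d₂ : s₂.var 6 = 64 * m := by rw [hs₂]; exact e6
  have f₂ := r₂.run_fillBlock false (cap := 5) (by norm_num) (by norm_num) v₂ (by omega)
    (show r - 2 + 1 = r - 1 by omega) hrn.le (by
      have := hs'.large
      rw [l₂, c₂]; omega)
  have r₃ := r₂.fillBlock false 5
  have d₃ : ((fillBlock false 5).run s₂).var 6 = 64 * m :=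
    (run_var_of_not_writesVar (c := fillBlock false 5) rfl _).trans d₂
  generalize (fillBlock false 5).run s₂ = s₃ at *
  rw [c₂, l₂] at f₂
  obtain ⟨s₄, hs₄⟩ : ∃ s₄, s₄ = (ForProg.assign 10 (.sub (.var 2) (.const 1))).run s₃ := ⟨_, rfl⟩
  rw [← hs₄]
  have r₄ : Ready T x r king s₄ := hs₄ ▸ r₃.run _ rfl rfl rfl rfl rfl
  have v₄ : s₄.var 10 = r - 1 := by
    simp [hs₄, run_assign, eval, r₃.rounds, r₃.input.size]; omega
  have l₄ : labels n s₄ = labels n s₃ := by rw [hs₄]; rfl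
  have d₄ : s₄.var 6 = 64 * m := by rw [hs₄]; exact d₃
  have f₄ := r₄.run_fillBlock false (cap := 6) (by norm_num) (by norm_num) v₄ (by omega)
    (show r - 1 + 1 = r by omega) hrn.le (by
      have := hs'.large'
      rw [l₄, d₄, f₂, filter_fillLabels_of_ne (fun v hv => by simp at hv; exact hv) (by omega)
        (by omega)]
      omega)
  refine ⟨r₄.fillBlock false 6, ?_⟩
  rw [f₄, d₄, l₄, f₂]
  exact hs'.final hT hk hn hm hr hrm hs (fun v => by simp) (fun v => by simp)

end

end KnockoutProg

/-! ### The program plays one round -/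

namespace KnockoutProg

open RamExp ForProg

section

variable {n : ℕ} {T : Tournament (Fin n)} {x : Fin n} {r : ℕ} {king : ℕ → Fin n}
  {lab : Fin n → ℕ} {t : ℕ} {losers : ℕ → ℕ} {s : RamState} {lev : Fin n → ℕ}
  {lose : Fin n → Fin n}

/-- The state during round `t`; `losers` is the array of the losers at the start of the round. -/
structure InRound (T : Tournament (Fin n)) (x : Fin n) (r : ℕ) (king : ℕ → Fin n)
    (lab : Fin n → ℕ) (t : ℕ) (losers : ℕ → ℕ) (lev : Fin n → ℕ) (lose : Fin n → Fin n)
    (s : RamState) : Prop where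
  ready : Ready T x r king s
  lab_eq : labels n s = lab
  round_eq : s.var 11 = t
  lev_eq : ∀ v : Fin n, s.arr 4 v = lev v
  lose_eq : ∀ v : Fin n, s.arr 5 (t * n + v) = lose v
  old : ∀ k, (∀ v : Fin n, k ≠ t * n + v) → s.arr 5 k = losers k

lemma InRound.setVar (h : InRound T x r king lab t losers lev lose s) {v : ℕ} (a : ℕ)
    (hv : 2 < v) (hv' : v ≠ 11) : InRound T x r king lab t losers lev lose (s.setVar v a) where
  ready := h.ready.setVar a hv
  lab_eq := h.lab_eq
  round_eq := by rw [RamState.setVar_var_of_ne _ _ hv'.symm, h.round_eq]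
  lev_eq := h.lev_eq
  lose_eq := h.lose_eq
  old := h.old

/-- The match between `u` and `v` is possible. -/
def IsMatch (T : Tournament (Fin n)) (lab : Fin n → ℕ) (t : ℕ) (cond : Fin n → Fin n → Prop)
    (lev : Fin n → ℕ) (u v : Fin n) : Prop :=
  lev u = t ∧ lev v = t ∧ lab u = lab v ∧ T.dom u v = true ∧ cond u v

lemma InRound.match (h : InRound T x r king lab t losers lev lose s) (htn : t + 1 ≤ n)
    {u v : Fin n} (hu : s.var 21 = u) (hv : s.var 22 = v) :
    InRound T x r king lab t losers (Function.update (Function.update lev u (t + 1)) v 0)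
      (Function.update lose u v)
      ((ForProg.seq (.store 5 (.add (.mul (.var 11) (.var 0)) (.var 21)) (.var 22)) <|
        .seq (.store 4 (.var 21) (.add (.var 11) (.const 1))) (.store 4 (.var 22) (.const 0))).run
        s) where
  ready := h.ready.run _ rfl rfl rfl rfl rfl
  lab_eq := h.lab_eq
  round_eq := h.round_eq
  lev_eq w := by
    simp only [run_seq, run_store, eval, RamState.setArr_var, RamState.setArr_arr_self, hu, hv,
      h.round_eq, h.ready.input.size, Function.update_apply, Fin.val_inj]
    split_ifs
    · simp
    · omega
    · simp [h.lev_eq]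
  lose_eq w := by
    simp only [run_seq, run_store, eval, RamState.setArr_var, hu, hv,
      h.round_eq, h.ready.input.size, Function.update_apply,
      RamState.setArr_arr_of_ne _ _ _ (show 5 ≠ 4 by norm_num), RamState.setArr_arr_self]
    by_cases hw : w = u
    · simp [hw]
    · have : (w : ℕ) ≠ u := fun e => hw (Fin.ext e)
      simp [hw, this, h.lose_eq]
  old k hk := by
    simp only [run_seq, run_store, eval, RamState.setArr_var, hu, hv,
      h.round_eq, h.ready.input.size,
      RamState.setArr_arr_of_ne _ _ _ (show 5 ≠ 4 by norm_num), RamState.setArr_arr_self]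
    rw [if_neg (hk u), h.old k hk]

/-- A single lexicographic pass over all pairs gives a maximal pairing: matches only remove players
from level `t`, so a pair found impossible remains impossible. The invariant `I` is available when
the test `e` has to be identified with `cond`. -/
lemma run_phase (h : InRound T x r king lab t losers lev lose s) (ht : 1 ≤ t) (htn : t + 1 ≤ n)
    {e : RamExp} {cond : Fin n → Fin n → Prop} {I : (Fin n → ℕ) → (Fin n → Fin n) → Prop}
    (he : ∀ s' lev' lose', InRound T x r king lab t losers lev' lose' s' → I lev' lose' →
      ∀ u v : Fin n, lev' u = t → s'.var 21 = u → s'.var 22 = v → (Holds s' e ↔ cond u v))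
    (hI : I lev lose)
    (hp : T.PreservedByMatches lab t cond I) :
    ∃ lev' lose', InRound T x r king lab t losers lev' lose' ((phase e).run s) ∧
      I lev' lose' ∧ T.IsMaximalPairing lab t cond lev' := by
  classical
  have hstep : ∀ lev u v u' v', ¬ IsMatch T lab t cond lev u' v' →
      ¬ IsMatch T lab t cond (Function.update (Function.update lev u (t + 1)) v 0) u' v' := by
    rintro lev u v u' v' hno ⟨h₁, h₂, h₃⟩
    simp only [Function.update_apply] at h₁ h₂
    split_ifs at h₁ h₂ <;> first | omega | exact hno ⟨h₁, h₂, h₃⟩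
  set body : ForProg := .ite (conj (equal (.entry 4 (.var 21)) (.var 11))
      (conj (equal (.entry 4 (.var 22)) (.var 11))
        (conj (equal (.entry 3 (.var 21)) (.entry 3 (.var 22)))
          (conj (domExp (.var 21) (.var 22)) e))))
    (.seq (.store 5 (.add (.mul (.var 11) (.var 0)) (.var 21)) (.var 22)) <|
      .seq (.store 4 (.var 21) (.add (.var 11) (.const 1))) (.store 4 (.var 22) (.const 0))) .skip
    with hbody
  have key := forN_induction (v := 21) (c := .forN 22 body) rfl
    (fun i s' => ∃ lev' lose', InRound T x r king lab t losers lev' lose' s' ∧ I lev' lose' ∧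
      ∀ u v : Fin n, (u : ℕ) < i → ¬ IsMatch T lab t cond lev' u v)
    (n := n) (s := s) h.ready.input.size ?_ ?_
  · obtain ⟨lev', lose', h₁, h₂, h₃⟩ := key
    exact ⟨lev', lose', h₁, h₂, fun u v a b c d f => h₃ u v u.2 ⟨a, b, c, d, f⟩⟩
  · exact ⟨lev, lose, h.setVar _ (by norm_num) (by norm_num), hI, fun u v hu => by omega⟩
  · rintro i hi s' h₀ h21 ⟨lev', lose', h₁, h₂, h₃⟩
    have inner := forN_induction (v := 22) (c := body) rfl
      (fun j s' => s'.var 21 = i ∧ ∃ lev' lose',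
        InRound T x r king lab t losers lev' lose' s' ∧ I lev' lose' ∧
        ∀ u v : Fin n, ((u : ℕ) < i ∨ (u : ℕ) = i ∧ (v : ℕ) < j) →
          ¬ IsMatch T lab t cond lev' u v)
      (n := n) (s := s') h₀ ?_ ?_
    · obtain ⟨-, lev', lose', h₁, h₂, h₃⟩ := inner
      exact ⟨lev', lose', h₁.setVar _ (by norm_num) (by norm_num), h₂,
        fun u v hu => h₃ u v (by have := v.2; omega)⟩
    · exact ⟨by simp [h21], lev', lose', h₁.setVar _ (by norm_num) (by norm_num), h₂,
        fun u v hu => h₃ u v (by omega)⟩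
    · rintro j hj s'' - h22 ⟨h21, lev', lose', h₁, h₂, h₃⟩
      set u : Fin n := ⟨i, hi⟩ with hu
      set v : Fin n := ⟨j, hj⟩ with hv
      have hl : ∀ w : Fin n, s''.arr 3 w = lab w := fun w => congrFun h₁.lab_eq w
      have hiff : Holds s'' (conj (equal (.entry 4 (.var 21)) (.var 11))
          (conj (equal (.entry 4 (.var 22)) (.var 11))
            (conj (equal (.entry 3 (.var 21)) (.entry 3 (.var 22)))
              (conj (domExp (.var 21) (.var 22)) e)))) ↔ IsMatch T lab t cond lev' u v := by
        have h₄ := h₁.lev_eq u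
        have h₅ := h₁.lev_eq v
        have h₆ := hl u
        have h₇ := hl v
        simp only [hu, hv] at h₄ h₅ h₆ h₇
        rw [holds_conj, holds_conj, holds_conj, holds_conj, holds_equal, holds_equal,
          holds_equal, h₁.ready.input.holds_domExp (a := .var 21) (b := .var 22) (u := u) (v := v)
            h21 h22]
        simp only [eval, h21, h22, h₁.round_eq, h₄, h₅, h₆, h₇, IsMatch, hu, hv]
        exact and_congr_right fun a => and_congr_right fun b => and_congr_right fun c =>
          and_congr_right fun d => he s'' lev' lose' h₁ h₂ u v a h21 h22
      have hsplit : ∀ a b : Fin n, ((a : ℕ) < i ∨ (a : ℕ) = i ∧ (b : ℕ) < j + 1) →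
          ((a : ℕ) < i ∨ (a : ℕ) = i ∧ (b : ℕ) < j) ∨ a = u ∧ b = v := by
        rintro a b (h | ⟨h, h'⟩)
        · exact Or.inl (Or.inl h)
        · by_cases hb : (b : ℕ) = j
          · exact Or.inr ⟨Fin.ext h, Fin.ext hb⟩
          · exact Or.inl (Or.inr ⟨h, by omega⟩)
      rw [hbody, run_ite]
      split_ifs with hc
      · rw [hiff] at hc
        obtain ⟨c₁, c₂, c₃, c₄, c₅⟩ := hc
        refine ⟨?_, _, _, (h₁.match htn h21 h22).setVar _ (by norm_num)
          (by norm_num), hp lev' lose' u v h₂ c₁ c₂ c₃ c₄ c₅, fun a b hab => ?_⟩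
        · simp [run_seq, run_store, h21]
        · rcases hsplit a b hab with h | ⟨rfl, rfl⟩
          · exact hstep _ _ _ _ _ (h₃ a b h)
          · rintro ⟨-, h, -⟩
            simp at h
            omega
      · rw [hiff] at hc
        refine ⟨by simp [run_skip, h21], lev', lose',
          h₁.setVar _ (by norm_num) (by norm_num), h₂, fun a b hab => ?_⟩
        rcases hsplit a b hab with h | ⟨rfl, rfl⟩
        · exact h₃ a b h
        · exact hc

lemma InRound.eval_kingExp (h : InRound T x r king lab t losers lev lose s) {u : Fin n}
    (hu : s.var 21 = u) (h₁ : 1 ≤ lab u) (h₂ : lab u ≤ r) :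
    kingExp.eval s = king (lab u - 1) := by
  have : s.arr 3 u = lab u := congrFun h.lab_eq u
  simp only [kingExp, eval, hu, this]
  exact h.ready.kings _ (by omega)

lemma run_round (h : InRound T x r king lab t losers lev lose s) (ht : 1 ≤ t) (htn : t + 1 ≤ n)
    (hlk : ∀ i < r, lab (king i) = i + 1)
    (h₀ : T.RoundInvariant r lab king t lev) :
    ∃ lev' lose', InRound T x r king lab t losers lev' lose' (round.run s) ∧
      T.IsPairing lab t lev lev' lose' ∧ T.RoundInvariant r lab king (t + 1) lev' := by
  -- No level exceeds `t` at the start, so there are no winners yet and the old contents of `lose`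
  -- do not matter.
  have hstart : T.IsPairing lab t lev lev lose :=
    ⟨fun v => Or.inl rfl, fun v hv => by have := h₀.le v; omega,
      fun v w hv => by have := h₀.le v; omega, fun v hv hv' => by omega⟩
  rw [round, run_seq, run_seq]
  -- Only labels between `1` and `r` belong to a block with a king, so only for them does `kingExp`
  -- read the right entry.
  have hrange : ∀ {lev' lose'}, T.IsPairing lab t lev lev' lose' → ∀ u, lev' u = t →
      1 ≤ lab u ∧ lab u ≤ r := by
    intro lev' lose' hp u hu
    have : lev u = t := by rcases hp.level u with h | h <;> omega
    have := h₀.lab_le u this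
    omega
  have hpreserved : ∀ (w : Fin n) (lev' : Fin n → ℕ) (u v : Fin n), lev' u = t → lev' v = t →
      lev' w = t + 1 → Function.update (Function.update lev' u (t + 1)) v 0 w = t + 1 := by
    intro w lev' u v hu hv hw
    simp only [Function.update_apply]
    split_ifs with h₁ h₂
    · rw [h₁] at hw; omega
    · rfl
    · exact hw
  have hnew : ∀ (w : Fin n) (lev' : Fin n → ℕ) (u v : Fin n),
      Function.update (Function.update lev' u (t + 1)) v 0 w = t + 1 →
      w = u ∨ w ≠ u ∧ lev' w = t + 1 := by
    intro w lev' u v hw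
    simp only [Function.update_apply] at hw
    split_ifs at hw with h₁ h₂
    · exact Or.inl h₂
    · exact Or.inr ⟨h₂, hw⟩
  -- the matches of the kings
  obtain ⟨lev₁, lose₁, k₁, ⟨p₁, w₁⟩, m₁⟩ := run_phase h ht htn (e := equal (.var 21) kingExp)
    (cond := Tournament.condKing fun v => king (lab v - 1))
    (I := fun lev' lose' => T.IsPairing lab t lev lev' lose' ∧
      ∀ v, lev' v = t + 1 → v = king (lab v - 1))
    (fun s' lev' lose' h' hI u v hu h21 h22 => by
      have hr := hrange hI.1 u hu
      rw [holds_equal, h'.eval_kingExp h21 hr.1 hr.2]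
      simp [eval, h21, Tournament.condKing, Fin.ext_iff])
    ⟨hstart, fun v hv => by have := h₀.le v; omega⟩
    (fun lev' lose' u v hI hu hv hl hd hc =>
      ⟨Tournament.IsPairing.preserved T lab ht lev _ lev' lose' u v hI.1 hu hv hl hd hc,
        fun w hw => by
          rcases hnew w lev' u v hw with rfl | ⟨-, hw⟩
          · exact hc
          · exact hI.2 w hw⟩)
  have kw₁ : ∀ i < r, t ≤ i → lev₁ (king i) = t + 1 := fun i hi hti =>
    h₀.king_wins hlk p₁ w₁ m₁ hi hti
  -- the matches of the helpers of the kings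
  obtain ⟨lev₂, lose₂, k₂, ⟨p₂, kw₂, w₂⟩, m₂⟩ := run_phase k₁ ht htn
    (e := conj (domExp kingExp (.var 21)) (domExp (.var 22) kingExp))
    (cond := Tournament.condHelp T fun v => king (lab v - 1))
    (I := fun lev' lose' => T.IsPairing lab t lev lev' lose' ∧
      (∀ i < r, t ≤ i → lev' (king i) = t + 1) ∧
      ∀ v, lev' v = t + 1 → v = king (lab v - 1) ∨
        Tournament.condHelp T (fun v => king (lab v - 1)) v (lose' v))
    (fun s' lev' lose' h' hI u v hu h21 h22 => by
      have hr := hrange hI.1 u hu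
      have hk := h'.eval_kingExp h21 hr.1 hr.2
      rw [holds_conj, h'.ready.input.holds_domExp (b := .var 21) hk h21,
        h'.ready.input.holds_domExp (a := .var 22) h22 hk]
      rfl)
    ⟨p₁, kw₁, fun v hv => Or.inl (w₁ v hv)⟩
    (fun lev' lose' u v hI hu hv hl hd hc =>
      ⟨Tournament.IsPairing.preserved T lab ht lev _ lev' lose' u v hI.1 hu hv hl hd hc,
        fun i hi hti => hpreserved _ lev' u v hu hv (hI.2.1 i hi hti),
        fun w hw => by
          rcases hnew w lev' u v hw with rfl | ⟨hw', hw⟩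
          · right; simpa using hc
          · rw [Function.update_of_ne hw']
            exact hI.2.2 w hw⟩)
  have l₂ : ∀ a b, (lev₂ b = t ∨ lev₂ b = t + 1) → T.dom b (king (lab b - 1)) = true →
      lev a = t → lab a = lab b → T.dom (king (lab b - 1)) a = true → T.dom a b = true →
      a = lose₂ (king (lab b - 1)) ∨ lev₂ a = t + 1 := fun a b h₁ h₂ h₃ h₄ h₅ h₆ =>
    p₂.helpers_win w₂ m₂ h₁ h₂ h₃ h₄ h₅ h₆
  -- the other matches
  obtain ⟨lev₃, lose₃, k₃, ⟨p₃, kw₃, l₃⟩, m₃⟩ := run_phase k₂ ht htn (e := .const 1)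
    (cond := fun _ _ => True)
    (I := fun lev' lose' => T.IsPairing lab t lev lev' lose' ∧
      (∀ i < r, t ≤ i → lev' (king i) = t + 1) ∧
      ∀ a b, (lev' b = t ∨ lev' b = t + 1) → T.dom b (king (lab b - 1)) = true →
      lev a = t → lab a = lab b → T.dom (king (lab b - 1)) a = true → T.dom a b = true →
      a = lose₂ (king (lab b - 1)) ∨ lev' a = t + 1)
    (fun s' lev' lose' h' hI u v hu h21 h22 => by simp [Holds, eval])
    ⟨p₂, kw₂, l₂⟩
    (fun lev' lose' u v hI hu hv hl hd hc =>
      ⟨Tournament.IsPairing.preserved T lab ht lev (fun _ _ => True) lev' lose' u v hI.1 hu hv hl hd hc,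
        fun i hi hti => hpreserved _ lev' u v hu hv (hI.2.1 i hi hti),
        fun a b hb h₁ h₂ h₃ h₄ h₅ => by
          have hb' : lev' b = t ∨ lev' b = t + 1 := by
            rcases hb with hb | hb
            · simp only [Function.update_apply] at hb
              split_ifs at hb
              · omega
              · omega
              · exact Or.inl hb
            · rcases hnew b lev' u v hb with rfl | ⟨-, hb⟩
              · exact Or.inl hu
              · exact Or.inr hb
          exact (hI.2.2 a b hb' h₁ h₂ h₃ h₄ h₅).imp id (hpreserved a lev' u v hu hv)⟩)
  -- The exceptional helper is given by `lose₂` from the end of the second phase; the count only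
  -- needs that there is a single exception for each king.
  exact ⟨lev₃, lose₃, k₃, p₃, h₀.next ht p₃ m₃ kw₃ lose₂
    fun a b hb h₁ h₂ h₃ h₄ h₅ => l₃ a b (Or.inr hb) h₁ h₂ h₃ h₄ h₅⟩

end

end KnockoutProg

/-! ### From the rounds to the table of results -/

namespace Tournament

/-- Only the entries of winners count, so the entry of `x` is free to record the king beaten by `x`.
-/
lemma IsPairing.congr {V : Type} {T : Tournament V} {lab : V → ℕ} {t : ℕ} {lev₀ lev : V → ℕ}
    {lose lose' : V → V} (h : T.IsPairing lab t lev₀ lev lose)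
    (hl : ∀ v, lev v = t + 1 → lose' v = lose v) : T.IsPairing lab t lev₀ lev lose' where
  level := h.level
  winner v hv := by rw [hl v hv]; exact h.winner v hv
  inj v w hv hw e := h.inj v w hv hw (by rw [← hl v hv, ← hl w hw, e])
  loser v hv hv' := by
    obtain ⟨w, hw, e⟩ := h.loser v hv hv'
    exact ⟨w, hw, by rw [hl w hw, e]⟩

/-- The sequence of the rounds gives a table of the results. -/
lemma isRoundTable_of_rounds {V : Type} [Fintype V] {T : Tournament V} {r : ℕ} {lab : V → ℕ}
    {king : ℕ → V} {x : V} {L : ℕ → V → ℕ} {lose : ℕ → V → V} (hx : r < lab x)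
    (hlk : ∀ i < r, lab (king i) = i + 1) (hdom : ∀ i < r, T.dom x (king i) = true)
    (hinv : ∀ t, 1 ≤ t → t ≤ r + 1 → T.RoundInvariant r lab king t (L t))
    (hp : ∀ t, 1 ≤ t → t ≤ r → T.IsPairing lab t (L t) (L (t + 1)) (lose t) ∧
      lose t x = king (t - 1)) :
    T.IsRoundTable r lab king x (fun t v => v = x ∨ L (t + 1) v = t + 1) lose := by
  have hxL : ∀ t, 1 ≤ t → t ≤ r + 1 → L t x ≠ t := fun t h₁ h₂ h => by
    have := (hinv t h₁ h₂).lab_le x h; omega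
  have hkx : ∀ i < r, king i ≠ x := fun i hi h => T.dom_ne (hdom i hi) h.symm
  have hlx : ∀ t < r, lose (t + 1) x = king t := fun t ht => by
    rw [(hp (t + 1) (by omega) (by omega)).2, Nat.add_sub_cancel]
  have hw : ∀ t < r, ∀ v, L (t + 1 + 1) v = t + 1 + 1 → _ := fun t ht =>
    (hp (t + 1) (by omega) (by omega)).1.winner
  have hking : ∀ t < r, L (t + 1 + 1) (king t) ≠ t + 1 + 1 := fun t ht h => by
    have := (hinv (t + 1 + 1) (by omega) (by omega)).lab_le _ h
    rw [hlk t ht] at this; omega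
  -- The matches of `x` do not collide with those inside the classes: a winner of round `t + 1` has
  -- a label of at least `t + 2`, as has his loser, while the king beaten by `x` has the label `t +
  -- 1`.
  have hmix : ∀ t < r, ∀ v, L (t + 1 + 1) v = t + 1 + 1 → lose (t + 1) v ≠ king t := by
    intro t ht v hv h
    have h₁ := (hw t ht v hv).2.2.2.1
    have h₂ := (hinv (t + 1 + 1) (by omega) (by omega)).lab_le _ hv
    rw [h, hlk t ht] at h₁; omega
  refine ⟨Or.inl rfl, hlx, fun t ht v hv => ?_, fun t ht v hv => ?_, fun t ht v w hv hw' e => ?_,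
    fun t ht v hv => ?_, fun t ht v hv hvx => ?_⟩
  · exact hv.imp id fun h => (hw t ht v h).1
  · rcases hv with rfl | hv
    · rw [hlx t ht]
      refine ⟨Or.inr ((hinv (t + 1) (by omega) (by omega)).king_lev t ht le_rfl), ?_⟩
      rintro (h | h)
      · exact hkx t ht h
      · exact hking t ht h
    · obtain ⟨h₁, h₂, h₃, h₄, h₅⟩ := hw t ht v hv
      refine ⟨Or.inr h₂, ?_⟩
      rintro (h | h)
      · rw [h] at h₂
        exact hxL _ (by omega) (by omega) h₂
      · omega
  · rcases hv with rfl | hv <;> rcases hw' with rfl | hw'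
    · rfl
    · rw [hlx t ht] at e
      exact absurd e.symm (hmix t ht w hw')
    · rw [hlx t ht] at e
      exact absurd e (hmix t ht v hv)
    · exact (hp (t + 1) (by omega) (by omega)).1.inj v w hv hw' e
  · rcases hv with rfl | hv
    · rw [hlx t ht]; exact hdom t ht
    · exact (hw t ht v hv).2.2.2.2
  · rcases hv with rfl | hv
    · exact absurd rfl hvx
    · exact (hw t ht v hv).2.2.2.1

end Tournament

/-! ### All rounds and the expansion into a bracket -/

namespace KnockoutProg

open RamExp ForProg

lemma row_eq {n t t' : ℕ} {v v' : ℕ} (hv : v < n) (hv' : v' < n) (h : t * n + v = t' * n + v') :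
    t = t' ∧ v = v' := by
  have hn : 0 < n := by omega
  have e : t = t' := by
    have := congrArg (· / n) h
    simpa [Nat.add_div_of_dvd_right, Nat.mul_div_cancel, hn, Nat.div_eq_of_lt hv,
      Nat.div_eq_of_lt hv'] using this
  subst e
  exact ⟨rfl, by omega⟩

section

variable {n : ℕ} {T : Tournament (Fin n)} {x : Fin n} {r m : ℕ} {king : ℕ → Fin n}
  {s : RamState} {lab : Fin n → ℕ}

lemma FinalLabels.roundInvariant (h : FinalLabels T x r king lab) (hrn : r < n) :
    T.RoundInvariant r lab king 1 (fun v => if v = x then 0 else 1) := by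
  have hx : ∀ v, lab v ≤ r → v ≠ x := by
    rintro v hv rfl
    have := h.player; omega
  have heq : ∀ i < r, ∀ v, lab v = i + 1 → (if v = x then 0 else 1) = 1 := fun i hi v hv => by
    rw [if_neg (hx v (by omega))]
  refine ⟨fun v => ?_, fun v hv => ?_, fun i hi _ => ?_, fun i hi _ => ?_,
    fun i hi _ b hb hb' hbk => ?_⟩
  · split_ifs <;> simp
  · split_ifs at hv with hvx
    exact ⟨h.pos v, h.le v hvx⟩
  · rw [Nat.add_sub_cancel, ← h.card i hi]
    congr 1
    ext v
    simp only [Finset.mem_filter, Finset.mem_univ, true_and]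
    exact ⟨fun hv => hv.2, fun hv => ⟨heq i hi v hv, hv⟩⟩
  · exact heq i hi _ (h.king_lab i hi)
  · rw [Nat.add_sub_cancel]
    refine (h.superking i hi b hb' hbk).trans (Finset.card_le_card fun v hv => ?_)
    simp only [Finset.mem_filter, Finset.mem_univ, true_and] at hv ⊢
    exact ⟨heq i hi v hv.1, hv⟩

lemma run_initLevels (h : Ready T x r king s) :
    Ready T x r king ((ForProg.store 4 (.var 1) (.const 0)).run
      ((ForProg.forN 20 (.store 4 (.var 20) (.const 1))).run s)) ∧
    (∀ v : Fin n, ((ForProg.store 4 (.var 1) (.const 0)).run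
      ((ForProg.forN 20 (.store 4 (.var 20) (.const 1))).run s)).arr 4 v =
        if v = x then 0 else 1) := by
  have hn : 1 ≤ n := x.pos
  have key := forN_induction (v := 20) (c := .store 4 (.var 20) (.const 1)) rfl
    (fun i s' => Ready T x r king s' ∧ ∀ j < i, s'.arr 4 j = 1) (n := n) (s := s)
    h.input.size ?_ ?_
  · refine ⟨key.1.run _ rfl rfl rfl rfl rfl, fun v => ?_⟩
    simp only [run_store, eval, RamState.setArr_arr_self, key.1.input.player, Fin.val_inj,
      key.2 v v.2, Nat.zero_min]
  · exact ⟨h.setVar _ (by norm_num), fun j hj => by omega⟩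
  · rintro i hi s' h₀ h20 ⟨h₁, h₂⟩
    refine ⟨(h₁.run _ rfl rfl rfl rfl rfl).setVar _ (by norm_num), fun j hj => ?_⟩
    simp only [run_store, eval, RamState.setVar_arr, RamState.setArr_arr_self, h20, h₀]
    split_ifs with e
    · omega
    · exact h₂ j (by omega)

lemma run_rounds (h : Ready T x r king s) (hk : AreKings T x r king) (hrn : r < n)
    (hf : FinalLabels T x r king (labels n s)) (h5 : ∀ k, s.arr 5 k = 0) :
    ∃ P lose, T.IsRoundTable r (labels n s) king x P lose ∧ Ready T x r king (rounds.run s) ∧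
      ∀ t, 1 ≤ t → t ≤ r → ∀ v : Fin n, (rounds.run s).arr 5 (t * n + v) = lose t v := by
  classical
  obtain ⟨g₁, g₂⟩ := run_initLevels h
  have g₃ : ∀ k, ((ForProg.store 4 (.var 1) (.const 0)).run
      ((ForProg.forN 20 (.store 4 (.var 20) (.const 1))).run s)).arr 5 k < n := by
    intro k
    rw [run_arr_of_not_writesArr (c := .store 4 (.var 1) (.const 0)) rfl,
      run_arr_of_not_writesArr (c := .forN 20 (.store 4 (.var 20) (.const 1))) rfl, h5]
    omega
  have g₄ : labels n ((ForProg.store 4 (.var 1) (.const 0)).run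
      ((ForProg.forN 20 (.store 4 (.var 20) (.const 1))).run s)) = labels n s := by
    funext v
    simp only [labels]
    rw [run_arr_of_not_writesArr (c := .store 4 (.var 1) (.const 0)) rfl,
      run_arr_of_not_writesArr (c := .forN 20 (.store 4 (.var 20) (.const 1))) rfl]
  rw [rounds, run_seq, run_seq]
  generalize labels n s = lab at *
  generalize (ForProg.store 4 (.var 1) (.const 0)).run
      ((ForProg.forN 20 (.store 4 (.var 20) (.const 1))).run s) = s₀ at *
  have key := forN_induction (v := 20) (c := .ite (less (.var 20) (.var 2))
      (.seq (.assign 11 (.add (.var 20) (.const 1))) <| .seq round <|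
        .store 5 (.add (.mul (.var 11) (.var 0)) (.var 1)) (.entry 2 (.var 20))) .skip) rfl
    (fun i s' => Ready T x r king s' ∧ labels n s' = lab ∧ (∀ k, s'.arr 5 k < n) ∧
      ∃ (L : ℕ → Fin n → ℕ) (lose : ℕ → Fin n → Fin n),
        (∀ v : Fin n, s'.arr 4 v = L (min i r + 1) v) ∧
        (∀ t, 1 ≤ t → t ≤ min i r + 1 → T.RoundInvariant r lab king t (L t)) ∧
        ∀ t, 1 ≤ t → t ≤ min i r → T.IsPairing lab t (L t) (L (t + 1)) (lose t) ∧
          lose t x = king (t - 1) ∧ ∀ v : Fin n, s'.arr 5 (t * n + v) = lose t v)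
    (n := n) (s := s₀) g₁.input.size ?_ ?_
  · obtain ⟨h₁, -, -, L, lose, -, h₄, h₅⟩ := key
    rw [show min n r = r by omega] at h₄ h₅
    refine ⟨_, lose, Tournament.isRoundTable_of_rounds (by rw [hf.player]; exact hrn)
      hf.king_lab (fun i hi => hk.dom hi) h₄ fun t a b => ⟨(h₅ t a b).1, (h₅ t a b).2.1⟩, h₁,
      fun t a b => (h₅ t a b).2.2⟩
  · refine ⟨g₁.setVar _ (by norm_num), g₄, g₃, fun _ v => if v = x then 0 else 1,
      fun _ v => v, g₂, fun t a b => ?_, fun t a b => by omega⟩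
    obtain rfl : t = 1 := by omega
    exact hf.roundInvariant hrn
  · rintro i hi s' h₀ h20 ⟨h₁, h₂, h₃, L, lose, h₄, h₅, h₆⟩
    rw [run_ite]
    have hiff : Holds s' (less (.var 20) (.var 2)) ↔ i < r := by simp [eval, h20, h₁.rounds]
    split_ifs with hc
    · rw [hiff] at hc
      rw [show min i r = i by omega] at h₄ h₅ h₆
      rw [show min (i + 1) r = i + 1 by omega, run_seq, run_seq]
      -- The bound on array `5` turns its current row into a function to `Fin n`, although the row
      -- has not been computed yet.
      have hin : InRound T x r king lab (i + 1) (s'.arr 5) (L (i + 1))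
          (fun v => ⟨s'.arr 5 ((i + 1) * n + v), h₃ _⟩)
          ((ForProg.assign 11 (.add (.var 20) (.const 1))).run s') :=
        ⟨h₁.run _ rfl rfl rfl rfl rfl, h₂, by simp [run_assign, eval, h20, h₀]; omega, h₄,
          fun _ => rfl, fun _ _ => rfl⟩
      obtain ⟨lev', lose', k₁, k₂, k₃⟩ := run_round hin (by omega) (by omega) hf.king_lab
        (h₅ (i + 1) (by omega) le_rfl)
      have e20 : (round.run ((ForProg.assign 11 (.add (.var 20) (.const 1))).run s')).var 20 =
          i := (run_var_of_not_writesVar (c := round) rfl _).trans h20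
      generalize round.run ((ForProg.assign 11 (.add (.var 20) (.const 1))).run s') = s₂ at *
      -- The label `n` of `x` exceeds `r`, so `x` wins no match inside a class, and its entry can be
      -- used for the king.
      have hx : lev' x ≠ i + 1 + 1 := fun h => by
        have h₁ := k₃.lab_le x h
        rw [hf.player] at h₁; omega
      have e₂ : s₂.arr 2 i = king i := k₁.ready.kings i hc
      have hval : ∀ k, ((ForProg.store 5 (.add (.mul (.var 11) (.var 0)) (.var 1))
          (.entry 2 (.var 20))).run s₂).arr 5 k =
            if k = (i + 1) * n + x then (king i : ℕ) else s₂.arr 5 k := by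
        intro k
        simp only [run_store, eval, RamState.setArr_arr_self, k₁.round_eq, k₁.ready.input.size,
          k₁.ready.input.player, e20, e₂]
        split_ifs
        · omega
        · rfl
      have hlt : ∀ k, s₂.arr 5 k < n := by
        intro k
        by_cases hk : ∃ v : Fin n, k = (i + 1) * n + v
        · obtain ⟨v, rfl⟩ := hk
          rw [k₁.lose_eq]; exact (lose' v).2
        · rw [k₁.old k fun v e => hk ⟨v, e⟩]
          exact h₃ k
      refine ⟨(k₁.ready.run _ rfl rfl rfl rfl rfl).setVar _ (by norm_num), k₁.lab_eq,
        fun k => ?_, Function.update L (i + 1 + 1) lev',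
        Function.update lose (i + 1) (Function.update lose' x (king i)), fun v => ?_,
        fun t a b => ?_, fun t a b => ?_⟩
      · simp only [RamState.setVar_arr, hval]
        split_ifs
        · exact (king i).2
        · exact hlt k
      · rw [Function.update_self]
        exact k₁.lev_eq v
      · by_cases ht : t = i + 1 + 1
        · subst ht; rw [Function.update_self]; exact k₃
        · rw [Function.update_of_ne ht]; exact h₅ t a (by omega)
      · simp only [RamState.setVar_arr, hval]
        by_cases ht : t = i + 1
        · subst ht
          rw [Function.update_self, Function.update_self, Function.update_of_ne (by omega)]
          refine ⟨k₂.congr fun v hv => ?_, by simp, fun v => ?_⟩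
          · rw [Function.update_of_ne]
            rintro rfl; exact hx hv
          · by_cases hv : v = x
            · simp [hv]
            · have : (v : ℕ) ≠ x := fun e => hv (Fin.ext e)
              simp [hv, this, k₁.lose_eq]
        · rw [Function.update_of_ne ht, Function.update_of_ne (by omega),
            Function.update_of_ne (by omega)]
          obtain ⟨a₁, a₂, a₃⟩ := h₆ t a (by omega)
          refine ⟨a₁, a₂, fun v => ?_⟩
          rw [if_neg fun e => ht (row_eq v.2 x.2 e).1,
            k₁.old _ fun w e => ht (row_eq v.2 w.2 e).1, a₃]
    · rw [hiff] at hc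
      rw [show min i r = r by omega] at h₄ h₅ h₆
      rw [show min (i + 1) r = r by omega, run_skip]
      exact ⟨h₁.setVar _ (by norm_num), h₂, h₃, L, lose, h₄, h₅, h₆⟩

lemma run_copy (h : Ready T x r king s) {k : ℕ} {f : ℕ → Fin n} (hf : ∀ j < k, s.arr 1 j = f j)
    (hkn : k ≤ n) : ∀ j < k,
      ((ForProg.forN 21 (.store 6 (.var 21) (.entry 1 (.var 21)))).run s).arr 6 j = f j := by
  have key := forN_induction (v := 21) (c := .store 6 (.var 21) (.entry 1 (.var 21))) rfl
    (fun i s' => s'.arr 1 = s.arr 1 ∧ ∀ j < i, j < k → s'.arr 6 j = f j) (n := n) (s := s)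
    h.input.size ?_ ?_
  · exact fun j hj => key.2 j (by omega) hj
  · exact ⟨rfl, fun j hj => by omega⟩
  · rintro i hi s' h₀ h21 ⟨h₁, h₂⟩
    refine ⟨h₁, fun j hj hjk => ?_⟩
    simp only [run_store, eval, RamState.setVar_arr, RamState.setArr_arr_self, h21, h₀, h₁]
    split_ifs with e
    · subst e
      rw [hf j hjk]
      omega
    · exact h₂ j (by omega) hjk

/-- Array `1` is overwritten while it is doubled, so the old positions are read from the copy in
array `6`. The loop runs on beyond `k`, but it writes only at positions from `2 * k` on there. -/
lemma run_double (h : Ready T x r king s) {k t : ℕ} {f g : ℕ → Fin n} {loser : Fin n → Fin n}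
    (h11 : s.var 11 = t) (hf : ∀ j < k, s.arr 6 j = f j) (hkn : k ≤ n)
    (hl : ∀ v : Fin n, s.arr 5 (t * n + v) = loser v) (hg : ∀ j, g (2 * j) = f j)
    (hg' : ∀ j, g (2 * j + 1) = loser (f j)) : ∀ j < 2 * k,
      ((ForProg.forN 21 <| .seq (.store 1 (.add (.var 21) (.var 21)) (.entry 6 (.var 21))) <|
            .store 1 (.add (.add (.var 21) (.var 21)) (.const 1))
              (.entry 5 (.add (.mul (.var 11) (.var 0)) (.entry 6 (.var 21))))).run s).arr 1 j =
        g j := by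
  have key := forN_induction (v := 21)
    (c := .seq (.store 1 (.add (.var 21) (.var 21)) (.entry 6 (.var 21))) <|
            .store 1 (.add (.add (.var 21) (.var 21)) (.const 1))
              (.entry 5 (.add (.mul (.var 11) (.var 0)) (.entry 6 (.var 21))))) rfl
    (fun i s' => s'.arr 6 = s.arr 6 ∧ s'.arr 5 = s.arr 5 ∧ s'.var 11 = t ∧
      ∀ j < 2 * i, j < 2 * k → s'.arr 1 j = g j) (n := n) (s := s) h.input.size ?_ ?_
  · exact fun j hj => key.2.2.2 j (by omega) hj
  · exact ⟨rfl, rfl, h11, fun j hj => by omega⟩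
  · rintro i hi s' h₀ h21 ⟨h₁, h₂, h₃, h₄⟩
    refine ⟨h₁, h₂, h₃, fun j hj hjk => ?_⟩
    simp only [run_seq, run_store, eval, RamState.setVar_arr, RamState.setArr_var,
      RamState.setArr_arr_self, RamState.setArr_arr_of_ne _ _ _ (show 6 ≠ 1 by norm_num),
      RamState.setArr_arr_of_ne _ _ _ (show 5 ≠ 1 by norm_num), h21, h₀, h₁, h₂, h₃]
    split_ifs with e e'
    · subst e
      rw [hf i (by omega), hl, ← two_mul, hg']
      omega
    · subst e'
      rw [hf i (by omega), ← two_mul, hg]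
      omega
    · exact h₄ j (by omega) hjk

/-- The rounds are unfolded from the last to the first: step `i` inserts the losers of round `r -
i`. -/
lemma run_expand (h : Ready T x r king s) (hn : n = 2 ^ r) {lose : ℕ → Fin n → Fin n}
    (hl : ∀ t, 1 ≤ t → t ≤ r → ∀ v : Fin n, s.arr 5 (t * n + v) = lose t v) :
    ∀ j < n, (expand.run s).arr 1 j = Tournament.layout r lose x r j := by
  classical
  have hrn : r < n := hn ▸ Nat.lt_two_pow_self
  rw [expand, run_seq]
  have key := forN_induction (v := 20) (c := .ite (less (.var 20) (.var 2))
      (.seq (.assign 11 (.sub (.var 2) (.var 20))) <|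
        .seq (.forN 21 (.store 6 (.var 21) (.entry 1 (.var 21)))) <|
          .forN 21 <| .seq (.store 1 (.add (.var 21) (.var 21)) (.entry 6 (.var 21))) <|
            .store 1 (.add (.add (.var 21) (.var 21)) (.const 1))
              (.entry 5 (.add (.mul (.var 11) (.var 0)) (.entry 6 (.var 21))))) .skip) rfl
    (fun i s' => Ready T x r king s' ∧ s'.arr 5 = s.arr 5 ∧
      ∀ j < 2 ^ min i r, s'.arr 1 j = Tournament.layout r lose x (min i r) j)
    (n := n) (s := (ForProg.store 1 (.const 0) (.var 1)).run s) h.input.size ?_ ?_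
  · rw [show min n r = r by omega, ← hn] at key
    exact key.2.2
  · refine ⟨(h.run _ rfl rfl rfl rfl rfl).setVar _ (by norm_num), rfl, fun j hj => ?_⟩
    obtain rfl : j = 0 := by simpa using hj
    simp [run_store, eval, RamState.setArr_arr_self, h.input.player, h.input.size,
      Tournament.layout]
  · rintro i hi s' h₀ h20 ⟨h₁, h₂, h₃⟩
    rw [run_ite]
    have hiff : Holds s' (less (.var 20) (.var 2)) ↔ i < r := by simp [eval, h20, h₁.rounds]
    split_ifs with hc
    · rw [hiff] at hc
      rw [show min i r = i by omega] at h₃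
      rw [show min (i + 1) r = i + 1 by omega, run_seq, run_seq]
      have hpow : 2 ^ i ≤ n := hn ▸ Nat.pow_le_pow_right (by norm_num) hc.le
      have r₁ : Ready T x r king ((ForProg.assign 11 (.sub (.var 2) (.var 20))).run s') :=
        h₁.run _ rfl rfl rfl rfl rfl
      have e₁ : ((ForProg.assign 11 (.sub (.var 2) (.var 20))).run s').var 11 = r - i := by
        simp [run_assign, eval, h20, h₁.rounds, h₀]; omega
      have a₁ : ((ForProg.assign 11 (.sub (.var 2) (.var 20))).run s').arr 5 = s.arr 5 := h₂
      have b₁ : ∀ j < 2 ^ i, ((ForProg.assign 11 (.sub (.var 2) (.var 20))).run s').arr 1 j =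
          Tournament.layout r lose x i j := h₃
      generalize (ForProg.assign 11 (.sub (.var 2) (.var 20))).run s' = s₁ at *
      have r₂ : Ready T x r king
          ((ForProg.forN 21 (.store 6 (.var 21) (.entry 1 (.var 21)))).run s₁) :=
        r₁.run _ rfl rfl rfl rfl rfl
      have b₂ := run_copy r₁ b₁ hpow
      have e₂ := (run_var_of_not_writesVar (v := 11)
        (c := .forN 21 (.store 6 (.var 21) (.entry 1 (.var 21)))) rfl s₁).trans e₁
      have a₂ := (run_arr_of_not_writesArr (a := 5)
        (c := .forN 21 (.store 6 (.var 21) (.entry 1 (.var 21)))) rfl s₁).trans a₁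
      generalize (ForProg.forN 21 (.store 6 (.var 21) (.entry 1 (.var 21)))).run s₁ = s₂ at *
      have b₃ := run_double r₂ e₂ b₂ hpow (g := Tournament.layout r lose x (i + 1))
        (loser := lose (r - i)) (fun v => by rw [a₂]; exact hl (r - i) (by omega) (by omega) v)
        (fun j => by simp [Tournament.layout])
        (fun j => by
          simp only [Tournament.layout]
          rw [if_neg (by omega), show (2 * j + 1) / 2 = j by omega])
      refine ⟨(r₂.run _ rfl rfl rfl rfl rfl).setVar _ (by norm_num),
        (run_arr_of_not_writesArr (a := 5) rfl s₂).trans a₂, fun j hj => b₃ j ?_⟩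
      rw [pow_succ] at hj
      omega
    · rw [hiff] at hc
      rw [show min i r = r by omega] at h₃
      rw [show min (i + 1) r = r by omega, run_skip]
      exact ⟨h₁.setVar _ (by norm_num), h₂, h₃⟩

end

end KnockoutProg

/-! ### Correctness of the whole program -/

namespace KnockoutProg

open RamExp ForProg

/-- The program finds a bracket with superking blocks if the tournament is typical. -/
theorem run_main {r m : ℕ} {T : Tournament (Fin (2 ^ r))} {x : Fin (2 ^ r)}
    (hT : T.IsTypical r (13 * m) x) (hm : 2 ^ r = 128 * m) (hrm : r + 10 ≤ 2 * m)
    (hr : 2 ≤ r) :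
    ∃ σ : SEBracket (Fin (2 ^ r)) r, OutputsBracket (main.run (inputState T x)) σ ∧
      T.WinsUnder σ x ∧ T.HasSuperkingBlocks σ x := by
  have hrn : r < 2 ^ r := Nat.lt_two_pow_self
  have i₀ : Input T x (inputState T x) :=
    ⟨by simp [inputState], by simp [inputState], fun u v => inputState_matrix T x u v⟩
  have z₀ : ∀ a k, a ≠ 0 → (inputState T x).arr a k = 0 := fun a k ha => by
    simp [inputState, ha]
  rw [main, run_seq, run_seq, run_seq, run_seq, run_seq, run_seq, run_seq, run_seq, run_seq,
    run_seq]
  generalize inputState T x = s₀ at *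
  have i₁ : Input T x (roundNumber.run s₀) := i₀.run _ rfl rfl rfl
  have v₁ := run_roundNumber i₀.size
  have z₁ : ∀ a k, a ≠ 0 → (roundNumber.run s₀).arr a k = 0 := fun a k ha => by
    rw [run_arr_of_not_writesArr (c := roundNumber) rfl]; exact z₀ a k ha
  generalize roundNumber.run s₀ = s₁ at *
  have i₂ : Input T x ((capacity 4 13 128).run s₁) := i₁.run _ rfl rfl rfl
  have v₂ : ((capacity 4 13 128).run s₁).var 2 = r :=
    (run_var_of_not_writesVar (c := capacity 4 13 128) rfl _).trans v₁
  have c₂ := run_capacity (v := 4) (p := 13) (q := 128) (by norm_num) (by norm_num) (by norm_num)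
    (by norm_num) (i₁.size.trans hm)
  have z₂ : ∀ a k, a ≠ 0 → ((capacity 4 13 128).run s₁).arr a k = 0 := fun a k ha => by
    rw [run_arr_of_not_writesArr (c := capacity 4 13 128) rfl]; exact z₁ a k ha
  generalize (capacity 4 13 128).run s₁ = s₂ at *
  have i₃ : Input T x ((capacity 5 1 4).run s₂) := i₂.run _ rfl rfl rfl
  have v₃ : ((capacity 5 1 4).run s₂).var 2 = r :=
    (run_var_of_not_writesVar (c := capacity 5 1 4) rfl _).trans v₂
  have c₃ : ((capacity 5 1 4).run s₂).var 4 = 13 * m :=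
    (run_var_of_not_writesVar (c := capacity 5 1 4) rfl _).trans c₂
  have d₃ := run_capacity (v := 5) (p := 1) (q := 4) (m := 32 * m) (by norm_num) (by norm_num)
    (by norm_num) (by norm_num) (i₂.size.trans (hm.trans (by ring)))
  have z₃ : ∀ a k, a ≠ 0 → ((capacity 5 1 4).run s₂).arr a k = 0 := fun a k ha => by
    rw [run_arr_of_not_writesArr (c := capacity 5 1 4) rfl]; exact z₂ a k ha
  generalize (capacity 5 1 4).run s₂ = s₃ at *
  have i₄ : Input T x ((capacity 6 1 2).run s₃) := i₃.run _ rfl rfl rfl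
  have v₄ : ((capacity 6 1 2).run s₃).var 2 = r :=
    (run_var_of_not_writesVar (c := capacity 6 1 2) rfl _).trans v₃
  have c₄ : ((capacity 6 1 2).run s₃).var 4 = 13 * m :=
    (run_var_of_not_writesVar (c := capacity 6 1 2) rfl _).trans c₃
  have d₄ : ((capacity 6 1 2).run s₃).var 5 = 1 * (32 * m) :=
    (run_var_of_not_writesVar (c := capacity 6 1 2) rfl _).trans d₃
  have e₄ := run_capacity (v := 6) (p := 1) (q := 2) (m := 64 * m) (by norm_num) (by norm_num)
    (by norm_num) (by norm_num) (i₃.size.trans (hm.trans (by ring)))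
  have z₄ : ∀ a k, a ≠ 0 → ((capacity 6 1 2).run s₃).arr a k = 0 := fun a k ha => by
    rw [run_arr_of_not_writesArr (c := capacity 6 1 2) rfl]; exact z₃ a k ha
  generalize (capacity 6 1 2).run s₃ = s₄ at *
  obtain ⟨king, k₁, k₂⟩ := run_chooseKings i₄ v₄ hT.candidates
  have hk : AreKings T x r king := ⟨fun i hi => (k₁ i hi).2, k₂⟩
  have r₅ : Ready T x r king (chooseKings.run s₄) := ⟨i₄.run _ rfl rfl rfl,
    (run_var_of_not_writesVar (c := chooseKings) rfl _).trans v₄, fun i hi => (k₁ i hi).1⟩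
  have c₅ : (chooseKings.run s₄).var 4 = 13 * m :=
    (run_var_of_not_writesVar (c := chooseKings) rfl _).trans c₄
  have d₅ : (chooseKings.run s₄).var 5 = 32 * m :=
    (run_var_of_not_writesVar (c := chooseKings) rfl _).trans (d₄.trans (by ring))
  have e₅ : (chooseKings.run s₄).var 6 = 64 * m :=
    (run_var_of_not_writesVar (c := chooseKings) rfl _).trans (e₄.trans (by ring))
  have l₅ : ∀ v, labels (2 ^ r) (chooseKings.run s₄) v = 0 := fun v => by
    rw [labels, run_arr_of_not_writesArr (c := chooseKings) rfl]; exact z₄ 3 _ (by norm_num)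
  have z₅ : ∀ k, (chooseKings.run s₄).arr 5 k = 0 := fun k => by
    rw [run_arr_of_not_writesArr (c := chooseKings) rfl]; exact z₄ 5 k (by norm_num)
  generalize chooseKings.run s₄ = s₅ at *
  obtain ⟨r₆, f₆⟩ := run_labels r₅ hk hT rfl hm hrm hr c₅ d₅ e₅ l₅
  have z₆ : ∀ k, (fillLarge.run (fillSmall.run (labelKings.run (reserve.run s₅)))).arr 5 k = 0 :=
    fun k => by
      rw [run_arr_of_not_writesArr (c := fillLarge) rfl,
        run_arr_of_not_writesArr (c := fillSmall) rfl,
        run_arr_of_not_writesArr (c := labelKings) rfl,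
        run_arr_of_not_writesArr (c := reserve) rfl]
      exact z₅ k
  generalize fillLarge.run (fillSmall.run (labelKings.run (reserve.run s₅))) = s₆ at *
  obtain ⟨P, lose, ht, r₇, l₇⟩ := run_rounds r₆ hk hrn f₆ z₆
  have out := run_expand r₇ rfl l₇
  obtain ⟨σ, h₁, h₂, h₃⟩ := ht.exists_bracket f₆.king_lab f₆.card f₆.superking
  exact ⟨σ, fun j => by rw [out j j.2, h₁], h₂, h₃⟩

end KnockoutProg

/-! ### Lower tails in products of coins -/

section Coins

variable {ι : Type*} [Fintype ι] {μ : ι → Measure Bool} [∀ i, IsProbabilityMeasure (μ i)]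

lemma integral_bool_ite (ν : Measure Bool) [IsProbabilityMeasure ν] (b : Bool) (t : ℝ) :
    ∫ c, (if c = b then t else 1) ∂ν = 1 - (1 - t) * ν.real {b} := by
  have h : (fun c : Bool => if c = b then t else 1) =
      fun c => 1 - ({b} : Set Bool).indicator (fun _ => 1 - t) c := by
    funext c
    by_cases hc : c = b <;> simp [hc]
  rw [h, integral_sub (integrable_const _) (.of_finite), integral_indicator_const _ (by simp)]
  rw [integral_const, probReal_univ, smul_eq_mul, smul_eq_mul]
  ring

/-- The probability that fewer than `k` of the coins in `S` show the desired side. -/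
lemma measureReal_card_filter_lt_le (S : Finset ι) (b : ι → Bool) {q : ℝ}
    (hq : ∀ i ∈ S, q ≤ (μ i).real {b i}) (k : ℕ) :
    (Measure.pi μ).real {o | (S.filter fun i => o i = b i).card < k} ≤
      4 ^ k * Real.exp (-(3 / 4 * q * S.card)) := by
  classical
  -- Exponential Markov inequality with weight `1 / 4` per success: the indicator of `N < k` is at
  -- most `4 ^ k * (1 / 4) ^ N`, and each factor for a coin in `S` has mean at most `1 - 3 / 4 * q ≤
  -- exp (-(3 / 4 * q))`.
  let f : ι → Bool → ℝ := fun i c => if i ∈ S then (if c = b i then 1 / 4 else 1) else 1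
  have hf : ∀ i c, 0 < f i c := by
    intro i c
    simp only [f]
    split_ifs <;> norm_num
  have hprod : ∀ o : ι → Bool, ∏ i, f i (o i) =
      (1 / 4 : ℝ) ^ (S.filter fun i => o i = b i).card := by
    intro o
    simp only [f]
    rw [Finset.prod_ite_mem, Finset.univ_inter, Finset.prod_ite, Finset.prod_const,
      Finset.prod_const_one, mul_one]
  have hle : (Measure.pi μ).real {o | (S.filter fun i => o i = b i).card < k} ≤
      ∫ o, 4 ^ k * ∏ i, f i (o i) ∂(Measure.pi μ) := by
    rw [← integral_indicator_one (MeasurableSet.of_discrete)]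
    refine integral_mono .of_finite .of_finite fun o => ?_
    have hpos : 0 < 4 ^ k * ∏ i, f i (o i) :=
      mul_pos (by positivity) (Finset.prod_pos fun i _ => hf i _)
    by_cases ho : (S.filter fun i => o i = b i).card < k
    · rw [Set.indicator_of_mem (by exact ho), hprod, Pi.one_apply, one_div, inv_pow,
        ← div_eq_mul_inv, one_le_div (by positivity)]
      exact pow_le_pow_right₀ (by norm_num) ho.le
    · rw [Set.indicator_of_notMem (by exact ho)]
      exact hpos.le
  refine hle.trans ?_
  rw [integral_const_mul, integral_fintype_prod_eq_prod]
  refine mul_le_mul_of_nonneg_left ?_ (by positivity)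
  have hexp : Real.exp (-(3 / 4 * q * S.card)) =
      ∏ i, if i ∈ S then Real.exp (-(3 / 4 * q)) else 1 := by
    rw [Finset.prod_ite_mem, Finset.univ_inter, Finset.prod_const, ← Real.exp_nat_mul]
    congr 1
    ring
  rw [hexp]
  refine Finset.prod_le_prod (fun i _ => integral_nonneg fun c => (hf i c).le) fun i _ => ?_
  by_cases hi : i ∈ S
  · simp only [f, hi, if_true]
    rw [integral_bool_ite]
    have := Real.add_one_le_exp (-(3 / 4 * q))
    have := hq i hi
    linarith
  · simp [f, hi]

/-- The same for a set of coins that depends on the coins outside a fixed set `D`. -/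
lemma measureReal_card_filter_lt_le_of_agree (D : Finset ι) (S : (ι → Bool) → Finset ι)
    (hSD : ∀ o, S o ⊆ D) (hS : ∀ o o', (∀ i ∉ D, o i = o' i) → S o = S o') (b : ι → Bool) {q : ℝ}
    (hq₀ : 0 ≤ q) (hq : ∀ i ∈ D, q ≤ (μ i).real {b i}) (k l : ℕ) :
    (Measure.pi μ).real {o | l ≤ (S o).card ∧ ((S o).filter fun i => o i = b i).card < k} ≤
      4 ^ k * Real.exp (-(3 / 4 * q * l)) := by
  classical
  set A := {o | l ≤ (S o).card ∧ ((S o).filter fun i => o i = b i).card < k} with hA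
  set B := 4 ^ k * Real.exp (-(3 / 4 * q * l)) with hB
  have hB₀ : 0 ≤ B := by positivity
  -- By Fubini it is enough to bound the section for each outcome `y` of the coins outside `D`; on a
  -- section the set `S` is constant.
  have hmp := (measurePreserving_piEquivPiSubtypeProd μ (fun i => i ∉ D)).symm
  have hmeas : (Measure.pi μ) A ≤ ENNReal.ofReal B := by
    rw [← hmp.measure_preimage (MeasurableSet.of_discrete).nullMeasurableSet,
      Measure.prod_apply (MeasurableSet.of_discrete)]
    refine (lintegral_mono (g := fun _ => ENNReal.ofReal B) fun y => ?_).trans (by simp)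
    rw [← ofReal_measureReal]
    refine ENNReal.ofReal_le_ofReal ?_
    let j : ({i // ¬ (i ∉ D)} → Bool) → ι → Bool := fun w =>
      (MeasurableEquiv.piEquivPiSubtypeProd (fun _ => Bool) (fun i => i ∉ D)).symm (y, w)
    have hj : ∀ w i (hi : ¬ (i ∉ D)), j w i = w ⟨i, hi⟩ := by
      intro w i hi
      simp only [j, MeasurableEquiv.piEquivPiSubtypeProd, MeasurableEquiv.symm_mk,
        MeasurableEquiv.coe_mk, Equiv.piEquivPiSubtypeProd_symm_apply]
      rw [dif_neg hi]
    have hj' : ∀ w w', ∀ i ∉ D, j w i = j w' i := by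
      intro w w' i hi
      simp only [j, MeasurableEquiv.piEquivPiSubtypeProd, MeasurableEquiv.symm_mk,
        MeasurableEquiv.coe_mk, Equiv.piEquivPiSubtypeProd_symm_apply]
      rw [dif_pos hi, dif_pos hi]
    -- An arbitrary outcome inside `D`, used only to name the constant value of `S` on the section.
    let w₀ : {i // ¬ (i ∉ D)} → Bool := fun _ => true
    let S' : Finset {i // ¬ (i ∉ D)} := (S (j w₀)).subtype _
    have hcard : S'.card = (S (j w₀)).card := by
      rw [← Finset.card_map (Function.Embedding.subtype _), Finset.subtype_map,
        Finset.filter_true_of_mem fun i hi => not_not.mpr (hSD _ hi)]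
    have hcard' : ∀ w : {i // ¬ (i ∉ D)} → Bool, (S'.filter fun i => w i = b i.1).card =
        ((S (j w₀)).filter fun i => j w i = b i).card := by
      intro w
      rw [← Finset.card_map (Function.Embedding.subtype _)]
      congr 1
      ext i
      simp only [Finset.mem_map, Finset.mem_filter, S', Finset.mem_subtype,
        Function.Embedding.coe_subtype]
      constructor
      · rintro ⟨i, ⟨h₁, h₂⟩, rfl⟩
        exact ⟨h₁, by rw [hj w _ i.2, h₂]⟩
      · rintro ⟨h₁, h₂⟩
        refine ⟨⟨i, not_not.mpr (hSD _ h₁)⟩, ⟨h₁, ?_⟩, rfl⟩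
        rw [← hj w i, h₂]
    have hset : Prod.mk y ⁻¹' ((MeasurableEquiv.piEquivPiSubtypeProd (fun _ => Bool)
        (fun i => i ∉ D)).symm ⁻¹' A) =
        {w : {i // ¬ (i ∉ D)} → Bool | l ≤ S'.card ∧ (S'.filter fun i => w i = b i.1).card < k} := by
      ext w
      change j w ∈ A ↔ _
      simp only [hA, Set.mem_ofPred_eq]
      rw [hcard, hcard', hS (j w) (j w₀) (hj' w w₀)]
    rw [hset]
    by_cases hl : l ≤ S'.card
    · simp only [hl, true_and]
      refine (measureReal_card_filter_lt_le S' (fun i => b i) (q := q)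
        (fun i _ => hq i (not_not.mp i.2)) k).trans ?_
      refine mul_le_mul_of_nonneg_left (Real.exp_le_exp.mpr ?_) (by positivity)
      have : (l : ℝ) ≤ S'.card := by exact_mod_cast hl
      have := mul_le_mul_of_nonneg_left this (show 0 ≤ 3 / 4 * q by positivity)
      linarith
    · simp [hl, hB₀]
  exact ENNReal.toReal_le_of_le_ofReal hB₀ hmeas

end Coins

/-! ### Tails in the generalized random model -/

section Model

variable {n : ℕ}

/-- The unordered pairs of `z` and an element of `A`. -/
def edgesAt (z : Fin n) (A : Finset (Fin n)) : Finset (EdgePair n) :=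
  Finset.univ.filter fun e => e.1.1 = z ∧ e.1.2 ∈ A ∨ e.1.2 = z ∧ e.1.1 ∈ A

lemma card_edgesAt {z : Fin n} {A : Finset (Fin n)} (hz : z ∉ A) :
    (edgesAt z A).card = A.card := by
  refine Finset.card_bij (fun e _ => if e.1.1 = z then e.1.2 else e.1.1) ?_ ?_ ?_
  · rintro ⟨⟨i, j⟩, hij⟩ h
    simp only [edgesAt, Finset.mem_filter, Finset.mem_univ, true_and] at h ⊢
    split_ifs with hi
    · rcases h with h | h
      · exact h.2
      · exact absurd (hi ▸ h.2) hz
    · rcases h with h | h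
      · exact absurd h.1 hi
      · exact h.2
  · rintro ⟨⟨i, j⟩, hij⟩ h ⟨⟨i', j'⟩, hij'⟩ h'
    simp only [edgesAt, Finset.mem_filter, Finset.mem_univ, true_and] at h h' hij hij' ⊢
    intro heq
    simp only [Subtype.mk.injEq, Prod.mk.injEq]
    split_ifs at heq with h₁ h₂ h₂
    · exact ⟨h₁.trans h₂.symm, heq⟩
    · rcases h' with h' | h'
      · exact absurd h'.1 h₂
      · rw [heq, h₁] at hij
        rw [h'.1] at hij'
        exact absurd hij (lt_asymm hij')
    · rcases h with h | h
      · exact absurd h.1 h₁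
      · rw [h.1, heq] at hij
        rw [h₂] at hij'
        exact absurd hij (lt_asymm hij')
    · rcases h with h | h
      · exact absurd h.1 h₁
      rcases h' with h' | h'
      · exact absurd h'.1 h₂
      exact ⟨heq, h.1.trans h'.1.symm⟩
  · intro v hv
    have hvz : v ≠ z := fun h => hz (h ▸ hv)
    rcases lt_or_gt_of_ne hvz with h | h
    · exact ⟨⟨(v, z), h⟩, by simp [edgesAt, hv], by simp [hvz]⟩
    · exact ⟨⟨(z, v), h⟩, by simp [edgesAt, hv], by simp⟩

/-- The coin of a pair tells whether the smaller alternative dominates the larger one, so the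
desired side is reversed when `z` is the larger one. -/
lemma filter_edgesAt (o : EdgePair n → Bool) (z : Fin n) (A : Finset (Fin n)) (d : Bool) :
    ((edgesAt z A).filter fun e => o e = if e.1.1 = z then d else !d) =
      edgesAt z (A.filter fun v => (Tournament.ofOrientation o).dom z v = d) := by
  ext ⟨⟨i, j⟩, hij⟩
  simp only at hij
  simp only [edgesAt, Finset.mem_filter, Finset.mem_univ, true_and]
  by_cases hi : i = z
  · subst hi
    have hj : j ≠ i := hij.ne'
    simp [hj, Tournament.ofOrientation, hij]
  · by_cases hj : j = z
    · subst hj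
      cases d <;> simp [hi, Tournament.ofOrientation, hij, not_lt_of_gt hij]
    · simp [hi, hj]

lemma coinLaw_isProbability {t : ℝ} (h₀ : 0 ≤ t) (h₁ : t ≤ 1) :
    IsProbabilityMeasure (coinLaw t) :=
  ⟨by
    have : 0 ≤ 1 - t := by linarith
    simp [coinLaw, ← ENNReal.ofReal_add h₀ this]⟩

lemma coinLaw_real_singleton {t : ℝ} (h₀ : 0 ≤ t) (h₁ : t ≤ 1) (b : Bool) :
    (coinLaw t).real {b} = if b then t else 1 - t := by
  cases b <;> simp [coinLaw, measureReal_def, h₀, h₁]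

/-- Parameters in `[q, 1 - q]`. -/
structure IsBalanced (p : Fin n → Fin n → ℝ) (q : ℝ) : Prop where
  nonneg : 0 ≤ q
  lower : ∀ i j, i ≠ j → q ≤ p i j
  upper : ∀ i j, i ≠ j → p i j ≤ 1 - q

lemma IsBalanced.isProbability {p : Fin n → Fin n → ℝ} {q : ℝ} (h : IsBalanced p q)
    (e : EdgePair n) : IsProbabilityMeasure (coinLaw (p e.1.1 e.1.2)) := by
  have h₁ := h.lower _ _ e.2.ne
  have h₂ := h.upper _ _ e.2.ne
  have h₃ := h.nonneg
  exact coinLaw_isProbability (by linarith) (by linarith)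

lemma generalizedRandomModel_real (p : Fin n → Fin n → ℝ) (A : Set (Tournament (Fin n))) :
    (generalizedRandomModel p).real A =
      (Measure.pi fun e : EdgePair n => coinLaw (p e.1.1 e.1.2)).real
        (Tournament.ofOrientation ⁻¹' A) :=
  map_measureReal_apply (Measurable.of_discrete) trivial

lemma IsBalanced.isProbability_model {p : Fin n → Fin n → ℝ} {q : ℝ} (h : IsBalanced p q) :
    IsProbabilityMeasure (generalizedRandomModel p) := by
  have := h.isProbability
  exact Measure.isProbabilityMeasure_map (Measurable.of_discrete).aemeasurable

/-- Let `F T` be a set of alternatives that is disjoint from `W` and does not depend on the edges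
between `z` and the alternatives outside `W`. It is unlikely that `F T` is large and contains few
alternatives dominated by (or dominating) `z`. -/
lemma IsBalanced.measureReal_le {p : Fin n → Fin n → ℝ} {q : ℝ} (h : IsBalanced p q) {z : Fin n}
    {W : Finset (Fin n)} (hz : z ∈ W) (F : Tournament (Fin n) → Finset (Fin n))
    (hFW : ∀ T, ∀ v ∈ F T, v ∉ W)
    (hF : ∀ T T' : Tournament (Fin n), (∀ a b, (a = z → b ∈ W) → (b = z → a ∈ W) →
      T.dom a b = T'.dom a b) → F T = F T') (d : Bool) (k l : ℕ) :
    (generalizedRandomModel p).real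
        {T | l ≤ (F T).card ∧ ((F T).filter fun v => T.dom z v = d).card < k} ≤
      4 ^ k * Real.exp (-(3 / 4 * q * l)) := by
  have := h.isProbability
  have hzF : ∀ T, z ∉ F T := fun T hT => hFW T z hT hz
  rw [generalizedRandomModel_real]
  have hset : Tournament.ofOrientation ⁻¹'
        {T | l ≤ (F T).card ∧ ((F T).filter fun v => T.dom z v = d).card < k} =
      {o : EdgePair n → Bool | l ≤ (edgesAt z (F (.ofOrientation o))).card ∧
        ((edgesAt z (F (.ofOrientation o))).filter
          fun e => o e = if e.1.1 = z then d else !d).card < k} := by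
    ext o
    simp only [Set.mem_preimage, Set.mem_ofPred_eq]
    rw [filter_edgesAt, card_edgesAt (hzF _), card_edgesAt]
    exact fun hz => hzF _ (Finset.mem_of_mem_filter _ hz)
  rw [hset]
  refine measureReal_card_filter_lt_le_of_agree (edgesAt z (Finset.univ \ W)) _ ?_ ?_ _ h.nonneg
    ?_ k l
  · intro o e he
    simp only [edgesAt, Finset.mem_filter, Finset.mem_univ, true_and, Finset.mem_sdiff] at he ⊢
    exact he.imp (fun h => ⟨h.1, hFW _ _ h.2⟩) (fun h => ⟨h.1, hFW _ _ h.2⟩)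
  · intro o o' ho
    congr 1
    refine hF _ _ fun a b ha hb => ?_
    have key : ∀ e : EdgePair n, (e.1.1 = z → e.1.2 ∈ W) → (e.1.2 = z → e.1.1 ∈ W) →
        o e = o' e := by
      intro e h₁ h₂
      refine ho e ?_
      simp only [edgesAt, Finset.mem_filter, Finset.mem_univ, true_and, Finset.mem_sdiff]
      rintro (h | h)
      · exact h.2 (h₁ h.1)
      · exact h.2 (h₂ h.1)
    simp only [Tournament.ofOrientation]
    split_ifs with h₁ h₂
    · exact key _ ha hb
    · rw [key _ hb ha]
    · rfl
  · intro e _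
    have h₁ := h.lower _ _ e.2.ne
    have h₂ := h.upper _ _ e.2.ne
    have h₃ := h.nonneg
    rw [coinLaw_real_singleton (by linarith) (by linarith)]
    split_ifs <;> linarith

end Model

/-! ### Random tournaments are typical -/

namespace Tournament

variable {n : ℕ} (T : Tournament (Fin n))

lemma two_mul_sum_card_dom_add_card (L : Finset (Fin n)) :
    2 * (∑ v ∈ L, (L.filter fun w => T.dom v w = true).card) + L.card = L.card * L.card := by
  have h₁ : ∑ v ∈ L, (L.filter fun w => T.dom v w = true).card =
      ∑ v ∈ L, (L.filter fun w => T.dom w v = true).card :=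
    Finset.sum_card_bipartiteAbove_eq_sum_card_bipartiteBelow fun v w => T.dom v w = true
  have h₂ : ∀ v ∈ L, (L.filter fun w => T.dom v w = true).card +
      (L.filter fun w => T.dom w v = true).card + 1 = L.card := by
    intro v hv
    rw [← Finset.card_union_of_disjoint, ← Finset.card_erase_add_one hv]
    · congr 2
      ext w
      simp only [Finset.mem_union, Finset.mem_filter, Finset.mem_erase]
      constructor
      · rintro (h | h)
        · exact ⟨(T.dom_ne h.2).symm, h.1⟩
        · exact ⟨T.dom_ne h.2, h.1⟩
      · rintro ⟨h, hw⟩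
        exact (T.dom_or_dom h.symm).imp (fun h => ⟨hw, h⟩) (fun h => ⟨hw, h⟩)
    · rw [Finset.disjoint_left]
      intro w hw hw'
      simp only [Finset.mem_filter] at hw hw'
      have := T.dom_asymm hw.2
      simp_all
  have h₃ := Finset.sum_congr rfl h₂
  rw [Finset.sum_add_distrib, Finset.sum_add_distrib, ← h₁] at h₃
  simp only [Finset.sum_const, smul_eq_mul, mul_one] at h₃
  omega

/-- The average outdegree inside `L` is `(|L| - 1) / 2`; if all are at most `c - 1`, then `|L| ≤ 2 *
c - 1`. -/
lemma card_lt_of_card_dom_lt {L : Finset (Fin n)} {c : ℕ} (hc : 0 < c)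
    (hL : ∀ v ∈ L, (L.filter fun w => T.dom v w = true).card < c) : L.card < 2 * c := by
  by_contra! h
  have h₁ := T.two_mul_sum_card_dom_add_card L
  have h₂ : ∑ v ∈ L, (L.filter fun w => T.dom v w = true).card ≤ L.card * (c - 1) := by
    rw [← smul_eq_mul]
    exact Finset.sum_le_card_nsmul _ _ _ fun v hv => Nat.le_sub_one_of_lt (hL v hv)
  have h₃ : L.card * (2 * (c - 1) + 1) < L.card * L.card := by
    apply Nat.mul_lt_mul_of_pos_left <;> omega
  nlinarith

/-- The alternatives that dominate almost half of the alternatives other than `x`. -/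
def strong (x : Fin n) : Finset (Fin n) :=
  Finset.univ.filter fun v => v ≠ x ∧
    15 * n ≤ 32 * (Finset.univ.filter fun w => w ≠ x ∧ T.dom v w = true).card

/-- Each alternative other than `x` that is not strong dominates fewer than `60 m` of its kind, so
there are fewer than `120 m` of them. -/
lemma le_card_strong {m : ℕ} (hm : 0 < m) (hn : n = 128 * m) (x : Fin n) :
    8 * m ≤ (T.strong x).card := by
  have hL : ((Finset.univ.erase x) \ T.strong x).card < 2 * (60 * m) := by
    refine T.card_lt_of_card_dom_lt (by omega) fun v hv => ?_
    simp only [strong, Finset.mem_sdiff, Finset.mem_erase, Finset.mem_univ, Finset.mem_filter,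
      true_and, and_true, not_and, not_le] at hv
    have h₁ := hv.2 hv.1
    refine lt_of_le_of_lt (b := (Finset.univ.filter fun w => w ≠ x ∧ T.dom v w = true).card)
      (Finset.card_le_card fun w hw => ?_) (by omega)
    simp only [Finset.mem_filter, Finset.mem_sdiff, Finset.mem_erase] at hw ⊢
    exact ⟨Finset.mem_univ _, hw.1.1.1, hw.2⟩
  have h₁ := Finset.le_card_sdiff (T.strong x) (Finset.univ.erase x)
  rw [Finset.card_erase_of_mem (Finset.mem_univ _), Finset.card_univ, Fintype.card_fin] at h₁
  omega

lemma strong_filter_subset_candidates (x : Fin n) :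
    ((T.strong x).filter fun v => T.dom x v = true) ⊆ T.candidates x := by
  intro v hv
  simp only [strong, Finset.mem_filter, Finset.mem_univ, true_and] at hv
  refine Finset.mem_filter.mpr ⟨Finset.mem_univ _, hv.2,
    hv.1.2.trans (Nat.mul_le_mul_left _ (Finset.card_le_card fun w hw => ?_))⟩
  simp only [Finset.mem_filter, Finset.mem_univ, true_and] at hw ⊢
  exact hw.2

variable {T}

lemma dominated_congr {T' : Tournament (Fin n)} {y : Fin n} (h : ∀ v, T.dom y v = T'.dom y v) :
    T.dominated y = T'.dominated y := by
  simp only [dominated, h]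

lemma card_firstReserve {m : ℕ} (hn : n = 128 * m) {y : Fin n} (hy : 15 * n ≤ 32 * T.outdegree y) :
    (T.firstReserve (13 * m) y).card = 13 * m := by
  rw [firstReserve, card_firstElements]
  change 15 * n ≤ 32 * (T.dominated y).card at hy
  omega

lemma card_secondReserve {m : ℕ} (hn : n = 128 * m) {y' y : Fin n}
    (hy' : 15 * n ≤ 32 * T.outdegree y') (hy : 15 * n ≤ 32 * T.outdegree y) :
    (T.secondReserve (13 * m) y' y).card = 13 * m := by
  rw [secondReserve, card_firstElements]
  have h := Finset.le_card_sdiff (T.firstReserve (13 * m) y') (T.dominated y)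
  rw [card_firstReserve hn hy'] at h
  change 15 * n ≤ 32 * (T.dominated y).card at hy
  omega

end Tournament

namespace IsBalanced

variable {n m : ℕ} {p : Fin n → Fin n → ℝ} {q : ℝ}

/-- The set `strong x` disregards the edges at `x`, which therefore are independent of it; each
strong alternative dominated by `x` is a candidate. -/
lemma measureReal_candidates_le (h : IsBalanced p q) (hm : 0 < m) (hn : n = 128 * m) (x : Fin n)
    (k : ℕ) :
    (generalizedRandomModel p).real {T | (T.candidates x).card < k} ≤
      4 ^ k * Real.exp (-(3 / 4 * q * (8 * m : ℕ))) := by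
  have := h.isProbability_model
  refine (measureReal_mono ?_).trans (h.measureReal_le (z := x) (W := {x}) (by simp)
    (fun T => T.strong x) ?_ ?_ true k (8 * m))
  · intro T hT
    exact ⟨T.le_card_strong hm hn x, (Finset.card_le_card
      (T.strong_filter_subset_candidates x)).trans_lt hT⟩
  · intro T v hv
    simp only [Tournament.strong, Finset.mem_filter] at hv
    simpa using hv.2.1
  · intro T T' hT
    ext v
    simp only [Tournament.strong, Finset.mem_filter, Finset.mem_univ, true_and]
    refine and_congr_right fun hv => ?_
    have : (Finset.univ.filter fun w => w ≠ x ∧ T.dom v w = true) =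
        Finset.univ.filter fun w => w ≠ x ∧ T'.dom v w = true := by
      refine Finset.filter_congr fun w _ => and_congr_right fun hw => ?_
      rw [hT v w (fun h => absurd h hv) (fun h => absurd h hw)]
    rw [this]

/-- A tail bound for sets that only depend on the edges at two alternatives. -/
lemma measureReal_reserve_le (h : IsBalanced p q) (y' y z : Fin n) (hz' : z ≠ y') (hz : z ≠ y)
    (R : Tournament (Fin n) → Finset (Fin n))
    (hR : ∀ T T' : Tournament (Fin n), (∀ v, T.dom y' v = T'.dom y' v) →
      (∀ v, T.dom y v = T'.dom y v) → R T = R T') (k l : ℕ) :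
    (generalizedRandomModel p).real {T | l ≤ (R T).card ∧
        ((R T).filter fun v => T.dom v z = true).card < k} ≤
      4 ^ k * Real.exp (-(3 / 4 * q * (l - 3 : ℕ))) := by
  have := h.isProbability_model
  -- The set `R T` may depend on the edges between `z` and the kings, so `y'` and `y` are excluded
  -- along with `z`; this costs at most three elements of `R T`.
  have hW : ({z, y', y} : Finset (Fin n)).card ≤ 3 := Finset.card_le_three
  refine (measureReal_mono ?_).trans (h.measureReal_le (z := z) (W := {z, y', y}) (by simp)
    (fun T => R T \ {z, y', y}) ?_ ?_ false k (l - 3))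
  · rintro T ⟨h₁, h₂⟩
    refine ⟨?_, lt_of_le_of_lt (Finset.card_le_card fun v hv => ?_) h₂⟩
    · have := Finset.le_card_sdiff ({z, y', y} : Finset (Fin n)) (R T)
      omega
    · simp only [Finset.mem_filter, Finset.mem_sdiff, Finset.mem_insert, not_or] at hv ⊢
      refine ⟨hv.1.1, ?_⟩
      rw [T.antisymm z v (Ne.symm hv.1.2.1), hv.2]
      rfl
  · intro T v hv
    exact (Finset.mem_sdiff.mp hv).2
  · intro T T' hT
    rw [hR T T']
    · exact fun v => hT _ _ (fun h => absurd h.symm hz') (fun _ => by simp)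
    · exact fun v => hT _ _ (fun h => absurd h.symm hz) (fun _ => by simp)

lemma measureReal_firstReserve_le (h : IsBalanced p q) (hn : n = 128 * m) (y z : Fin n) (k : ℕ) :
    (generalizedRandomModel p).real {T | z ≠ y ∧ 15 * n ≤ 32 * T.outdegree y ∧
        ((T.firstReserve (13 * m) y).filter fun v => T.dom v z = true).card < k} ≤
      4 ^ k * Real.exp (-(3 / 4 * q * (13 * m - 3 : ℕ))) := by
  have := h.isProbability_model
  by_cases hz : z ≠ y
  · refine (measureReal_mono ?_).trans (h.measureReal_reserve_le y y z hz hz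
      (fun T => T.firstReserve (13 * m) y) ?_ k (13 * m))
    · rintro T ⟨-, h₁, h₂⟩
      exact ⟨(Tournament.card_firstReserve hn h₁).ge, h₂⟩
    · intro T T' hT _
      rw [Tournament.firstReserve, Tournament.firstReserve, Tournament.dominated_congr hT]
  · simp only [hz, false_and]
    simp only [Set.ofPred_false, measureReal_empty]
    positivity

lemma measureReal_secondReserve_le (h : IsBalanced p q) (hn : n = 128 * m) (y' y z : Fin n)
    (k : ℕ) :
    (generalizedRandomModel p).real {T | z ≠ y' ∧ z ≠ y ∧ 15 * n ≤ 32 * T.outdegree y' ∧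
        15 * n ≤ 32 * T.outdegree y ∧
        ((T.secondReserve (13 * m) y' y).filter fun v => T.dom v z = true).card < k} ≤
      4 ^ k * Real.exp (-(3 / 4 * q * (13 * m - 3 : ℕ))) := by
  have := h.isProbability_model
  by_cases hz : z ≠ y' ∧ z ≠ y
  · refine (measureReal_mono ?_).trans (h.measureReal_reserve_le y' y z hz.1 hz.2
      (fun T => T.secondReserve (13 * m) y' y) ?_ k (13 * m))
    · rintro T ⟨-, -, h₁, h₂, h₃⟩
      exact ⟨(Tournament.card_secondReserve hn h₁ h₂).ge, h₃⟩
    · intro T T' hT hT'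
      rw [Tournament.secondReserve, Tournament.secondReserve, Tournament.firstReserve,
        Tournament.firstReserve, Tournament.dominated_congr hT, Tournament.dominated_congr hT']
  · simp only [← and_assoc, hz, false_and]
    simp only [Set.ofPred_false, measureReal_empty]
    positivity

/-- The kings depend on the tournament, so the union bound runs over all alternatives that could be
kings: over `x`, over pairs `(y, z)` and over triples `(y', y, z)`. -/
lemma measureReal_not_isTypical_le (h : IsBalanced p q) (hm : 0 < m) (hn : n = 128 * m) (r : ℕ) :
    (generalizedRandomModel p).real {T | ∀ x, T.IsTypical r (13 * m) x}ᶜ ≤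
      n * (4 ^ r * Real.exp (-(3 / 4 * q * (8 * m : ℕ)))) +
      (n ^ 2 + n ^ 3) * (4 ^ (2 * r) * Real.exp (-(3 / 4 * q * (13 * m - 3 : ℕ)))) := by
  have := h.isProbability_model
  set B₁ : Fin n → Set (Tournament (Fin n)) := fun x => {T | (T.candidates x).card < r}
  set B₂ : Fin n × Fin n → Set (Tournament (Fin n)) := fun e => {T | e.2 ≠ e.1 ∧
    15 * n ≤ 32 * T.outdegree e.1 ∧
    ((T.firstReserve (13 * m) e.1).filter fun v => T.dom v e.2 = true).card < 2 * r}
  set B₃ : Fin n × Fin n × Fin n → Set (Tournament (Fin n)) := fun e => {T | e.2.2 ≠ e.1 ∧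
    e.2.2 ≠ e.2.1 ∧ 15 * n ≤ 32 * T.outdegree e.1 ∧ 15 * n ≤ 32 * T.outdegree e.2.1 ∧
    ((T.secondReserve (13 * m) e.1 e.2.1).filter fun v => T.dom v e.2.2 = true).card < 2 * r}
  have hsub : {T : Tournament (Fin n) | ∀ x, T.IsTypical r (13 * m) x}ᶜ ⊆
      (⋃ e, B₁ e) ∪ ((⋃ e, B₂ e) ∪ ⋃ e, B₃ e) := by
    intro T hT
    by_contra hB
    simp only [Set.mem_union, Set.mem_iUnion, not_or, not_exists] at hB
    refine hT fun x => ⟨?_, ?_, ?_⟩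
    · exact not_lt.mp (hB.1 x)
    · intro y z hz hy
      by_contra! hlt
      exact hB.2.1 (y, z) ⟨hz, hy, hlt⟩
    · intro y' y z hz' hz hy' hy
      by_contra! hlt
      exact hB.2.2 (y', y, z) ⟨hz', hz, hy', hy, hlt⟩
  have key : ∀ {ι : Type} [Fintype ι] (B : ι → Set (Tournament (Fin n))) (b : ℝ),
      (∀ e, (generalizedRandomModel p).real (B e) ≤ b) →
      (generalizedRandomModel p).real (⋃ e, B e) ≤ Fintype.card ι * b := by
    intro ι _ B b hb
    refine (measureReal_iUnion_fintype_le B).trans ?_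
    refine (Finset.sum_le_card_nsmul _ _ b fun e _ => hb e).trans ?_
    simp
  have h₁ := key B₁ _ fun x => h.measureReal_candidates_le hm hn x r
  have h₂ := key B₂ _ fun e => h.measureReal_firstReserve_le hn e.1 e.2 (2 * r)
  have h₃ := key B₃ _ fun e => h.measureReal_secondReserve_le hn e.1 e.2.1 e.2.2 (2 * r)
  have h₄ := (measureReal_mono hsub (by finiteness) (μ := generalizedRandomModel p)).trans
    ((measureReal_union_le _ _).trans (add_le_add_right (measureReal_union_le _ _) _))
  simp only [Fintype.card_prod, Fintype.card_fin] at h₁ h₂ h₃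
  rw [Nat.cast_mul] at h₂ h₃
  rw [Nat.cast_mul] at h₃
  refine h₄.trans ((add_le_add h₁ (add_le_add h₂ h₃)).trans (le_of_eq ?_))
  ring

end IsBalanced

/-! ### The failure probability and the theorem -/

/-- The failure probability in terms of the number of alternatives. -/
lemma failure_bound_le {r m : ℕ} (hm : 5 ≤ m) (hr : 2 ^ r = 128 * m) {q : ℝ}
    (hq : q = 100 * Real.log (2 ^ r) / 2 ^ r) :
    ((2 ^ r : ℕ) : ℝ) * (4 ^ r * Real.exp (-(3 / 4 * q * (8 * m : ℕ)))) +
      (((2 ^ r : ℕ) : ℝ) ^ 2 + ((2 ^ r : ℕ) : ℝ) ^ 3) *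
        (4 ^ (2 * r) * Real.exp (-(3 / 4 * q * (13 * m - 3 : ℕ)))) ≤
      3 * Real.exp (-(1 / 4 * Real.log (2 ^ r))) := by
  set l := Real.log (2 ^ r) with hl
  have hN : ((2 : ℝ) ^ r) = Real.exp l := (Real.exp_log (by positivity)).symm
  have hl₀ : 0 ≤ l := Real.log_nonneg (one_le_pow₀ (by norm_num))
  have hrm : (2 : ℝ) ^ r = 128 * m := by exact_mod_cast hr
  have hm' : (5 : ℝ) ≤ m := by exact_mod_cast hm
  have h4 : (4 : ℝ) ^ r = Real.exp (2 * l) := by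
    rw [show (4 : ℝ) = 2 ^ 2 by norm_num, ← pow_mul, mul_comm, pow_mul, hN, ← Real.exp_nat_mul]
    norm_num
  have h4' : (4 : ℝ) ^ (2 * r) = Real.exp (4 * l) := by
    rw [mul_comm, pow_mul, h4, ← Real.exp_nat_mul]
    congr 1
    push_cast
    ring
  have hc : (((13 * m - 3 : ℕ)) : ℝ) = 13 * m - 3 := by
    rw [Nat.cast_sub (by omega)]
    push_cast
    ring
  -- The exact coefficient is `75 / 16`; it has to exceed `3`, one for the choice of `x` and two for
  -- `4 ^ r = n ^ 2`.
  have e₁ : 37 / 8 * l ≤ 3 / 4 * q * (8 * m : ℕ) := by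
    rw [hq, hrm]
    push_cast
    have : 3 / 4 * (100 * l / (128 * m)) * (8 * m) = 75 / 16 * l := by
      field_simp
      ring
    rw [this]
    linarith
  -- The critical estimate: `n ^ 3` triples and `4 ^ (2 * r) = n ^ 4` require an exponent above `7`.
  -- The coefficient `75 * (13 * m - 3) / (128 * m)` is at least `29 / 4` because `47 * m ≥ 225`,
  -- that is, for `m ≥ 5`; the surplus `1 / 4` is the final rate.
  have e₂ : 29 / 4 * l ≤ 3 / 4 * q * (13 * m - 3 : ℕ) := by
    rw [hq, hrm, hc]
    have : 3 / 4 * (100 * l / (128 * m)) * (13 * m - 3 : ℝ) =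
        l * (75 * (13 * m - 3) / (128 * m)) := by
      field_simp
      ring
    rw [this, mul_comm]
    refine mul_le_mul_of_nonneg_left ?_ hl₀
    rw [le_div_iff₀ (by positivity)]
    linarith
  push_cast
  rw [h4, h4', hN, ← Real.exp_nat_mul, ← Real.exp_nat_mul, add_mul]
  simp only [← Real.exp_add]
  have b₁ : l + (2 * l + -(3 / 4 * q * (8 * m : ℕ))) ≤ -(1 / 4 * l) := by linarith
  have b₂ : ((2 : ℕ) : ℝ) * l + (4 * l + -(3 / 4 * q * (13 * m - 3 : ℕ))) ≤ -(1 / 4 * l) := by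
    push_cast at e₂ ⊢
    linarith
  have b₃ : ((3 : ℕ) : ℝ) * l + (4 * l + -(3 / 4 * q * (13 * m - 3 : ℕ))) ≤ -(1 / 4 * l) := by
    push_cast at e₂ ⊢
    linarith
  have c₁ := Real.exp_le_exp.mpr b₁
  have c₂ := Real.exp_le_exp.mpr b₂
  have c₃ := Real.exp_le_exp.mpr b₃
  push_cast at c₁ c₂ c₃ ⊢
  linarith

theorem mainTheorem6 :
    ∃ (prog : RamProg) (q : Polynomial ℕ),
      -- on every input, the program halts within polynomially many steps
      (∀ (r : ℕ) (T : Tournament (Fin (2 ^ r))) (x : Fin (2 ^ r)),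
        ∃ (t : ℕ) (s : RamState), Runs prog (inputState T x) t s ∧ t ≤ q.eval (2 ^ r)) ∧
      -- with high probability, it outputs a winning bracket for every alternative
      (∀ ε : ℝ, 0 < ε → ∃ r₀ : ℕ, ∀ r : ℕ, r₀ ≤ r →
        ∀ p : Fin (2 ^ r) → Fin (2 ^ r) → ℝ,
          (∀ i j, i ≠ j → p i j + p j i = 1) →
          (∀ i j, i ≠ j →
            p i j ∈ Set.Icc (100 * Real.log (2 ^ r) / 2 ^ r)
              (1 - 100 * Real.log (2 ^ r) / 2 ^ r)) →
          1 - ε ≤ (generalizedRandomModel p).real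
            {T | ∀ x : Fin (2 ^ r), T.IsSingleEliminationWinner x ∧
              ∃ (t : ℕ) (s : RamState) (σ : SEBracket (Fin (2 ^ r)) r),
                Runs prog (inputState T x) t s ∧ t ≤ q.eval (2 ^ r) ∧
                OutputsBracket s σ ∧ T.WinsUnder σ x ∧ T.HasSuperkingBlocks σ x}) := by
  obtain ⟨P, hP⟩ := ForProg.exists_polynomial_runs KnockoutProg.main_wellFormed
  refine ⟨KnockoutProg.main.compile, P, fun r T x => ?_, fun ε hε => ?_⟩
  · obtain ⟨t, ht, ht'⟩ := (hP _ _ (inputState_bounded T x)).2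
    exact ⟨t, _, ht, ht'⟩
  have hlim : Filter.Tendsto (fun r : ℕ => 3 * Real.exp (-(1 / 4 * Real.log (2 ^ r))))
      Filter.atTop (nhds 0) := by
    have h₀ : (0 : ℝ) = 3 * 0 := by norm_num
    rw [h₀]
    refine Filter.Tendsto.const_mul 3 (Real.tendsto_exp_neg_atTop_nhds_zero.comp
      (Filter.Tendsto.const_mul_atTop (by norm_num) (Real.tendsto_log_atTop.comp
        (tendsto_pow_atTop_atTop_of_one_lt (by norm_num)))))
  obtain ⟨r₁, hr₁⟩ := Filter.eventually_atTop.mp (hlim.eventually (gt_mem_nhds hε))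
  -- From `r ≥ 12` on, `m = 2 ^ (r - 7)` satisfies `m ≥ 5` and `r + 10 ≤ 2 * m`.
  refine ⟨max r₁ 12, fun r hr p _ hp => ?_⟩
  obtain ⟨s, rfl⟩ : ∃ s, r = s + 7 := ⟨r - 7, by omega⟩
  have hs : 5 ≤ s := by omega
  have hm : 2 ^ (s + 7) = 128 * 2 ^ s := by rw [pow_add]; ring
  have hsm : s + 17 ≤ 2 * 2 ^ s ∧ 5 ≤ 2 ^ s := by
    clear * - hs
    induction s, hs using Nat.le_induction with
    | base => norm_num
    | succ s _ ih => rw [pow_succ]; omega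
  have hb : IsBalanced p (100 * Real.log (2 ^ (s + 7)) / 2 ^ (s + 7)) :=
    { nonneg := by
        have : 0 ≤ Real.log (2 ^ (s + 7)) := Real.log_nonneg (one_le_pow₀ (by norm_num))
        positivity
      lower := fun i j hij => (hp i j hij).1
      upper := fun i j hij => (hp i j hij).2 }
  have := hb.isProbability_model
  have hfail := (hb.measureReal_not_isTypical_le (by positivity) hm (s + 7)).trans
    (failure_bound_le hsm.2 hm rfl)
  have hε' := hr₁ (s + 7) (by omega)
  rw [probReal_compl_eq_one_sub (MeasurableSpace.measurableSet_top)] at hfail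
  refine le_trans (by linarith) (measureReal_mono (fun T hT => ?_)
    (s₁ := {T : Tournament (Fin (2 ^ (s + 7))) | ∀ x, T.IsTypical (s + 7) (13 * 2 ^ s) x}))
  intro x
  obtain ⟨σ, hσ, hwin, hblocks⟩ :=
    KnockoutProg.run_main (hT x) hm (by omega) (by omega)
  obtain ⟨t, ht, ht'⟩ := (hP _ _ (inputState_bounded T x)).2
  exact ⟨⟨σ, hwin⟩, t, _, σ, ht, ht', hσ, hwin, hblocks⟩
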